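/- Let $n,l$ be positive integers. For a permutation $\sigma$ put $\nu(\sigma)=\sum_{i\ge 1}(i-1)m_i(\sigma)$, where $m_i(\sigma)$ is the number of $i$-cycles of $\sigma$, and for $\alpha\in\mathbb C$ let $$\det{}^{(\alpha)}(X)=\sum_{\sigma\in\mathfrak S_n}\alpha^{\nu(\sigma)}x_{\sigma(1)1}x_{\sigma(2)2}\cdots x_{\sigma(n)n}$$ in the polynomial algebra $\mathcal A=\mathbb C[x_{ij}\,;\,1\le i,j\le n]$. The universal enveloping algebra $U(\mathfrak{gl}_n)$, $\mathfrak{gl}_n=\mathfrak{gl}_n(\mathbb C)$, acts on $\mathcal A$ by $E_{ij}\cdot f=\sum_{s=1}^n x_{is}\,\partial f/\partial x_{js}$; consider the cyclic module $U(\mathfrak{gl}_n)\cdot\det^{(\alpha)}(X)^l\subseteq\mathcal A$. Let $K=\{g\in\mathfrak S_{nl}: \lceil g(x)/l\rceil=\lceil x/l\rceil \text{ for all } x\}$ and $H=\{g\in\mathfrak S_{nl}: g(x)\equiv x \pmod l\text{ for all } x\}$ be the row group and the column group of the standard tableau of shape $(l^n)$ with $(i,j)$-entry $(i-1)l+j$.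 For a partition $\lambda\vdash nl$ with at most $n$ parts let $S^\lambda$ be the Specht module of $\mathfrak S_{nl}$, written as a right module, with an $\mathfrak S_{nl}$-invariant inner product $\langle\cdot,\cdot\rangle$, linear in the first argument. Let $d$ be the dimension of the space $(S^\lambda)^K$ of $K$-invariant vectors, and let $e_1,\dots,e_f$ be any orthonormal basis of $S^\lambda$ whose first $d$ vectors span $(S^\lambda)^K$. Put $\psi^\lambda_{ij}(g)=\langle e_i\cdot g,e_j\rangle$ and $$F^\lambda(\alpha)=\Bigl(\sum_{h\in H}\alpha^{\nu(h)}\psi^\lambda_{ij}(h)\Bigr)_{1\le i,j\le d}.$$ Then, for every such $\lambda$ and basis, $d$ equals the Kostka number $K_{\lambda,(l^n)}$, and for every $\alpha\in\mathbb C$ the multiplicity of the irreducible $U(\mathfrak{gl}_n)$-module $M^\lambda$ of highest weight $\lambda$ in $U(\mathfrak{gl}_n)\cdot\det^{(\alpha)}(X)^l$ equals the rank of $F^\lambda(\alpha)$. Moreover, for every $\alpha\in\mathbb C$, as $U(\mathfrak{gl}_n)$-modules, $$U(\mathfrak{gl}_n)\cdot\det{}^{(\alpha)}(X)^l\;\cong\bigoplus_{\lambda\vdash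 nl,\ \ell(\lambda)\le n}(M^\lambda)^{\oplus\operatorname{rank}F^\lambda(\alpha)}.$$ -/

import Mathlib

open scoped DirectSum

attribute [local instance 100] LieRing.ofAssociativeRing

namespace AlphaDet

/-! ### Permutations and the row and column groups of the rectangular tableau -/

/-- `ν(σ) = ∑ᵢ (i - 1) mᵢ(σ)`, where `mᵢ(σ)` is the number of `i`-cycles of `σ`
(`cycleType` lists the lengths of the nontrivial cycles; fixed points contribute `0`). -/
def nu {ι : Type*} [Fintype ι] [DecidableEq ι] (σ : Equiv.Perm ι) : ℕ :=
  (σ.cycleType.map fun i => i - 1).sum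

/-- The row group of the standard tableau of rectangular shape with `n` rows of length `l`, filled
row by row: with the entries numbered from `0`, the entry `x` stands in row `x / l`. -/
def rowGroup (n l : ℕ) : Subgroup (Equiv.Perm (Fin (n * l))) where
  carrier := {g | ∀ x, (g x).divNat = x.divNat}
  one_mem' _ := rfl
  mul_mem' {a b} ha hb x := by
    rw [Equiv.Perm.mul_apply, ha, hb]
  inv_mem' {a} ha x := by
    rw [← ha (a⁻¹ x), show a (a⁻¹ x) = x from a.apply_symm_apply x]

/-- The column group of the same tableau: the entry `x` stands in column `x % l`. -/
def columnGroup (n l : ℕ) : Subgroup (Equiv.Perm (Fin (n * l))) where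
  carrier := {g | ∀ x, (g x).modNat = x.modNat}
  one_mem' _ := rfl
  mul_mem' {a b} ha hb x := by
    rw [Equiv.Perm.mul_apply, ha, hb]
  inv_mem' {a} ha x := by
    rw [← ha (a⁻¹ x), show a (a⁻¹ x) = x from a.apply_symm_apply x]

instance (n l : ℕ) : DecidablePred (· ∈ columnGroup n l) := fun g =>
  inferInstanceAs (Decidable (∀ x, (g x).modNat = x.modNat))

/-! ### Partitions and Kostka numbers -/

/-- Partitions of `N` with at most `n` parts, as Young diagrams; the parts are the `rowLen i`. -/
def BoundedPartition (n N : ℕ) : Type :=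
  {μ : YoungDiagram // μ.card = N ∧ μ.colLen 0 ≤ n}

/-- The Kostka number `K_{μ,(l^n)}`: the number of semistandard tableaux of shape `μ` in which
each of the `n` entries `0, …, n - 1` occurs exactly `l` times and no other entry occurs. -/
noncomputable def kostka (μ : YoungDiagram) (n l : ℕ) : ℕ :=
  Nat.card {T : SemistandardYoungTableau μ //
    ∀ i : ℕ, (μ.cells.filter fun c => T c.1 c.2 = i).card = if i < n then l else 0}

/-! ### Specht modules -/

/-- Tabloids of shape `μ` with entries in `Fin N`: the function gives the row of each entry. -/
def Tabloid (μ : YoungDiagram) (N : ℕ) : Type :=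
  {r : Fin N → Fin (μ.colLen 0) // ∀ i, (Finset.univ.filter fun x => r x = i).card = μ.rowLen i}

noncomputable instance (μ : YoungDiagram) (N : ℕ) : Fintype (Tabloid μ N) :=
  inferInstanceAs (Fintype {r : Fin N → Fin (μ.colLen 0) //
    ∀ i, (Finset.univ.filter fun x => r x = i).card = μ.rowLen i})

instance (μ : YoungDiagram) (N : ℕ) : DecidableEq (Tabloid μ N) :=
  inferInstanceAs (DecidableEq {r : Fin N → Fin (μ.colLen 0) //
    ∀ i, (Finset.univ.filter fun x => r x = i).card = μ.rowLen i})

/-- The right action of a permutation `g` on tabloids: the entry `x` of the new tabloid stands in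
the row in which the entry `g x` stood. -/
def Tabloid.actEquiv (μ : YoungDiagram) (N : ℕ) (g : Equiv.Perm (Fin N)) :
    Tabloid μ N ≃ Tabloid μ N where
  toFun r := ⟨fun x => r.1 (g x), fun i => by
    rw [← r.2 i]
    exact Finset.card_equiv g (by simp)⟩
  invFun r := ⟨fun x => r.1 (g⁻¹ x), fun i => by
    rw [← r.2 i]
    exact Finset.card_equiv g⁻¹ (by simp)⟩
  left_inv r := Subtype.ext (funext fun x => by simp)
  right_inv r := Subtype.ext (funext fun x => by simp)

/-- The permutation module on tabloids, with the inner product for which they are orthonormal. -/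
abbrev TabloidSpace (μ : YoungDiagram) (N : ℕ) : Type := EuclideanSpace ℂ (Tabloid μ N)

/-- The right action `v ↦ v · g` on the permutation module; it is isometric and satisfies
`v · (g * h) = (v · g) · h`. -/
noncomputable def rightAct (μ : YoungDiagram) (N : ℕ) (g : Equiv.Perm (Fin N)) :
    TabloidSpace μ N ≃ₗᵢ[ℂ] TabloidSpace μ N :=
  LinearIsometryEquiv.piLpCongrLeft 2 ℂ ℂ (Tabloid.actEquiv μ N g)

theorem rightAct_single (μ : YoungDiagram) (N : ℕ) (g : Equiv.Perm (Fin N)) (r : Tabloid μ N) :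
    rightAct μ N g (EuclideanSpace.single r 1) =
      EuclideanSpace.single (Tabloid.actEquiv μ N g r) 1 :=
  EuclideanSpace.piLpCongrLeft_single _ _ _

theorem rightAct_mul (μ : YoungDiagram) (N : ℕ) (g h : Equiv.Perm (Fin N))
    (v : TabloidSpace μ N) :
    rightAct μ N (g * h) v = rightAct μ N h (rightAct μ N g v) := by
  refine PiLp.ext fun r => ?_
  change v _ = v _
  rfl

/-- Bijective tableaux of shape `μ` with entries in `Fin N`: the map gives the cell of each entry.
-/
abbrev Tableau (μ : YoungDiagram) (N : ℕ) : Type := Fin N ≃ {c : ℕ × ℕ // c ∈ μ.cells}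

/-- The tabloid of a tableau. -/
def Tableau.tabloid {μ : YoungDiagram} {N : ℕ} (t : Tableau μ N) : Tabloid μ N :=
  ⟨fun x => ⟨(t x).1.1, YoungDiagram.mem_iff_lt_colLen.1
      (μ.up_left_mem le_rfl (Nat.zero_le _) ((t x).2 : ((t x).1.1, (t x).1.2) ∈ μ))⟩, fun i => by
    rw [YoungDiagram.rowLen_eq_card]
    refine Finset.card_bij (fun x _ => (t x).1) ?_ ?_ ?_
    · intro x hx
      simp only [Finset.mem_filter, Finset.mem_univ, true_and, Fin.ext_iff] at hx
      exact YoungDiagram.mem_row_iff.2 ⟨(t x).2, hx⟩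
    · intro x _ y _ h
      exact t.injective (Subtype.ext h)
    · intro c hc
      obtain ⟨hc1, hc2⟩ := YoungDiagram.mem_row_iff.1 hc
      exact ⟨t.symm ⟨c, hc1⟩, by simp [Fin.ext_iff, hc2], by simp⟩⟩

/-- The column stabilizer of a tableau. -/
def Tableau.columnStabilizer {μ : YoungDiagram} {N : ℕ} (t : Tableau μ N) :
    Finset (Equiv.Perm (Fin N)) :=
  Finset.univ.filter fun σ => ∀ x, (t (σ x)).1.2 = (t x).1.2

/-- The polytabloid of a tableau `t`: the sum of `sgn(σ) {t} · σ` over the column stabilizer. -/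
noncomputable def Tableau.polytabloid {μ : YoungDiagram} {N : ℕ} (t : Tableau μ N) :
    TabloidSpace μ N :=
  ∑ σ ∈ t.columnStabilizer, ((Equiv.Perm.sign σ : ℤ) : ℂ) •
    EuclideanSpace.single (Tabloid.actEquiv μ N σ t.tabloid) (1 : ℂ)

/-- The Specht module of shape `μ`, spanned by the polytabloids; its inner product is the
restriction of the one on the permutation module, hence invariant under the symmetric group. -/
noncomputable def specht (μ : YoungDiagram) (N : ℕ) : Submodule ℂ (TabloidSpace μ N) :=
  Submodule.span ℂ (Set.range (Tableau.polytabloid (μ := μ) (N := N)))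

theorem rightAct_polytabloid {μ : YoungDiagram} {N : ℕ} (g : Equiv.Perm (Fin N))
    (t : Tableau μ N) :
    rightAct μ N g t.polytabloid = Tableau.polytabloid (g.trans t) := by
  simp only [Tableau.polytabloid, map_sum, map_smul, rightAct_single]
  refine Finset.sum_equiv (MulAut.conj g⁻¹).toEquiv ?_ ?_
  · intro σ
    simp only [Tableau.columnStabilizer, Finset.mem_filter, Finset.mem_univ, true_and]
    constructor
    · intro h x
      simpa using h (g x)
    · intro h x
      simpa using h (g⁻¹ x)
  · intro σ _
    have h1 : Equiv.Perm.sign ((MulAut.conj g⁻¹).toEquiv σ) = Equiv.Perm.sign σ := by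
      change Equiv.Perm.sign (g⁻¹ * σ * g⁻¹⁻¹) = _
      rw [map_mul, map_mul, mul_right_comm, ← map_mul, mul_inv_cancel, map_one, one_mul]
    rw [h1]
    congr 2
    refine Subtype.ext (funext fun x => Fin.ext ?_)
    change (t (σ (g x))).1.1 = (t (g (g⁻¹ (σ (g⁻¹⁻¹ x))))).1.1
    rw [inv_inv, show g (g⁻¹ (σ (g x))) = σ (g x) from g.apply_symm_apply _]

theorem rightAct_mem_specht (μ : YoungDiagram) (N : ℕ) (g : Equiv.Perm (Fin N)) :
    ∀ v ∈ specht μ N, (rightAct μ N g).toLinearEquiv.toLinearMap v ∈ specht μ N := by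
  intro v hv
  refine Submodule.span_induction ?_ ?_ ?_ ?_ hv
  · rintro _ ⟨t, rfl⟩
    exact Submodule.subset_span ⟨g.trans t, (rightAct_polytabloid g t).symm⟩
  · simp
  · intro x y _ _ hx hy
    rw [map_add]
    exact add_mem hx hy
  · intro a x _ hx
    rw [map_smul]
    exact Submodule.smul_mem _ _ hx

/-- The right action `v ↦ v · g` of the symmetric group on the Specht module. -/
noncomputable def spechtAct (μ : YoungDiagram) (N : ℕ) (g : Equiv.Perm (Fin N)) :
    specht μ N →ₗ[ℂ] specht μ N :=
  (rightAct μ N g).toLinearEquiv.toLinearMap.restrict (rightAct_mem_specht μ N g)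

/-- The subspace of vectors of the Specht module that are invariant under the row group. -/
noncomputable def rowInvariants (μ : YoungDiagram) (n l : ℕ) :
    Submodule ℂ (specht μ (n * l)) :=
  ⨅ k ∈ rowGroup n l, LinearMap.ker (spechtAct μ (n * l) k - LinearMap.id)

/-- An orthonormal basis `e₁, …, e_f` of the Specht module whose first `d` vectors span the
row-group invariants (so that the others span the orthogonal complement of the invariants). -/
structure AdaptedBasis (μ : YoungDiagram) (n l : ℕ) where
  f : ℕ
  d : ℕ
  d_le : d ≤ f
  basis : OrthonormalBasis (Fin f) ℂ (specht μ (n * l))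
  span_eq : Submodule.span ℂ (Set.range fun i : Fin d => basis (Fin.castLE d_le i)) =
    rowInvariants μ n l

theorem exists_orthonormalBasis_extending {F : Type*} [NormedAddCommGroup F]
    [InnerProductSpace ℂ F] [FiniteDimensional ℂ F] (W : Submodule ℂ F) :
    ∃ (f d : ℕ) (hd : d ≤ f) (b : OrthonormalBasis (Fin f) ℂ F),
      Submodule.span ℂ (Set.range fun i : Fin d => b (Fin.castLE hd i)) = W := by
  have hd : Module.finrank ℂ W ≤ Module.finrank ℂ F := Submodule.finrank_le W
  let w := stdOrthonormalBasis ℂ W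
  let v : Fin (Module.finrank ℂ F) → F := fun i =>
    if h : i.1 < Module.finrank ℂ W then (w ⟨i.1, h⟩ : F) else 0
  let s : Set (Fin (Module.finrank ℂ F)) := {i | i.1 < Module.finrank ℂ W}
  have hw : Orthonormal ℂ fun i => (w i : F) :=
    w.orthonormal.comp_linearIsometry W.subtypeₗᵢ
  have hv : Orthonormal ℂ (s.domRestrict v) := by
    have h1 : s.domRestrict v = (fun i => (w i : F)) ∘ fun i : s => ⟨i.1.1, i.2⟩ := by
      funext i
      have hi : i.1.1 < Module.finrank ℂ W := i.2
      simp [v, Set.domRestrict_apply, hi]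
    rw [h1]
    refine hw.comp _ fun i j h => ?_
    simpa [Fin.ext_iff, Subtype.ext_iff] using h
  obtain ⟨b, hb⟩ := hv.exists_orthonormalBasis_extension_of_card_eq (by simp)
  refine ⟨_, _, hd, b, ?_⟩
  have h2 : (fun i : Fin (Module.finrank ℂ W) => b (Fin.castLE hd i)) = W.subtype ∘ w := by
    funext i
    rw [hb _ (show (Fin.castLE hd i).1 < _ from i.2)]
    simp [v]
  rw [h2, Set.range_comp, ← Submodule.map_span, ← w.coe_toBasis, w.toBasis.span_eq,
    Submodule.map_top, Submodule.range_subtype]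

/-- Adapted bases exist. -/
theorem AdaptedBasis.nonempty (μ : YoungDiagram) (n l : ℕ) : Nonempty (AdaptedBasis μ n l) := by
  obtain ⟨f, d, hd, b, h⟩ := exists_orthonormalBasis_extending (F := specht μ (n * l)) (rowInvariants μ n l)
  exact ⟨⟨f, d, hd, b, h⟩⟩

/-- The matrix coefficient `ψ_{ij}(g) = ⟨eᵢ · g, eⱼ⟩`, the inner product being linear in its first
argument (Mathlib's `inner` is linear in the second one). -/
noncomputable def AdaptedBasis.psi {μ : YoungDiagram} {n l : ℕ} (B : AdaptedBasis μ n l)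
    (i j : Fin B.f) (g : Equiv.Perm (Fin (n * l))) : ℂ :=
  inner ℂ (B.basis j) (spechtAct μ (n * l) g (B.basis i))

/-- The `d × d` matrix with entries `∑_{h ∈ H} α^{ν(h)} ψ_{ij}(h)`, `H` the column group. -/
noncomputable def AdaptedBasis.transitionMatrix {μ : YoungDiagram} {n l : ℕ}
    (B : AdaptedBasis μ n l) (α : ℂ) : Matrix (Fin B.d) (Fin B.d) ℂ :=
  Matrix.of fun i j => ∑ h : columnGroup n l,
    α ^ nu h.1 * B.psi (Fin.castLE B.d_le i) (Fin.castLE B.d_le j) h.1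

/-! ### The general linear Lie algebra acting on polynomials in matrix entries -/

/-- `gl_n(ℂ)`, with the commutator bracket. -/
abbrev gl (n : ℕ) : Type := Matrix (Fin n) (Fin n) ℂ

/-- The universal enveloping algebra of `gl_n(ℂ)`. -/
abbrev U (n : ℕ) : Type := UniversalEnvelopingAlgebra ℂ (gl n)

/-- The image in `U(gl_n)` of the matrix unit `E_{ij}`. -/
noncomputable def E {n : ℕ} (i j : Fin n) : U n :=
  UniversalEnvelopingAlgebra.ι ℂ (Matrix.single i j (1 : ℂ) : gl n)

/-- The polynomial algebra in the `n²` variables `x_{ij}`. -/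
abbrev PolyMat (n : ℕ) : Type := MvPolynomial (Fin n × Fin n) ℂ

/-- The derivation by which a matrix `A = ∑ A_{ij} E_{ij}` acts on polynomials, where `E_{ij}` acts
as `∑ₛ x_{is} ∂/∂x_{js}`. -/
noncomputable def glDerivation (n : ℕ) (A : gl n) : Derivation ℂ (PolyMat n) (PolyMat n) :=
  ∑ i, ∑ j, A i j • ∑ s, (MvPolynomial.X (i, s) : PolyMat n) • MvPolynomial.pderiv (j, s)

theorem derivation_sum_apply {n : ℕ} {ι : Type*} (s : Finset ι)
    (D : ι → Derivation ℂ (PolyMat n) (PolyMat n)) (f : PolyMat n) :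
    (∑ i ∈ s, D i) f = ∑ i ∈ s, D i f :=
  map_sum (⟨⟨fun D => D f, rfl⟩, fun _ _ => rfl⟩ :
    Derivation ℂ (PolyMat n) (PolyMat n) →+ PolyMat n) D s

theorem glDerivation_apply (n : ℕ) (A : gl n) (f : PolyMat n) :
    glDerivation n A f = ∑ i, ∑ j, A i j •
      ∑ s, (MvPolynomial.X (i, s) : PolyMat n) * MvPolynomial.pderiv (j, s) f := by
  simp only [glDerivation, derivation_sum_apply, Derivation.smul_apply, smul_eq_mul]

theorem glDerivation_X (n : ℕ) (A : gl n) (j s : Fin n) :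
    glDerivation n A (MvPolynomial.X (j, s)) =
      ∑ i, A i j • (MvPolynomial.X (i, s) : PolyMat n) := by
  simp only [glDerivation_apply, MvPolynomial.pderiv_X]
  refine Finset.sum_congr rfl fun i _ => ?_
  rw [Finset.sum_eq_single j]
  · congr 1
    rw [Finset.sum_eq_single s]
    · simp
    · intro b _ hb
      simp [Ne.symm hb]
    · simp
  · intro b _ hb
    simp [Ne.symm hb]
  · simp

/-- The action of `gl_n` on polynomials as a homomorphism of Lie algebras. -/
noncomputable def glAction (n : ℕ) : gl n →ₗ⁅ℂ⁆ Module.End ℂ (PolyMat n) where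
  toFun A := (glDerivation n A : PolyMat n →ₗ[ℂ] PolyMat n)
  map_add' A B := by
    refine LinearMap.ext fun f => ?_
    change glDerivation n (A + B) f = glDerivation n A f + glDerivation n B f
    simp only [glDerivation_apply, Matrix.add_apply, add_smul, Finset.sum_add_distrib]
  map_smul' c A := by
    refine LinearMap.ext fun f => ?_
    change glDerivation n (c • A) f = c • glDerivation n A f
    simp only [glDerivation_apply, Matrix.smul_apply, smul_assoc, Finset.smul_sum]
  map_lie' {A B} := by
    rw [← Derivation.commutator_coe_linear_map]
    congr 1
    refine MvPolynomial.derivation_ext fun p => ?_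
    obtain ⟨j, s⟩ := p
    rw [Derivation.commutator_apply]
    simp only [glDerivation_X, map_sum, Derivation.map_smul, LieRing.of_associative_ring_bracket,
      Matrix.sub_apply, Matrix.mul_apply, sub_smul, Finset.sum_smul, Finset.sum_sub_distrib,
      Finset.smul_sum, smul_smul]
    congr 1
    · rw [Finset.sum_comm]
      exact Finset.sum_congr rfl fun i _ => Finset.sum_congr rfl fun k _ => by rw [mul_comm]
    · rw [Finset.sum_comm]
      exact Finset.sum_congr rfl fun i _ => Finset.sum_congr rfl fun k _ => by rw [mul_comm]

/-- The `U(gl_n)`-module structure on the polynomial algebra. -/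
noncomputable instance (n : ℕ) : Module (U n) (PolyMat n) :=
  Module.compHom (PolyMat n) (UniversalEnvelopingAlgebra.lift ℂ (glAction n)).toRingHom

theorem E_smul (n : ℕ) (i j : Fin n) (f : PolyMat n) :
    E i j • f = ∑ s, MvPolynomial.X (i, s) * MvPolynomial.pderiv (j, s) f := by
  change UniversalEnvelopingAlgebra.lift ℂ (glAction n) (UniversalEnvelopingAlgebra.ι ℂ _) f = _
  rw [UniversalEnvelopingAlgebra.lift_ι_apply]
  change glDerivation n _ f = _
  rw [glDerivation_apply]
  rw [Finset.sum_eq_single i, Finset.sum_eq_single j]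
  · simp
  · intro b _ hb
    simp [Ne.symm hb]
  · simp
  · intro b _ hb
    simp [Ne.symm hb]
  · simp

/-- The `α`-determinant `∑_σ α^{ν(σ)} x_{σ(1)1} ⋯ x_{σ(n)n}` of the matrix of variables. -/
noncomputable def alphaDet (n : ℕ) (α : ℂ) : PolyMat n :=
  ∑ σ : Equiv.Perm (Fin n), MvPolynomial.C (α ^ nu σ) * ∏ i, MvPolynomial.X (σ i, i)

/-- The cyclic module `U(gl_n) · det^{(α)}(X)^l`. -/
noncomputable def cyclicModule (n l : ℕ) (α : ℂ) : Submodule (U n) (PolyMat n) :=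
  Submodule.span (U n) {alphaDet n α ^ l}

/-- The module `M` contains a highest weight vector of weight `μ`: a nonzero vector killed by all
`E_{ij}` with `i < j` on which `E_{ii}` acts as the `i`-th part of `μ`. -/
def HasHighestWeight {n : ℕ} (M : Type*) [AddCommGroup M] [Module (U n) M]
    (μ : YoungDiagram) : Prop :=
  ∃ v : M, v ≠ 0 ∧ (∀ i j : Fin n, i < j → E i j • v = 0) ∧
    ∀ i : Fin n, E i i • v = μ.rowLen i • v

/-- The multiplicity of a simple module `S` in a module `V`: the length of the `S`-isotypic
component of `V`, that is, the number of copies of `S` in it. -/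
noncomputable def simpleMultiplicity (R V S : Type*) [Ring R] [AddCommGroup V] [Module R V]
    [AddCommGroup S] [Module R S] : ℕ∞ :=
  Module.length R (isotypicComponent R V S)

end AlphaDet

open AlphaDet

open AlphaDet

namespace AlphaDet

/-! ### Highest weight vectors in modules over the enveloping algebra -/

/-! The mechanism is Schur–Weyl duality on W = (ℂⁿ)^{⊗nl}, realised as `WordSpace`: `gl_n` acts on
letters, permutations act on positions. Sending a word to a monomial (`wordToPoly`) is linear over
the enveloping algebra and has the same kernel as the sum over K (`wordToPoly_eq_zero_iff`). The
word `rowWord` generates all K-invariants of W, and its weighted sum over H goes to det^(α)(X)^l,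
because an element of H is an independent choice of a permutation in each of the l columns. Hence
the cyclic module is the image of W under the row sum, then the weighted column sum, then
`wordToPoly` (`range_detMap`).

W is semisimple because E_ji is the adjoint of E_ij. In a semisimple module multiplicities are
dimensions of spaces of highest weight vectors (`simpleMultiplicity_eq_finrank`,
`nonempty_equiv_directSum`). In W those of weight λ form a copy of S^λ (`map_specht`), and those of
the cyclic module are the images of the ones in W (`finrank_hwSpace_cyclicModule`). On S^λ the row
sum is |K| times the orthogonal projection onto the K-invariants. What remains is the compression of
the weighted column sum to the invariants, whose matrix is the transpose of F^λ(α)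
(`finrank_map_detMap`).

Duality enters through `mem_range_wordRep`: every operator on W commuting with permutations comes
from the enveloping algebra. It provides the projections to weight spaces, the generation of
invariants by `rowWord`, and the fact that a single polytabloid generates all highest weight vectors
of its weight under permutations (`mem_span_wordAct`).

For the Kostka number, the K-sums of polytabloids attached to semistandard tableaux of content (lⁿ)
are independent by a triangularity argument (`linearIndependent_invariantVector`). Conversely a
K-invariant vector is determined by its pairings with these polytabloids, by Garnir straightening
applied to inner products (`eq_zero_of_inner_represents`). -/

theorem E_mul_sub {n : ℕ} (i j k m : Fin n) :
    E i j * E k m - E k m * E i j =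
      (if j = k then E i m else 0) - (if m = i then E k j else 0) := by
  have h := (UniversalEnvelopingAlgebra.ι ℂ).map_lie (Matrix.single i j (1 : ℂ) : gl n)
    (Matrix.single k m (1 : ℂ) : gl n)
  rw [LieRing.of_associative_ring_bracket, LieRing.of_associative_ring_bracket] at h
  rw [E, E, ← h, map_sub]
  congr 1
  · split_ifs with hjk
    · subst hjk
      rw [Matrix.single_mul_single_same, one_mul, E]
    · rw [Matrix.single_mul_single_of_ne _ _ _ _ hjk, map_zero]
  · split_ifs with hmi
    · subst hmi
      rw [Matrix.single_mul_single_same, one_mul, E]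
    · rw [Matrix.single_mul_single_of_ne _ _ _ _ hmi, map_zero]

/-- By the universal property, `ι` corestricted to the subalgebra extends to the whole enveloping
algebra. Composed with the inclusion this extension is the identity, so the subalgebra is
everything. -/
theorem adjoin_E (n : ℕ) :
    Algebra.adjoin ℂ (Set.range fun p : Fin n × Fin n => (E p.1 p.2 : U n)) = ⊤ := by
  set S := Algebra.adjoin ℂ (Set.range fun p : Fin n × Fin n => (E p.1 p.2 : U n)) with hS
  have hmem : ∀ A : gl n, UniversalEnvelopingAlgebra.ι ℂ A ∈ S := by
    intro A
    rw [Matrix.matrix_eq_sum_single A, map_sum]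
    refine sum_mem fun i _ => ?_
    rw [map_sum]
    refine sum_mem fun j _ => ?_
    have : Matrix.single i j (A i j) = A i j • (Matrix.single i j (1 : ℂ)) := by simp
    rw [this, map_smul]
    exact S.smul_mem (Algebra.subset_adjoin ⟨(i, j), rfl⟩) _
  let f : gl n →ₗ⁅ℂ⁆ S :=
    { toFun := fun A => ⟨UniversalEnvelopingAlgebra.ι ℂ A, hmem A⟩
      map_add' := fun A B => Subtype.ext (map_add _ A B)
      map_smul' := fun c A => Subtype.ext (map_smul (UniversalEnvelopingAlgebra.ι ℂ) c A)
      map_lie' := fun {A B} => Subtype.ext (LieHom.map_lie _ A B) }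
  have hid : S.val.comp (UniversalEnvelopingAlgebra.lift ℂ f) = AlgHom.id ℂ (U n) := by
    apply UniversalEnvelopingAlgebra.hom_ext
    ext A
    simp [f]
  rw [eq_top_iff]
  intro u _
  have := DFunLike.congr_fun hid u
  rw [← show _ = u from this]
  exact (UniversalEnvelopingAlgebra.lift ℂ f u).2

section Modules

variable {n : ℕ} {M : Type*} [AddCommGroup M] [Module (U n) M] [Module ℂ M]
  [IsScalarTower ℂ (U n) M]

theorem smul_mem_of_E_smul_mem (X : Submodule ℂ M)
    (h : ∀ i j : Fin n, ∀ x ∈ X, (E i j : U n) • x ∈ X) (u : U n) {x : M} (hx : x ∈ X) :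
    u • x ∈ X := by
  have hu : u ∈ Algebra.adjoin ℂ (Set.range fun p : Fin n × Fin n => (E p.1 p.2 : U n)) := by
    rw [adjoin_E]; trivial
  induction hu using Algebra.adjoin_induction generalizing x with
  | mem u hu => obtain ⟨p, rfl⟩ := hu; exact h _ _ _ hx
  | algebraMap c => rw [algebraMap_smul]; exact X.smul_mem _ hx
  | add u v _ _ h1 h2 => rw [add_smul]; exact X.add_mem (h1 hx) (h2 hx)
  | mul u v _ _ h1 h2 => rw [mul_smul]; exact h1 (h2 hx)

/-- A linear map commuting with the matrix units is linear over the enveloping algebra. -/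
theorem map_smul_of_map_E_smul {M' : Type*} [AddCommGroup M'] [Module (U n) M'] [Module ℂ M']
    [IsScalarTower ℂ (U n) M'] (f : M →ₗ[ℂ] M')
    (h : ∀ (i j : Fin n) (x : M), f ((E i j : U n) • x) = (E i j : U n) • f x) (u : U n) (x : M) :
    f (u • x) = u • f x := by
  have hu : u ∈ Algebra.adjoin ℂ (Set.range fun p : Fin n × Fin n => (E p.1 p.2 : U n)) := by
    rw [adjoin_E]; trivial
  induction hu using Algebra.adjoin_induction generalizing x with
  | mem u hu => obtain ⟨p, rfl⟩ := hu; exact h _ _ _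
  | algebraMap c => rw [algebraMap_smul, algebraMap_smul, map_smul]
  | add u v _ _ h1 h2 => rw [add_smul, add_smul, map_add, h1, h2]
  | mul u v _ _ h1 h2 => rw [mul_smul, mul_smul, h1, h2]

variable (M) in
/-- The space of highest weight vectors of weight `μ`, including `0`. -/
def hwSpace (μ : Fin n → ℕ) : Submodule ℂ M where
  carrier := {v | (∀ i j : Fin n, i < j → (E i j : U n) • v = 0) ∧
    ∀ i : Fin n, (E i i : U n) • v = μ i • v}
  zero_mem' := by simp
  add_mem' := by
    rintro a b ⟨h1, h2⟩ ⟨h3, h4⟩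
    exact ⟨fun i j hij => by rw [smul_add, h1 i j hij, h3 i j hij, add_zero],
      fun i => by rw [smul_add, h2, h4, smul_add]⟩
  smul_mem' := by
    rintro c a ⟨h1, h2⟩
    exact ⟨fun i j hij => by rw [smul_comm, h1 i j hij, smul_zero],
      fun i => by rw [smul_comm, h2, smul_comm]⟩

theorem hasHighestWeight_iff {μ : YoungDiagram} : HasHighestWeight (n := n) M μ ↔
    ∃ v : M, v ≠ 0 ∧ v ∈ hwSpace M (fun i : Fin n => μ.rowLen i) := Iff.rfl

/-- The element `∑ i E_{ii}`, whose eigenvalues grade a module by height. -/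
noncomputable def heightElt (n : ℕ) : U n := ∑ i : Fin n, ((i : ℕ) : ℂ) • E i i

variable (n M) in
/-- The action of `∑ i E_{ii}`. -/
noncomputable def heightEnd : Module.End ℂ M where
  toFun v := heightElt n • v
  map_add' := smul_add _
  map_smul' c v := by simp only [RingHom.id_apply]; rw [smul_comm]

theorem heightEnd_apply (v : M) : heightEnd n M v = heightElt n • v := rfl

/-- The height of a weight. -/
def weightHeight (μ : Fin n → ℕ) : ℕ := ∑ i, i * μ i

theorem heightEnd_of_weight {μ : Fin n → ℕ} {v : M} (hv : ∀ i, (E i i : U n) • v = μ i • v) :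
    heightEnd n M v = (weightHeight μ : ℂ) • v := by
  rw [heightEnd_apply, heightElt, Finset.sum_smul, weightHeight, Nat.cast_sum, Finset.sum_smul]
  refine Finset.sum_congr rfl fun i _ => ?_
  rw [smul_assoc, hv, ← Nat.cast_smul_eq_nsmul ℂ, smul_smul, Nat.cast_mul]

/-- Lowering operators (j < i) thus strictly increase the height, and raising operators strictly
decrease it. All uniqueness statements on highest weight vectors below come from this grading. -/
theorem heightElt_mul_E (i j : Fin n) :
    heightElt n * E i j = E i j * heightElt n + (((i : ℕ) : ℂ) - ((j : ℕ) : ℂ)) • E i j := by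
  rw [← sub_eq_iff_eq_add', heightElt, Finset.sum_mul, Finset.mul_sum, ← Finset.sum_sub_distrib]
  have : ∀ k : Fin n, ((k : ℕ) : ℂ) • E k k * E i j - E i j * ((k : ℕ) : ℂ) • E k k =
      (if k = i then ((k : ℕ) : ℂ) • E i j else 0) -
        (if k = j then ((k : ℕ) : ℂ) • E i j else (0 : U n)) := by
    intro k
    rw [smul_mul_assoc, mul_smul_comm, ← smul_sub, E_mul_sub, smul_sub]
    congr 1
    · split_ifs with h <;> simp [h]
    · by_cases h : k = j
      · simp [h]
      · simp [h, Ne.symm h]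
  simp only [this, Finset.sum_sub_distrib, Finset.sum_ite_eq', Finset.mem_univ, if_true, sub_smul]

theorem heightEnd_E_smul {i j : Fin n} {v : M} {c : ℂ} (hv : heightEnd n M v = c • v) :
    heightEnd n M ((E i j : U n) • v) = (c + ((i : ℕ) - (j : ℕ))) • ((E i j : U n) • v) := by
  rw [heightEnd_apply] at hv ⊢
  rw [smul_smul, heightElt_mul_E, add_smul, mul_smul, hv, smul_assoc, add_smul, smul_comm]

/-- The result of applying lowering operators, listed in `L`, to `v`. -/
noncomputable def lowerWord (v : M) (L : List (Fin n × Fin n)) : M :=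
  L.foldr (fun p x => (E p.1 p.2 : U n) • x) v

/-- Induction on the word: moving `E i j` past the first lowering operator leaves commutator terms,
which are matrix units acting on the shorter word. No ordering of the lowering operators is needed.
-/
theorem E_smul_lowerWord_mem {μ : Fin n → ℕ} {v : M} (hv : v ∈ hwSpace M μ)
    (L : List (Fin n × Fin n)) (hL : ∀ p ∈ L, p.2 < p.1) (i j : Fin n) :
    (E i j : U n) • lowerWord v L ∈
      Submodule.span ℂ (lowerWord v '' {L : List (Fin n × Fin n) | ∀ p ∈ L, p.2 < p.1}) := by
  set X := Submodule.span ℂ (lowerWord v '' {L : List (Fin n × Fin n) | ∀ p ∈ L, p.2 < p.1})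
  have hlow : ∀ a b : Fin n, b < a → ∀ x ∈ X, (E a b : U n) • x ∈ X := by
    intro a b hab x hx
    induction hx using Submodule.span_induction with
    | mem x hx =>
      obtain ⟨L, hL, rfl⟩ := hx
      refine Submodule.subset_span ⟨(a, b) :: L, ?_, rfl⟩
      intro p hp
      rcases List.mem_cons.1 hp with rfl | hp
      · exact hab
      · exact hL p hp
    | zero => rw [smul_zero]; exact zero_mem _
    | add x y _ _ h1 h2 => rw [smul_add]; exact add_mem h1 h2
    | smul c x _ h => rw [smul_comm]; exact Submodule.smul_mem _ _ h
  induction L generalizing i j with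
  | nil =>
    have hv0 : v ∈ X := Submodule.subset_span ⟨[], by simp, rfl⟩
    change (E i j : U n) • v ∈ X
    rcases lt_trichotomy i j with h | h | h
    · rw [hv.1 i j h]; exact zero_mem _
    · subst h; rw [hv.2 i]; exact X.smul_of_tower_mem _ hv0
    · exact hlow _ _ h _ hv0
  | cons p L ih =>
    obtain ⟨a, b⟩ := p
    have hab : b < a := hL (a, b) (by simp)
    have ih' := ih fun p hp => hL p (by simp [hp])
    change (E i j : U n) • (E a b : U n) • lowerWord v L ∈ X
    rw [smul_smul, ← sub_add_cancel (E i j * E a b : U n) (E a b * E i j), E_mul_sub, add_smul,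
      sub_smul, mul_smul]
    refine add_mem (sub_mem ?_ ?_) (hlow _ _ hab _ (ih' i j))
    · split_ifs
      · exact ih' _ _
      · rw [zero_smul]; exact zero_mem _
    · split_ifs
      · exact ih' _ _
      · rw [zero_smul]; exact zero_mem _

theorem mem_span_lowerWord {μ : Fin n → ℕ} {v : M} (hv : v ∈ hwSpace M μ) {x : M}
    (hx : x ∈ Submodule.span (U n) {v}) :
    x ∈ Submodule.span ℂ (lowerWord v '' {L : List (Fin n × Fin n) | ∀ p ∈ L, p.2 < p.1}) := by
  obtain ⟨u, rfl⟩ := Submodule.mem_span_singleton.1 hx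
  refine smul_mem_of_E_smul_mem _ ?_ u (Submodule.subset_span ⟨[], by simp, rfl⟩)
  intro i j x hx
  induction hx using Submodule.span_induction with
  | mem x hx =>
    obtain ⟨L, hL, rfl⟩ := hx
    exact E_smul_lowerWord_mem hv L hL i j
  | zero => rw [smul_zero]; exact zero_mem _
  | add x y _ _ h1 h2 => rw [smul_add]; exact add_mem h1 h2
  | smul c x _ h => rw [smul_comm]; exact Submodule.smul_mem _ _ h

theorem heightEnd_lowerWord {μ : Fin n → ℕ} {v : M} (hv : v ∈ hwSpace M μ)
    (L : List (Fin n × Fin n)) (hL : ∀ p ∈ L, p.2 < p.1) :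
    ∃ k : ℕ, (L ≠ [] → 0 < k) ∧
      heightEnd n M (lowerWord v L) = ((weightHeight μ + k : ℕ) : ℂ) • lowerWord v L := by
  induction L with
  | nil => exact ⟨0, by simp, heightEnd_of_weight hv.2⟩
  | cons p L ih =>
    obtain ⟨k, -, hk⟩ := ih fun p hp => hL p (by simp [hp])
    have hp : (p.2 : ℕ) < p.1 := hL p (by simp)
    refine ⟨k + (p.1 - p.2), fun _ => by omega, ?_⟩
    have := heightEnd_E_smul (i := p.1) (j := p.2) hk
    change heightEnd n M ((E p.1 p.2 : U n) • lowerWord v L) = _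
    rw [this]
    change _ = _ • ((E p.1 p.2 : U n) • lowerWord v L)
    congr 1
    push_cast [Nat.cast_sub hp.le]
    ring

/-- Only the empty lowering word keeps the height of `v`; every other one lands in an eigenspace of
strictly larger height. -/
theorem exists_smul_add_of_mem_span {μ : Fin n → ℕ} {v : M} (hv : v ∈ hwSpace M μ) {x : M}
    (hx : x ∈ Submodule.span (U n) {v}) :
    ∃ c : ℂ, ∃ y ∈ ⨆ k ∈ {k : ℕ | weightHeight μ < k},
      Module.End.eigenspace (heightEnd n M) (k : ℂ), x = c • v + y := by
  replace hx := mem_span_lowerWord hv hx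
  induction hx using Submodule.span_induction with
  | mem x hx =>
    obtain ⟨L, hL, rfl⟩ := hx
    by_cases h : L = []
    · subst h
      exact ⟨1, 0, zero_mem _, by simp [lowerWord]⟩
    · obtain ⟨k, hk, hk'⟩ := heightEnd_lowerWord hv L hL
      refine ⟨0, lowerWord v L, ?_, by simp⟩
      refine Submodule.mem_iSup_of_mem (weightHeight μ + k) (Submodule.mem_iSup_of_mem ?_ ?_)
      · have := hk h
        simpa using this
      · rwa [Module.End.mem_eigenspace_iff]
  | zero => exact ⟨0, 0, zero_mem _, by simp⟩
  | add x y _ _ h1 h2 =>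
    obtain ⟨c, z, hz, rfl⟩ := h1
    obtain ⟨d, w, hw, rfl⟩ := h2
    exact ⟨c + d, z + w, add_mem hz hw, by rw [add_smul]; abel⟩
  | smul a x _ h =>
    obtain ⟨c, z, hz, rfl⟩ := h
    exact ⟨a * c, a • z, Submodule.smul_mem _ _ hz, by rw [smul_add, smul_smul]⟩

theorem disjoint_eigenspace_heightEnd (a : ℕ) (s : Set ℕ) (ha : a ∉ s) :
    Disjoint (Module.End.eigenspace (heightEnd n M) (a : ℂ))
      (⨆ k ∈ s, Module.End.eigenspace (heightEnd n M) (k : ℂ)) := by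
  have h := (Module.End.eigenspaces_iSupIndep (heightEnd n M)).comp
    (Nat.cast_injective (R := ℂ))
  refine (h a).mono_right (iSup₂_le fun k hk => ?_)
  exact le_iSup₂_of_le (f := fun (j : ℕ) (_ : j ≠ a) =>
    Module.End.eigenspace (heightEnd n M) (j : ℂ)) k (fun e => ha (e ▸ hk)) le_rfl

/-- In the module generated by a highest weight vector `v`, vectors of the same height are
multiples of `v`. -/
theorem exists_eq_smul_of_mem_span {μ : Fin n → ℕ} {v : M} (hv : v ∈ hwSpace M μ) {x : M}
    (hx : x ∈ Submodule.span (U n) {v}) (hxh : heightEnd n M x = (weightHeight μ : ℂ) • x) :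
    ∃ c : ℂ, x = c • v := by
  obtain ⟨c, y, hy, rfl⟩ := exists_smul_add_of_mem_span hv hx
  refine ⟨c, ?_⟩
  have hy' : y ∈ Module.End.eigenspace (heightEnd n M) (weightHeight μ : ℂ) := by
    rw [Module.End.mem_eigenspace_iff]
    rw [map_add, map_smul, heightEnd_of_weight hv.2, smul_add, smul_comm] at hxh
    exact add_left_cancel hxh
  have := Submodule.disjoint_def.1 (disjoint_eigenspace_heightEnd (n := n) (M := M)
    (weightHeight μ) {k : ℕ | weightHeight μ < k} (by simp)) y hy' hy
  rw [this, add_zero]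

/-- The generated module is a sum of height eigenspaces of height at least that of `v`, and these
are independent of any smaller eigenvalue. -/
theorem weightHeight_le_of_mem_span {μ : Fin n → ℕ} {v : M} (hv : v ∈ hwSpace M μ) {x : M}
    (hx : x ∈ Submodule.span (U n) {v}) (hx0 : x ≠ 0) {a : ℕ}
    (hxh : heightEnd n M x = (a : ℂ) • x) : weightHeight μ ≤ a := by
  by_contra hlt
  obtain ⟨c, y, hy, rfl⟩ := exists_smul_add_of_mem_span hv hx
  refine hx0 (Submodule.disjoint_def.1 (disjoint_eigenspace_heightEnd (n := n) (M := M)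
    a {k : ℕ | weightHeight μ ≤ k} (by simpa using hlt)) _
      (Module.End.mem_eigenspace_iff.2 hxh) ?_)
  refine add_mem ?_ ?_
  · refine Submodule.smul_mem _ _ (Submodule.mem_iSup_of_mem (weightHeight μ)
      (Submodule.mem_iSup_of_mem (by simp) ?_))
    exact Module.End.mem_eigenspace_iff.2 (heightEnd_of_weight hv.2)
  · refine SetLike.le_def.1 (iSup₂_le fun k hk => ?_) hy
    exact le_iSup₂_of_le (f := fun (j : ℕ) (_ : j ∈ {k : ℕ | weightHeight μ ≤ k}) =>
      Module.End.eigenspace (heightEnd n M) (j : ℂ)) k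
      (show weightHeight μ ≤ k from le_of_lt hk) le_rfl

/-- Highest weight vectors in a simple module have the same weight and are proportional. -/
theorem hwSpace_simple [IsSimpleModule (U n) M] {μ μ' : Fin n → ℕ} {v v' : M}
    (hv : v ∈ hwSpace M μ) (hv' : v' ∈ hwSpace M μ') (h0 : v ≠ 0) (h0' : v' ≠ 0) :
    μ = μ' ∧ ∃ c : ℂ, v' = c • v := by
  have h1 : v' ∈ Submodule.span (U n) {v} := by
    rw [IsSimpleModule.span_singleton_eq_top (U n) h0]; trivial
  have h2 : v ∈ Submodule.span (U n) {v'} := by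
    rw [IsSimpleModule.span_singleton_eq_top (U n) h0']; trivial
  -- Each of the two vectors generates the simple module, so each has the least height in it.
  have h3 : weightHeight μ' = weightHeight μ :=
    le_antisymm (weightHeight_le_of_mem_span hv' h2 h0 (heightEnd_of_weight hv.2))
      (weightHeight_le_of_mem_span hv h1 h0' (heightEnd_of_weight hv'.2))
  obtain ⟨c, hc⟩ := exists_eq_smul_of_mem_span hv h1 (by
    rw [heightEnd_of_weight hv'.2, h3])
  refine ⟨funext fun i => ?_, c, hc⟩
  have h4 := hv'.2 i
  have h5 : (E i i : U n) • v' = μ i • v' := by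
    rw [hc, smul_comm, hv.2, smul_comm]
  rw [h5, ← Nat.cast_smul_eq_nsmul ℂ, ← Nat.cast_smul_eq_nsmul ℂ] at h4
  exact_mod_cast smul_left_injective ℂ h0' h4

theorem finrank_hwSpace_simple [IsSimpleModule (U n) M] {μ : Fin n → ℕ} {v : M}
    (hv : v ∈ hwSpace M μ) (h0 : v ≠ 0) : Module.finrank ℂ (hwSpace M μ) = 1 := by
  refine finrank_eq_one (⟨v, hv⟩ : hwSpace M μ) (by simpa [Subtype.ext_iff] using h0) ?_
  rintro ⟨w, hw⟩
  by_cases hw0 : w = 0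
  · exact ⟨0, by simp [Subtype.ext_iff, hw0]⟩
  · obtain ⟨-, c, hc⟩ := hwSpace_simple hv hw h0 hw0
    exact ⟨c, Subtype.ext hc.symm⟩

theorem map_mem_hwSpace {M' : Type*} [AddCommGroup M'] [Module (U n) M'] [Module ℂ M']
    [IsScalarTower ℂ (U n) M'] (f : M →ₗ[U n] M') {μ : Fin n → ℕ} {v : M}
    (hv : v ∈ hwSpace M μ) : f v ∈ hwSpace M' μ :=
  ⟨fun i j hij => by rw [← map_smul, hv.1 i j hij, map_zero],
    fun i => by rw [← map_smul, hv.2, map_nsmul]⟩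

/-- A highest weight vector in a semisimple module generates a simple module. -/
theorem isSimpleModule_span [IsSemisimpleModule (U n) M] {μ : Fin n → ℕ} {v : M}
    (hv : v ∈ hwSpace M μ) (h0 : v ≠ 0) :
    IsSimpleModule (U n) (Submodule.span (U n) {v}) := by
  rw [isSimpleModule_iff_isAtom]
  refine ⟨fun h => h0 (by simpa using h), fun Q hQ => ?_⟩
  obtain ⟨Q', hQ'⟩ := exists_isCompl Q
  by_contra hne
  refine hQ.not_ge ?_
  have hp := Submodule.mem_sup.1 (show v ∈ Q ⊔ Q' by rw [hQ'.sup_eq_top]; trivial)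
  obtain ⟨q, hq, q', hq', hqq⟩ := hp
  have key : ∀ a ∈ Q, ∀ b ∈ Q', a + b = 0 → a = 0 := fun a ha b hb hab =>
    Submodule.disjoint_def.1 hQ'.disjoint a ha (by
      rw [eq_neg_of_add_eq_zero_left hab]; exact neg_mem hb)
  -- The component of `v` in `Q` inherits the highest weight equations, hence is `c • v`. If `c =
  -- 0`, then `v` lies in the complement and `Q` vanishes; otherwise `v` lies in `Q`.
  have hqh : q ∈ hwSpace M μ := by
    constructor
    · intro i j hij
      refine key _ (Q.smul_mem _ hq) _ (Q'.smul_mem (E i j) hq') ?_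
      rw [← smul_add, hqq, hv.1 i j hij]
    · intro i
      refine sub_eq_zero.1 (key _ (sub_mem (Q.smul_mem _ hq) (Q.smul_of_tower_mem _ hq))
        (E i i • q' - μ i • q') (sub_mem (Q'.smul_mem _ hq') (Q'.smul_of_tower_mem _ hq')) ?_)
      have := hv.2 i
      rw [← hqq, smul_add, smul_add] at this
      rw [sub_add_sub_comm, this, sub_self]
  obtain ⟨c, hc⟩ := exists_eq_smul_of_mem_span hv (hQ.le hq) (heightEnd_of_weight hqh.2)
  by_cases hc0 : c = 0
  · rw [hc0, zero_smul] at hc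
    rw [hc, zero_add] at hqq
    subst hqq
    refine absurd (Submodule.eq_bot_iff Q |>.2 fun x hx => ?_) hne
    exact Submodule.disjoint_def.1 hQ'.disjoint x hx
      ((Submodule.span_singleton_le_iff_mem _ _).2 hq' (hQ.le hx))
  · rw [Submodule.span_singleton_le_iff_mem]
    have : v = c⁻¹ • q := by rw [hc, smul_smul, inv_mul_cancel₀ hc0, one_smul]
    rw [this]
    exact Q.smul_of_tower_mem _ hq

/-- Simple modules with the same highest weight are isomorphic. -/
theorem exists_linearEquiv_of_hwSpace [IsSimpleModule (U n) M] {M' : Type*} [AddCommGroup M']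
    [Module (U n) M'] [Module ℂ M'] [IsScalarTower ℂ (U n) M'] [IsSimpleModule (U n) M']
    {μ : Fin n → ℕ} {v : M} {v' : M'} (hv : v ∈ hwSpace M μ) (hv' : v' ∈ hwSpace M' μ)
    (h0 : v ≠ 0) (h0' : v' ≠ 0) : ∃ e : M ≃ₗ[U n] M', e v = v' := by
  -- `P` will be the graph of the isomorphism. Its projections are onto by simplicity. A nonzero
  -- kernel element of the first one would put `(0, v')` in `P`; this has the same height as the
  -- generator `(v, v')` without being a multiple of it.
  let P := Submodule.span (U n) {(v, v')}
  have hP : (v, v') ∈ P := Submodule.mem_span_singleton_self _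
  have hw : (v, v') ∈ hwSpace (M × M') μ :=
    ⟨fun i j hij => Prod.ext (hv.1 i j hij) (hv'.1 i j hij),
      fun i => Prod.ext (hv.2 i) (hv'.2 i)⟩
  let f : P →ₗ[U n] M := LinearMap.fst _ _ _ ∘ₗ P.subtype
  let g : P →ₗ[U n] M' := LinearMap.snd _ _ _ ∘ₗ P.subtype
  have hf : Function.Surjective f := LinearMap.surjective_of_ne_zero fun h =>
    h0 (LinearMap.congr_fun h ⟨_, hP⟩)
  have hg : Function.Surjective g := LinearMap.surjective_of_ne_zero fun h =>
    h0' (LinearMap.congr_fun h ⟨_, hP⟩)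
  have hf' : Function.Injective f := by
    rw [← LinearMap.ker_eq_bot, Submodule.eq_bot_iff]
    rintro ⟨⟨x, y⟩, hxy⟩ hx
    have hx : x = 0 := hx
    subst hx
    by_contra hne
    have hy : y ≠ 0 := fun h => hne (by simp [h])
    have h1 : v' ∈ Submodule.span (U n) {y} := by
      rw [IsSimpleModule.span_singleton_eq_top (U n) hy]; trivial
    obtain ⟨u, hu⟩ := Submodule.mem_span_singleton.1 h1
    have h2 : ((0 : M), v') ∈ P := by
      have := P.smul_mem u hxy
      rwa [Prod.smul_mk, smul_zero, hu] at this
    obtain ⟨c, hc⟩ := exists_eq_smul_of_mem_span hw h2 (heightEnd_of_weight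
      fun i => Prod.ext (by simp) (hv'.2 i))
    have h3 : (0 : M) = c • v := congrArg Prod.fst hc
    have h4 : v' = c • v' := congrArg Prod.snd hc
    rcases smul_eq_zero.1 h3.symm with h | h
    · exact h0' (by rw [h4, h, zero_smul])
    · exact h0 h
  have hg' : Function.Injective g := by
    rw [← LinearMap.ker_eq_bot, Submodule.eq_bot_iff]
    rintro ⟨⟨y, x⟩, hxy⟩ hx
    have hx : x = 0 := hx
    subst hx
    by_contra hne
    have hy : y ≠ 0 := fun h => hne (by simp [h])
    have h1 : v ∈ Submodule.span (U n) {y} := by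
      rw [IsSimpleModule.span_singleton_eq_top (U n) hy]; trivial
    obtain ⟨u, hu⟩ := Submodule.mem_span_singleton.1 h1
    have h2 : (v, (0 : M')) ∈ P := by
      have := P.smul_mem u hxy
      rwa [Prod.smul_mk, smul_zero, hu] at this
    obtain ⟨c, hc⟩ := exists_eq_smul_of_mem_span hw h2 (heightEnd_of_weight
      fun i => Prod.ext (hv.2 i) (by simp))
    have h3 : (0 : M') = c • v' := congrArg Prod.snd hc
    have h4 : v = c • v := congrArg Prod.fst hc
    rcases smul_eq_zero.1 h3.symm with h | h
    · exact h0 (by rw [h4, h, zero_smul])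
    · exact h0' h
  let ef := LinearEquiv.ofBijective f ⟨hf', hf⟩
  let eg := LinearEquiv.ofBijective g ⟨hg', hg⟩
  refine ⟨ef.symm.trans eg, ?_⟩
  have h5 : ef.symm v = ⟨(v, v'), hP⟩ := by
    rw [LinearEquiv.symm_apply_eq]; rfl
  rw [LinearEquiv.trans_apply, h5]
  rfl

end Modules

/-! ### Isotypic decomposition and highest weight vectors -/

section Isotypic

variable {n : ℕ} {X : Type*} [AddCommGroup X] [Module (U n) X] [Module ℂ X]
  [IsScalarTower ℂ (U n) X]

theorem finrank_hwSpace_congr {Y : Type*} [AddCommGroup Y] [Module (U n) Y] [Module ℂ Y]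
    [IsScalarTower ℂ (U n) Y] (e : X ≃ₗ[U n] Y) (μ : Fin n → ℕ) :
    Module.finrank ℂ (hwSpace X μ) = Module.finrank ℂ (hwSpace Y μ) := by
  refine LinearEquiv.finrank_eq
    { toFun := fun x => ⟨e x.1, map_mem_hwSpace e.toLinearMap x.2⟩
      invFun := fun y => ⟨e.symm y.1, map_mem_hwSpace e.symm.toLinearMap y.2⟩
      map_add' := fun x y => Subtype.ext (map_add e _ _)
      map_smul' := fun c x => Subtype.ext ?_
      left_inv := fun x => Subtype.ext (by simp)
      right_inv := fun x => Subtype.ext (by simp) }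
  change e (c • x.1) = c • e x.1
  rw [← algebraMap_smul (U n) c, map_smul, algebraMap_smul]

theorem finrank_hwSpace_fun (m : ℕ) (μ : Fin n → ℕ) [FiniteDimensional ℂ (hwSpace X μ)] :
    Module.finrank ℂ (hwSpace (Fin m → X) μ) = m * Module.finrank ℂ (hwSpace X μ) := by
  have e : hwSpace (Fin m → X) μ ≃ₗ[ℂ] (Fin m → hwSpace X μ) :=
    { toFun := fun x k => ⟨x.1 k, map_mem_hwSpace (LinearMap.proj (R := U n) k) x.2⟩
      invFun := fun y => ⟨fun k => (y k).1,
        fun i j hij => funext fun k => (y k).2.1 i j hij, fun i => funext fun k => (y k).2.2 i⟩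
      map_add' := fun x y => rfl
      map_smul' := fun c x => rfl
      left_inv := fun x => rfl
      right_inv := fun x => rfl }
  rw [e.finrank_eq, Module.finrank_pi_fintype]
  simp

/-- Every nonzero highest weight vector of weight `μ` generates a copy of `M`, so it already lies in
the isotypic component. -/
theorem finrank_hwSpace_isotypicComponent [IsSemisimpleModule (U n) X] {M : Type*}
    [AddCommGroup M] [Module (U n) M] [Module ℂ M] [IsScalarTower ℂ (U n) M]
    [IsSimpleModule (U n) M] {μ : Fin n → ℕ} {v : M} (hv : v ∈ hwSpace M μ) (h0 : v ≠ 0) :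
    Module.finrank ℂ (hwSpace (isotypicComponent (U n) X M) μ) =
      Module.finrank ℂ (hwSpace X μ) := by
  set Y := isotypicComponent (U n) X M
  refine LinearEquiv.finrank_eq
    { toFun := fun x => ⟨x.1.1, map_mem_hwSpace Y.subtype x.2⟩
      invFun := fun x => ⟨⟨x.1, ?_⟩, fun i j hij => Subtype.ext (x.2.1 i j hij),
        fun i => Subtype.ext (x.2.2 i)⟩
      map_add' := fun x y => rfl
      map_smul' := fun c x => rfl
      left_inv := fun x => rfl
      right_inv := fun x => rfl }
  by_cases hx : x.1 = 0
  · rw [hx]; exact zero_mem _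
  · have := isSimpleModule_span x.2 hx
    have hx' : (⟨x.1, Submodule.mem_span_singleton_self _⟩ : Submodule.span (U n) {x.1}) ∈
        hwSpace (Submodule.span (U n) {x.1}) μ :=
      ⟨fun i j hij => Subtype.ext (x.2.1 i j hij), fun i => Subtype.ext (x.2.2 i)⟩
    obtain ⟨e, -⟩ := exists_linearEquiv_of_hwSpace hx' hv
      (fun h => hx (congrArg Subtype.val h)) h0
    exact (le_sSup (show Submodule.span (U n) {x.1} ∈ {m : Submodule (U n) X | Nonempty (m ≃ₗ[U n] M)} from ⟨e⟩))
      (Submodule.mem_span_singleton_self _)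

variable [FiniteDimensional ℂ X] [IsSemisimpleModule (U n) X]

/-- The component is a finite power of `M`, and each factor contributes exactly one dimension of
highest weight vectors; this identifies the exponent. -/
theorem nonempty_isotypicComponent_equiv {M : Type*}
    [AddCommGroup M] [Module (U n) M] [Module ℂ M] [IsScalarTower ℂ (U n) M]
    [IsSimpleModule (U n) M] {μ : Fin n → ℕ} {v : M} (hv : v ∈ hwSpace M μ) (h0 : v ≠ 0) :
    Nonempty (isotypicComponent (U n) X M ≃ₗ[U n]
      (Fin (Module.finrank ℂ (hwSpace X μ)) → M)) := by
  have hfin : Module.Finite (U n) (isotypicComponent (U n) X M) :=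
    have : FiniteDimensional ℂ (isotypicComponent (U n) X M) :=
      FiniteDimensional.finiteDimensional_submodule
        ((isotypicComponent (U n) X M).restrictScalars ℂ)
    Module.Finite.of_restrictScalars_finite ℂ (U n) _
  obtain ⟨m, ⟨e⟩⟩ := (IsIsotypicOfType.isotypicComponent (U n) X M).linearEquiv_fun
  have h1 := finrank_hwSpace_isotypicComponent (X := X) hv h0
  have hM := finrank_hwSpace_simple hv h0
  have : FiniteDimensional ℂ (hwSpace M μ) := FiniteDimensional.of_finrank_eq_succ hM
  rw [finrank_hwSpace_congr e, finrank_hwSpace_fun, hM, mul_one] at h1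
  rw [← h1]
  exact ⟨e⟩

theorem simpleMultiplicity_eq_finrank {M : Type*}
    [AddCommGroup M] [Module (U n) M] [Module ℂ M] [IsScalarTower ℂ (U n) M]
    [IsSimpleModule (U n) M] {μ : Fin n → ℕ} {v : M} (hv : v ∈ hwSpace M μ) (h0 : v ≠ 0) :
    simpleMultiplicity (U n) X M = Module.finrank ℂ (hwSpace X μ) := by
  obtain ⟨e⟩ := nonempty_isotypicComponent_equiv (X := X) hv h0
  rw [simpleMultiplicity, e.length_eq, Module.length_pi_of_fintype]
  simp

/-- `hX` supplies every simple submodule with a highest weight among the `μ a`, so the isotypic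
components of the `M a` exhaust `X`; injectivity of `μ` makes the `M a` pairwise non-isomorphic. -/
theorem nonempty_equiv_directSum {Λ : Type*} {M : Λ → Type*} [∀ a, AddCommGroup (M a)]
    [∀ a, Module (U n) (M a)] [∀ a, Module ℂ (M a)] [∀ a, IsScalarTower ℂ (U n) (M a)]
    [∀ a, IsSimpleModule (U n) (M a)] {μ : Λ → Fin n → ℕ} (hμ : Function.Injective μ)
    {v : ∀ a, M a} (hv : ∀ a, v a ∈ hwSpace (M a) (μ a)) (h0 : ∀ a, v a ≠ 0)
    (hX : ∀ S : Submodule (U n) X, IsSimpleModule (U n) S →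
      ∃ a, ∃ x ∈ S, x ≠ 0 ∧ x ∈ hwSpace X (μ a))
    {r : Λ → ℕ} (hr : ∀ a, Module.finrank ℂ (hwSpace X (μ a)) = r a) :
    Nonempty (X ≃ₗ[U n] ⨁ a, (Fin (r a) → M a)) := by
  classical
  obtain rfl : (fun a => Module.finrank ℂ (hwSpace X (μ a))) = r := funext hr
  let Y : Λ → Submodule (U n) X := fun a => isotypicComponent (U n) X (M a)
  have hS : ∀ S : Submodule (U n) X, IsSimpleModule (U n) S → ∃ a, Nonempty (S ≃ₗ[U n] M a) := by
    intro S hS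
    obtain ⟨a, x, hxS, hx0, hx⟩ := hX S hS
    have hx' : (⟨x, hxS⟩ : S) ∈ hwSpace S (μ a) :=
      ⟨fun i j hij => Subtype.ext (hx.1 i j hij), fun i => Subtype.ext (hx.2 i)⟩
    obtain ⟨e, -⟩ := exists_linearEquiv_of_hwSpace hx' (hv a)
      (fun h => hx0 (congrArg Subtype.val h)) (h0 a)
    exact ⟨a, ⟨e⟩⟩
  have hinj : ∀ a b, Nonempty (M a ≃ₗ[U n] M b) → a = b := by
    rintro a b ⟨e⟩
    refine hμ (hwSpace_simple (map_mem_hwSpace e.toLinearMap (hv a)) (hv b) ?_ (h0 b)).1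
    simpa using h0 a
  have htop : ⨆ a, Y a = ⊤ := by
    rw [eq_top_iff, ← IsSemisimpleModule.sSup_simples_eq_top (R := U n) (M := X)]
    refine sSup_le fun S hS' => ?_
    obtain ⟨a, ha⟩ := hS S hS'
    exact (le_sSup (show S ∈ {m : Submodule (U n) X | Nonempty (m ≃ₗ[U n] M a)} from ha)).trans (le_iSup Y a)
  -- A simple submodule in the overlap would be isomorphic both to `M a` and to some `M j` with `j ≠
  -- a`.
  have hind : iSupIndep Y := by
    intro a
    rw [disjoint_iff]
    by_contra hne
    obtain ⟨S, hSle, hSs⟩ := (IsSemisimpleModule.eq_bot_or_exists_simple_le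
      (R := U n) (Y a ⊓ ⨆ j, ⨆ (_ : j ≠ a), Y j)).resolve_left hne
    obtain ⟨e⟩ := isIsotypicOfType_submodule_iff.1
      (IsIsotypicOfType.isotypicComponent (U n) X (M a)) S (hSle.trans inf_le_left)
    have h2 : S ≤ sSup {m | ∃ j, j ≠ a ∧ m = Y j} :=
      (hSle.trans inf_le_right).trans (iSup₂_le fun j hj => le_sSup ⟨j, hj, rfl⟩)
    have : ∀ m : {m | ∃ j, j ≠ a ∧ m = Y j}, IsSemisimpleModule (U n) m := fun m => inferInstance
    obtain ⟨m, ⟨j, hj, rfl⟩, S', hS', ⟨e'⟩⟩ := Submodule.le_linearEquiv_of_le_sSup S _ h2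
    have := IsSimpleModule.congr e'.symm
    obtain ⟨e''⟩ := isIsotypicOfType_submodule_iff.1
      (IsIsotypicOfType.isotypicComponent (U n) X (M j)) S' hS'
    exact hj (hinj a j ⟨e.symm.trans (e'.trans e'')⟩).symm
  exact ⟨(hind.linearEquiv htop).symm.trans (DFinsupp.mapRange.linearEquiv fun a =>
    (nonempty_isotypicComponent_equiv (X := X) (hv a) (h0 a)).some)⟩

end Isotypic

/-! ### The tensor space on words -/

/-- The `N`-th tensor power of `ℂⁿ`, with the words of length `N` as orthonormal basis. -/
abbrev WordSpace (n N : ℕ) : Type := EuclideanSpace ℂ (Fin N → Fin n)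

/-- The matrix of the tensor product of the matrices `A x`. -/
def tensorMatrix {n N : ℕ} (A : Fin N → gl n) : Matrix (Fin N → Fin n) (Fin N → Fin n) ℂ :=
  Matrix.of fun f g => ∏ x, A x (f x) (g x)

section

variable {n N : ℕ}

theorem tensorMatrix_apply (A : Fin N → gl n) (f g : Fin N → Fin n) :
    tensorMatrix A f g = ∏ x, A x (f x) (g x) := rfl

theorem tensorMatrix_mul (A B : Fin N → gl n) :
    tensorMatrix (A * B) = tensorMatrix A * tensorMatrix B := by
  ext f g
  simp only [tensorMatrix_apply, Matrix.mul_apply, Pi.mul_apply, ← Finset.prod_mul_distrib]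
  rw [Finset.prod_univ_sum, Fintype.piFinset_univ]

theorem tensorMatrix_one : tensorMatrix (1 : Fin N → gl n) = 1 := by
  ext f g
  simp only [tensorMatrix_apply, Pi.one_apply, Matrix.one_apply, Finset.prod_ite_zero,
    Finset.mem_univ, forall_const, Finset.prod_const_one, funext_iff]

theorem tensorMatrix_conjTranspose (A : Fin N → gl n) :
    (tensorMatrix A).conjTranspose = tensorMatrix fun x => (A x).conjTranspose := by
  ext f g
  simp [tensorMatrix_apply, Matrix.conjTranspose_apply]

theorem tensorMatrix_mulSingle_apply (x : Fin N) (A : gl n) (f g : Fin N → Fin n) :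
    tensorMatrix (Pi.mulSingle x A) f g =
      A (f x) (g x) * ∏ y ∈ Finset.univ.erase x, (1 : gl n) (f y) (g y) := by
  rw [tensorMatrix_apply, ← Finset.mul_prod_erase _ _ (Finset.mem_univ x), Pi.mulSingle_eq_same]
  congr 1
  refine Finset.prod_congr rfl fun y hy => ?_
  rw [Pi.mulSingle_eq_of_ne (Finset.ne_of_mem_erase hy)]

theorem tensorMatrix_mulSingle_mulVec (x : Fin N) (A : gl n) (v : (Fin N → Fin n) → ℂ)
    (f : Fin N → Fin n) :
    (tensorMatrix (Pi.mulSingle x A)).mulVec v f = ∑ k, A (f x) k * v (Function.update f x k) := by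
  rw [Matrix.mulVec, dotProduct]
  symm
  refine Fintype.sum_of_injective (fun k => Function.update f x k)
    (Function.update_injective f x) _ _ ?_ ?_
  · intro g hg
    have : ∃ y ≠ x, f y ≠ g y := by
      by_contra! h
      refine hg ⟨g x, funext fun y => ?_⟩
      by_cases hy : y = x
      · subst hy; simp
      · simp [hy, h y hy]
    obtain ⟨y, hy, hfg⟩ := this
    rw [tensorMatrix_mulSingle_apply, Finset.prod_eq_zero (i := y) (by simp [hy]) (by simp [hfg]),
      mul_zero, zero_mul]
  · intro k
    rw [tensorMatrix_mulSingle_apply, Finset.prod_eq_one, mul_one]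
    · rw [Function.update_self]
    · intro y hy
      rw [Function.update_of_ne (Finset.ne_of_mem_erase hy), Matrix.one_apply_eq]

variable (n N) in
/-- The diagonal action of `gl_n` on words. -/
noncomputable def wordLie : gl n →ₗ⁅ℂ⁆ Matrix (Fin N → Fin n) (Fin N → Fin n) ℂ where
  toFun A := ∑ x, tensorMatrix (Pi.mulSingle x A)
  map_add' A B := by
    rw [← Finset.sum_add_distrib]
    refine Finset.sum_congr rfl fun x _ => ?_
    ext f g
    simp only [Matrix.add_apply, tensorMatrix_mulSingle_apply, add_mul]
  map_smul' c A := by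
    rw [RingHom.id_apply, Finset.smul_sum]
    refine Finset.sum_congr rfl fun x _ => ?_
    ext f g
    simp only [Matrix.smul_apply, tensorMatrix_mulSingle_apply, smul_eq_mul, mul_assoc]
  map_lie' {A B} := by
    rw [LieRing.of_associative_ring_bracket, LieRing.of_associative_ring_bracket, Finset.sum_mul_sum,
      Finset.sum_mul_sum]
    rw [Finset.sum_comm (f := fun i j => tensorMatrix (Pi.mulSingle i B) *
      tensorMatrix (Pi.mulSingle j A)), ← Finset.sum_sub_distrib]
    refine Finset.sum_congr rfl fun x _ => ?_
    -- Operators at different positions commute, so only the diagonal terms of the double sum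
    -- contribute.
    rw [← Finset.sum_sub_distrib, Finset.sum_eq_single x]
    · rw [← tensorMatrix_mul, ← tensorMatrix_mul, ← Pi.mulSingle_mul, ← Pi.mulSingle_mul]
      ext f g
      simp only [Matrix.sub_apply, tensorMatrix_mulSingle_apply, sub_mul]
    · intro y _ hy
      rw [← tensorMatrix_mul, ← tensorMatrix_mul,
        (Pi.mulSingle_commute (f := fun _ => gl n) hy.symm A B).eq, sub_self]
    · simp

variable (n N) in
/-- The representation of the enveloping algebra on words. -/
noncomputable def wordRep : U n →ₐ[ℂ] Matrix (Fin N → Fin n) (Fin N → Fin n) ℂ :=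
  UniversalEnvelopingAlgebra.lift ℂ (wordLie n N)

theorem wordRep_E (i j : Fin n) :
    wordRep n N (E i j) = ∑ x, tensorMatrix (Pi.mulSingle x (Matrix.single i j 1)) :=
  UniversalEnvelopingAlgebra.lift_ι_apply ..

noncomputable instance : Module (U n) (WordSpace n N) where
  smul u v := WithLp.toLp 2 ((wordRep n N u).mulVec v.ofLp)
  one_smul v := by
    change WithLp.toLp 2 ((wordRep n N 1).mulVec v.ofLp) = v
    rw [map_one, Matrix.one_mulVec]
  mul_smul a b v := by
    change WithLp.toLp 2 ((wordRep n N (a * b)).mulVec v.ofLp) =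
      WithLp.toLp 2 ((wordRep n N a).mulVec ((wordRep n N b).mulVec v.ofLp))
    rw [map_mul, Matrix.mulVec_mulVec]
  smul_zero a := by
    change WithLp.toLp 2 ((wordRep n N a).mulVec 0) = 0
    rw [Matrix.mulVec_zero]; rfl
  smul_add a v w := by
    change WithLp.toLp 2 ((wordRep n N a).mulVec (v.ofLp + w.ofLp)) = _
    rw [Matrix.mulVec_add]; rfl
  add_smul a b v := by
    change WithLp.toLp 2 ((wordRep n N (a + b)).mulVec v.ofLp) = _
    rw [map_add, Matrix.add_mulVec]; rfl
  zero_smul v := by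
    change WithLp.toLp 2 ((wordRep n N 0).mulVec v.ofLp) = _
    rw [map_zero, Matrix.zero_mulVec]; rfl

theorem smul_word_apply (u : U n) (v : WordSpace n N) (f : Fin N → Fin n) :
    (u • v) f = (wordRep n N u).mulVec v.ofLp f := rfl

instance : IsScalarTower ℂ (U n) (WordSpace n N) where
  smul_assoc c u v := by
    ext f
    rw [smul_word_apply, map_smul, Matrix.smul_mulVec]
    rfl

theorem E_smul_word_apply (i j : Fin n) (v : WordSpace n N) (f : Fin N → Fin n) :
    ((E i j : U n) • v) f = ∑ x, if f x = i then v (Function.update f x j) else 0 := by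
  rw [smul_word_apply, wordRep_E, Matrix.sum_mulVec, Finset.sum_apply]
  refine Finset.sum_congr rfl fun x _ => ?_
  rw [tensorMatrix_mulSingle_mulVec]
  split_ifs with h
  · rw [Finset.sum_eq_single j]
    · simp [h]
    · intro k _ hk
      simp [Ne.symm hk]
    · simp
  · refine Finset.sum_eq_zero fun k _ => ?_
    simp [Ne.symm h]

/-- The source both of complete reducibility of the word space and of the dominance of its highest
weights. -/
theorem inner_E_smul_left (i j : Fin n) (v w : WordSpace n N) :
    inner ℂ ((E i j : U n) • v) w = inner ℂ v ((E j i : U n) • w) := by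
  rw [EuclideanSpace.inner_eq_star_dotProduct, EuclideanSpace.inner_eq_star_dotProduct]
  change w.ofLp ⬝ᵥ star ((wordRep n N (E i j)).mulVec v.ofLp) =
    (wordRep n N (E j i)).mulVec w.ofLp ⬝ᵥ star v.ofLp
  have h : (wordRep n N (E i j)).conjTranspose = wordRep n N (E j i) := by
    rw [wordRep_E, wordRep_E, Matrix.conjTranspose_sum]
    refine Finset.sum_congr rfl fun x _ => ?_
    rw [tensorMatrix_conjTranspose]
    congr 1
    funext y
    by_cases hy : y = x
    · subst hy; simp
    · simp [Pi.mulSingle_eq_of_ne hy]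
  rw [Matrix.star_mulVec, h, dotProduct_comm, ← Matrix.dotProduct_mulVec, dotProduct_comm]

/-! ### Equivariant endomorphisms come from the enveloping algebra -/

/-- The sum of `A 0 ⊗ ⋯ ⊗ A (k - 1)` over all placements at distinct positions. -/
noncomputable def placementSum {k : ℕ} (A : Fin k → gl n) :
    Matrix (Fin N → Fin n) (Fin N → Fin n) ℂ :=
  ∑ p : Fin k ↪ Fin N, tensorMatrix (Function.extend p A 1)

theorem sum_subtype_range {ι κ R : Type*} [Fintype ι] [AddCommMonoid R] (p : ι ↪ κ)
    [Fintype {y // y ∈ Set.range p}] (F : κ → R) :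
    ∑ y : {y // y ∈ Set.range p}, F y = ∑ i, F (p i) := by
  symm
  exact Fintype.sum_bijective (fun i => (⟨p i, i, rfl⟩ : {y // y ∈ Set.range p}))
    ⟨fun i j hij => p.injective (congrArg Subtype.val hij), by rintro ⟨_, i, rfl⟩; exact ⟨i, rfl⟩⟩
    _ _ fun i => rfl

/-- In the product, `B` either falls on a free position, giving a placement of one matrix more, or
on an occupied one, where it multiplies the matrix already there. -/
theorem wordLie_mul_placementSum {k : ℕ} (B : gl n) (A : Fin k → gl n) :
    wordLie n N B * placementSum A = placementSum (Fin.cons B A : Fin (k + 1) → gl n) +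
      ∑ i, placementSum (Function.update A i (B * A i)) := by
  classical
  change (∑ x, tensorMatrix (Pi.mulSingle x B)) * _ = _
  simp only [placementSum]
  rw [← (Equiv.embeddingFinSucc k (Fin N)).symm.sum_comp, Fintype.sum_sigma,
    Finset.sum_comm (t := Finset.univ (α := Fin k ↪ Fin N)), Finset.mul_sum,
    ← Finset.sum_add_distrib]
  refine Finset.sum_congr rfl fun p _ => ?_
  rw [Finset.sum_mul, add_comm,
    ← Fintype.sum_subtype_add_sum_subtype (fun x => x ∈ Set.range p)]
  congr 1
  · refine (@sum_subtype_range (Fin k) (Fin N) _ _ _ p (Subtype.fintype _) fun y =>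
      tensorMatrix (Pi.mulSingle y B) * tensorMatrix (Function.extend p A 1)).trans
      (Finset.sum_congr rfl fun i _ => ?_)
    rw [← tensorMatrix_mul]
    congr 1
    funext x
    rw [Pi.mul_apply]
    by_cases hx : ∃ j, p j = x
    · obtain ⟨j, rfl⟩ := hx
      rw [p.injective.extend_apply, p.injective.extend_apply]
      by_cases hj : j = i
      · subst hj; simp
      · rw [Function.update_of_ne hj, Pi.mulSingle_eq_of_ne (p.injective.ne hj), one_mul]
    · rw [Function.extend_apply' _ _ _ hx, Function.extend_apply' _ _ _ hx,
        Pi.mulSingle_eq_of_ne (fun h => hx ⟨i, h.symm⟩), one_mul]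
  · refine Finset.sum_congr rfl fun y _ => ?_
    rw [← tensorMatrix_mul]
    congr 1
    set q : Fin (k + 1) ↪ Fin N := (Equiv.embeddingFinSucc k (Fin N)).symm ⟨p, y⟩ with hq
    have hq' : (q : Fin (k + 1) → Fin N) = Fin.cons (y : Fin N) p :=
      Equiv.coe_embeddingFinSucc_symm ⟨p, y⟩
    funext x
    rw [Pi.mul_apply]
    by_cases hxy : x = y
    · subst hxy
      have h0 : q 0 = (y : Fin N) := by rw [hq']; rfl
      rw [← h0, q.injective.extend_apply, h0, Pi.mulSingle_eq_same,
        Function.extend_apply' _ _ _ y.2, Fin.cons_zero, Pi.one_apply, mul_one]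
    · rw [Pi.mulSingle_eq_of_ne hxy, one_mul]
      by_cases hx : ∃ j, p j = x
      · obtain ⟨j, rfl⟩ := hx
        have h0 : q j.succ = p j := by rw [hq']; rfl
        rw [p.injective.extend_apply, ← h0, q.injective.extend_apply, Fin.cons_succ]
      · rw [Function.extend_apply' _ _ _ hx, Function.extend_apply']
        rintro ⟨j, hj⟩
        rw [hq'] at hj
        induction j using Fin.cases with
        | zero => exact hxy hj.symm
        | succ j => exact hx ⟨j, hj⟩

/-- Induction on the number of placed matrices: the preceding identity is solved for its term with
`k + 1` matrices. -/
theorem placementSum_mem_range {k : ℕ} (A : Fin k → gl n) :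
    placementSum A ∈ (wordRep n N).range := by
  induction k with
  | zero =>
    have : placementSum A = (Fintype.card (Fin 0 ↪ Fin N) : ℂ) •
        (1 : Matrix (Fin N → Fin n) (Fin N → Fin n) ℂ) := by
      rw [placementSum, Finset.sum_congr rfl (g := fun _ => 1), Finset.sum_const, Finset.card_univ,
        Nat.cast_smul_eq_nsmul]
      intro p _
      rw [← tensorMatrix_one]
      congr 1
      funext x
      rw [Function.extend_apply']
      rintro ⟨i, -⟩
      exact i.elim0
    rw [this]
    exact Subalgebra.smul_mem _ (one_mem _) _
  | succ k ih =>
    rw [← Fin.cons_self_tail A, eq_sub_of_add_eq (wordLie_mul_placementSum (A 0)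
      (Fin.tail A)).symm]
    refine sub_mem (mul_mem ?_ (ih _)) (sum_mem fun i _ => ih _)
    exact ⟨UniversalEnvelopingAlgebra.ι ℂ (A 0), UniversalEnvelopingAlgebra.lift_ι_apply ..⟩

theorem placementSum_full (A : Fin N → gl n) :
    placementSum A = ∑ σ : Equiv.Perm (Fin N), tensorMatrix (A ∘ σ) := by
  -- The matrix `A y` sits at position `p y`, so position `x` carries `A (p⁻¹ x)`; hence the
  -- inversion.
  refine Fintype.sum_equiv ((Equiv.embeddingEquivOfFinite (Fin N)).trans (Equiv.inv _)) _ _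
    fun p => ?_
  congr 1
  funext x
  have hp : Function.Surjective p := Finite.injective_iff_surjective.1 p.injective
  obtain ⟨y, rfl⟩ := hp x
  have h : (Equiv.embeddingEquivOfFinite (Fin N) p) y = p y := rfl
  rw [p.injective.extend_apply, Equiv.trans_apply, Equiv.inv_apply, Function.comp_apply, ← h]
  exact congrArg A (Equiv.symm_apply_apply _ y).symm

theorem tensorMatrix_single (f g : Fin N → Fin n) :
    tensorMatrix (fun x => (Matrix.single (f x) (g x) (1 : ℂ) : gl n)) = Matrix.single f g 1 := by
  ext f' g'
  rw [tensorMatrix_apply]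
  simp only [Matrix.single_apply, Finset.prod_ite_zero, Finset.mem_univ, forall_const,
    Finset.prod_const_one, funext_iff, forall_and]

/-- Matrices commuting with the permutations of the positions lie in the image of the enveloping
algebra. -/
theorem mem_range_wordRep (φ : Matrix (Fin N → Fin n) (Fin N → Fin n) ℂ)
    (h : ∀ (σ : Equiv.Perm (Fin N)) f g, φ (f ∘ σ) (g ∘ σ) = φ f g) :
    φ ∈ (wordRep n N).range := by
  -- Expanding `φ` in matrix units and symmetrising turns each unit into a full placement sum, while
  -- the invariant `φ` is only multiplied by the order of the symmetric group.
  have key : ∑ f, ∑ g, φ f g •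
      placementSum (fun x => (Matrix.single (f x) (g x) (1 : ℂ) : gl n)) =
      (Fintype.card (Equiv.Perm (Fin N)) : ℂ) • φ := by
    simp only [placementSum_full, Finset.smul_sum]
    have h1 : ∀ f : Fin N → Fin n, ∑ g : Fin N → Fin n, ∑ σ : Equiv.Perm (Fin N), φ f g •
        tensorMatrix ((fun x => (Matrix.single (f x) (g x) (1 : ℂ) : gl n)) ∘ σ) =
        ∑ σ : Equiv.Perm (Fin N), ∑ g : Fin N → Fin n,
          φ (f ∘ σ) (g ∘ σ) • Matrix.single (f ∘ σ) (g ∘ σ) (1 : ℂ) := by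
      intro f
      rw [Finset.sum_comm]
      refine Finset.sum_congr rfl fun σ _ => Finset.sum_congr rfl fun g _ => ?_
      rw [h, ← tensorMatrix_single]
      rfl
    simp only [h1]
    rw [Finset.sum_comm, Finset.sum_congr rfl (g := fun _ => φ), Finset.sum_const,
      Finset.card_univ, Nat.cast_smul_eq_nsmul]
    intro σ _
    have h2 : ∀ F : (Fin N → Fin n) → (Fin N → Fin n) →
        Matrix (Fin N → Fin n) (Fin N → Fin n) ℂ,
        ∑ f, ∑ g, F (f ∘ σ) (g ∘ σ) = ∑ f, ∑ g, F f g := by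
      intro F
      exact Fintype.sum_equiv (σ.symm.arrowCongr (Equiv.refl (Fin n))) _ _ fun f =>
        Fintype.sum_equiv (σ.symm.arrowCongr (Equiv.refl (Fin n))) _ _ fun g => rfl
    rw [h2 fun f g => φ f g • Matrix.single f g 1]
    conv_rhs => rw [Matrix.matrix_eq_sum_single φ]
    simp
  have hc : (Fintype.card (Equiv.Perm (Fin N)) : ℂ) ≠ 0 := by
    exact_mod_cast Fintype.card_ne_zero
  rw [← inv_smul_smul₀ hc φ, ← key]
  exact Subalgebra.smul_mem _ (sum_mem fun f _ => sum_mem fun g _ =>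
    Subalgebra.smul_mem _ (placementSum_mem_range _) _) _

end

/-! ### Permutations of positions, semisimplicity and highest weight vectors of the word space -/

section

variable {n N : ℕ}

variable (n) in
/-- The right action of permutations of the positions on words, `e_f ↦ e_{f ∘ σ}`. -/
noncomputable def wordAct (σ : Equiv.Perm (Fin N)) : WordSpace n N ≃ₗᵢ[ℂ] WordSpace n N :=
  LinearIsometryEquiv.piLpCongrLeft 2 ℂ ℂ (σ.symm.arrowCongr (Equiv.refl (Fin n)))

theorem wordAct_apply (σ : Equiv.Perm (Fin N)) (v : WordSpace n N) (f : Fin N → Fin n) :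
    wordAct n σ v f = v (f ∘ σ.symm) := rfl

theorem wordAct_single (σ : Equiv.Perm (Fin N)) (f : Fin N → Fin n) :
    wordAct n σ (EuclideanSpace.single f 1) = EuclideanSpace.single (f ∘ σ) 1 :=
  EuclideanSpace.piLpCongrLeft_single _ _ _

theorem wordAct_mul (σ τ : Equiv.Perm (Fin N)) (v : WordSpace n N) :
    wordAct n (σ * τ) v = wordAct n τ (wordAct n σ v) := rfl

theorem wordAct_E_smul (σ : Equiv.Perm (Fin N)) (i j : Fin n) (v : WordSpace n N) :
    wordAct n σ ((E i j : U n) • v) = (E i j : U n) • wordAct n σ v := by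
  ext f
  rw [wordAct_apply, E_smul_word_apply, E_smul_word_apply]
  refine Fintype.sum_equiv σ.symm _ _ fun x => ?_
  rw [wordAct_apply, Function.update_comp_equiv, Equiv.symm_symm, Equiv.apply_symm_apply,
    Function.comp_apply]

theorem wordAct_smul (σ : Equiv.Perm (Fin N)) (u : U n) (v : WordSpace n N) :
    wordAct n σ (u • v) = u • wordAct n σ v :=
  map_smul_of_map_E_smul (wordAct n σ).toLinearEquiv.toLinearMap (wordAct_E_smul σ) u v

/-- Endomorphisms commuting with the permutations act as elements of the enveloping algebra. -/
theorem exists_smul_eq (φ : WordSpace n N →ₗ[ℂ] WordSpace n N)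
    (h : ∀ (σ : Equiv.Perm (Fin N)) (v : WordSpace n N), φ (wordAct n σ v) = wordAct n σ (φ v)) :
    ∃ u : U n, ∀ v, u • v = φ v := by
  obtain ⟨m, rfl⟩ := (Matrix.toEuclideanLin (𝕜 := ℂ) (m := Fin N → Fin n)
    (n := Fin N → Fin n)).surjective φ
  have hm : ∀ f g, m f g = Matrix.toEuclideanLin m (EuclideanSpace.single g (1 : ℂ)) f := by
    intro f g
    simp [Matrix.toLpLin_apply]
  obtain ⟨u, hu⟩ := mem_range_wordRep m (fun σ f g => by
    rw [hm, hm, ← wordAct_single, h, wordAct_apply]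
    rw [Function.comp_assoc, Equiv.self_comp_symm, Function.comp_id])
  refine ⟨u, fun v => ?_⟩
  ext f
  rw [smul_word_apply, Matrix.toLpLin_apply, ← hu]
  rfl

/-- The orthogonal complement of a submodule is a submodule. -/
noncomputable def orthogonalSubmodule (Q : Submodule (U n) (WordSpace n N)) :
    Submodule (U n) (WordSpace n N) :=
  { (Q.restrictScalars ℂ)ᗮ with
    smul_mem' := fun u v hv => by
      refine smul_mem_of_E_smul_mem (Q.restrictScalars ℂ)ᗮ ?_ u hv
      intro i j x hx q hq
      rw [← inner_E_smul_left]
      exact hx _ (Q.smul_mem _ hq) }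

instance : IsSemisimpleModule (U n) (WordSpace n N) where
  exists_isCompl Q := by
    refine ⟨orthogonalSubmodule Q, ?_⟩
    have h : IsCompl (Q.restrictScalars ℂ) (Q.restrictScalars ℂ)ᗮ :=
      Submodule.isCompl_orthogonal _
    constructor
    · rw [Submodule.disjoint_def]
      exact fun x hx hx' => Submodule.disjoint_def.1 h.disjoint x hx hx'
    · rw [codisjoint_iff, eq_top_iff]
      intro x _
      have hx : x ∈ Q.restrictScalars ℂ ⊔ (Q.restrictScalars ℂ)ᗮ := by
        rw [h.sup_eq_top]; trivial
      obtain ⟨y, hy, z, hz, rfl⟩ := Submodule.mem_sup.1 hx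
      exact Submodule.add_mem_sup (T := orthogonalSubmodule Q) hy hz

/-- The content of a word: the number of occurrences of each letter. -/
def content (f : Fin N → Fin n) (i : Fin n) : ℕ := (Finset.univ.filter fun x => f x = i).card

theorem content_comp (f : Fin N → Fin n) (σ : Equiv.Perm (Fin N)) :
    content (f ∘ σ) = content f := by
  funext i
  exact Finset.card_equiv σ (by simp)

theorem sum_content (f : Fin N → Fin n) : ∑ i, content f i = N := by
  simpa [content] using (Finset.card_eq_sum_card_fiberwise (f := f) (s := Finset.univ)
    (t := Finset.univ) (fun _ _ => Finset.mem_univ _)).symm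

theorem E_self_smul_word_apply (i : Fin n) (v : WordSpace n N) (f : Fin N → Fin n) :
    ((E i i : U n) • v) f = content f i * v f := by
  rw [E_smul_word_apply, content, Finset.card_filter, Nat.cast_sum, Finset.sum_mul]
  refine Finset.sum_congr rfl fun x _ => ?_
  split_ifs with h
  · rw [← h, Function.update_eq_self]; simp
  · simp

theorem weight_word_iff {μ : Fin n → ℕ} {v : WordSpace n N} :
    (∀ i, (E i i : U n) • v = μ i • v) ↔ ∀ f, v f ≠ 0 → content f = μ := by
  constructor
  · intro h f hf
    funext i
    have := congrArg (fun w : WordSpace n N => w f) (h i)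
    simp only [E_self_smul_word_apply, PiLp.smul_apply, nsmul_eq_mul] at this
    have h2 := mul_right_cancel₀ hf this
    exact Nat.cast_injective (R := ℂ) h2
  · intro h i
    ext f
    rw [E_self_smul_word_apply, PiLp.smul_apply, nsmul_eq_mul]
    by_cases hf : v f = 0
    · rw [hf, mul_zero, mul_zero]
    · rw [h f hf]

theorem heightEnd_word_apply (v : WordSpace n N) (f : Fin N → Fin n) :
    heightEnd n (WordSpace n N) v f = weightHeight (content f) * v f := by
  rw [heightEnd_apply, heightElt, Finset.sum_smul, weightHeight, Nat.cast_sum, Finset.sum_mul,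
    WithLp.ofLp_sum, Finset.sum_apply]
  refine Finset.sum_congr rfl fun i _ => ?_
  rw [smul_assoc, PiLp.smul_apply, E_self_smul_word_apply, smul_eq_mul, Nat.cast_mul, mul_assoc]

/-- Submodules are stable under the projection to a weight space. -/
theorem exists_smul_eq_weight_component (μ : Fin n → ℕ) :
    ∃ u : U n, ∀ (v : WordSpace n N) f, (u • v) f = if content f = μ then v f else 0 := by
  classical
  -- The projection to the words of content `μ` commutes with permutations, since content does not
  -- see the order of the letters.
  obtain ⟨u, hu⟩ := exists_smul_eq (n := n) (N := N)
    { toFun := fun v => WithLp.toLp 2 fun f => if content f = μ then v f else 0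
      map_add' := fun v w => by
        ext f
        simp only [PiLp.add_apply]
        split_ifs <;> simp
      map_smul' := fun c v => by
        ext f
        simp } (fun σ v => by
        ext f
        change (if content f = μ then _ else _) = if content (f ∘ σ.symm) = μ then _ else _
        rw [content_comp]
        rfl)
  exact ⟨u, fun v f => by rw [hu]; rfl⟩

/-- A weight vector of least height in `Q` is a highest weight vector: a raising operator that did
not kill it would yield a weight vector in `Q` of smaller height. -/
theorem exists_mem_hwSpace_word (Q : Submodule (U n) (WordSpace n N)) (hQ : Q ≠ ⊥) :
    ∃ μ : Fin n → ℕ, ∃ v ∈ Q, v ≠ 0 ∧ v ∈ hwSpace (WordSpace n N) μ := by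
  have hex : ∀ q ∈ Q, ∀ f, q f ≠ 0 → ∃ v ∈ Q, v ≠ 0 ∧
      ∀ i, (E i i : U n) • v = content f i • v := by
    intro q hq f hf
    obtain ⟨u, hu⟩ := exists_smul_eq_weight_component (N := N) (content f)
    refine ⟨u • q, Q.smul_mem _ hq, fun h => hf ?_, weight_word_iff.2 fun g hg => ?_⟩
    · have := hu q f
      rw [h, if_pos rfl] at this
      exact this.symm
    · rw [hu] at hg
      by_contra hne
      exact hg (if_neg hne)
  have hne : ∃ k : ℕ, ∃ μ : Fin n → ℕ, weightHeight μ = k ∧ ∃ v ∈ Q, v ≠ 0 ∧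
      ∀ i, (E i i : U n) • v = μ i • v := by
    obtain ⟨q, hq, hq0⟩ := Submodule.exists_mem_ne_zero_of_ne_bot hQ
    have : ∃ f, q f ≠ 0 := by
      by_contra! h
      exact hq0 (PiLp.ext h)
    obtain ⟨f, hf⟩ := this
    exact ⟨_, content f, rfl, hex q hq f hf⟩
  classical
  obtain ⟨μ, hμ, v, hv, hv0, hvw⟩ := Nat.find_spec hne
  refine ⟨μ, v, hv, hv0, fun i j hij => ?_, hvw⟩
  by_contra hE
  have : ∃ f, ((E i j : U n) • v) f ≠ 0 := by
    by_contra! h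
    exact hE (PiLp.ext h)
  obtain ⟨f, hf⟩ := this
  have h1 := congrArg (fun w : WordSpace n N => w f)
    (heightEnd_E_smul (i := i) (j := j) (heightEnd_of_weight hvw))
  simp only [heightEnd_word_apply, PiLp.smul_apply, smul_eq_mul] at h1
  have h2 := mul_right_cancel₀ hf h1
  have h3 : ((weightHeight (content f) + j : ℕ) : ℂ) = ((weightHeight μ + i : ℕ) : ℂ) := by
    push_cast
    rw [h2]; ring
  have h4 : weightHeight (content f) + j = weightHeight μ + i := by exact_mod_cast h3
  have h5 : weightHeight (content f) < weightHeight μ := by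
    have : (i : ℕ) < j := hij
    omega
  rw [hμ] at h5
  exact Nat.find_min hne h5 ⟨content f, rfl, hex _ (Q.smul_mem _ hv) f hf⟩

/-- Passing to the adjoint leaves `E i j * E j i` acting on `v`, and `E i j` kills `v`, so only the
commutator `E i i - E j j` remains. Positivity of the norm then forces the weight to be a partition.
-/
theorem norm_E_smul_sq {μ : Fin n → ℕ} {v : WordSpace n N} (hv : v ∈ hwSpace (WordSpace n N) μ)
    {i j : Fin n} (hij : i < j) :
    ((‖(E j i : U n) • v‖ ^ 2 : ℝ) : ℂ) = ((μ i : ℂ) - μ j) * ((‖v‖ ^ 2 : ℝ) : ℂ) := by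
  have h : (E i j : U n) • (E j i : U n) • v = ((μ i : ℂ) - μ j) • v := by
    rw [smul_smul, ← sub_add_cancel (E i j * E j i : U n) (E j i * E i j), E_mul_sub, if_pos rfl,
      if_pos rfl, add_smul, sub_smul, mul_smul, hv.1 i j hij, smul_zero, add_zero, hv.2, hv.2,
      sub_smul, Nat.cast_smul_eq_nsmul, Nat.cast_smul_eq_nsmul]
  have h2 := inner_self_eq_norm_sq_to_K (𝕜 := ℂ) ((E j i : U n) • v)
  rw [inner_E_smul_left, h, inner_smul_right, inner_self_eq_norm_sq_to_K] at h2
  push_cast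
  exact h2.symm

theorem weight_antitone {μ : Fin n → ℕ} {v : WordSpace n N} (hv : v ∈ hwSpace (WordSpace n N) μ)
    (h0 : v ≠ 0) : Antitone μ := by
  intro i j hij
  rcases hij.eq_or_lt with rfl | hij
  · exact le_rfl
  have h := norm_E_smul_sq hv hij
  have h1 : ‖(E j i : U n) • v‖ ^ 2 = ((μ i : ℝ) - μ j) * ‖v‖ ^ 2 := by exact_mod_cast h
  have h2 : 0 ≤ ((μ i : ℝ) - μ j) * ‖v‖ ^ 2 := h1 ▸ sq_nonneg _
  have h3 : 0 < ‖v‖ ^ 2 := by positivity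
  have h4 := nonneg_of_mul_nonneg_left h2 h3
  have : (μ j : ℝ) ≤ μ i := by linarith
  exact_mod_cast this

theorem sum_weight {μ : Fin n → ℕ} {v : WordSpace n N} (hv : v ∈ hwSpace (WordSpace n N) μ)
    (h0 : v ≠ 0) : ∑ i, μ i = N := by
  have : ∃ f, v f ≠ 0 := by
    by_contra! h
    exact h0 (PiLp.ext h)
  obtain ⟨f, hf⟩ := this
  rw [← weight_word_iff.1 hv.2 f hf, sum_content]

/-- The weight of a bounded partition. -/
def BoundedPartition.weight (lam : BoundedPartition n N) (i : Fin n) : ℕ := lam.1.rowLen i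

theorem rowLen_eq_zero {μ : YoungDiagram} {i : ℕ} (h : μ.colLen 0 ≤ i) : μ.rowLen i = 0 := by
  by_contra hne
  have : (i, 0) ∈ μ := YoungDiagram.mem_iff_lt_rowLen.2 (Nat.pos_of_ne_zero hne)
  exact absurd (YoungDiagram.mem_iff_lt_colLen.1 this) (not_lt.2 h)

theorem BoundedPartition.weight_injective :
    Function.Injective (BoundedPartition.weight (n := n) (N := N)) := by
  intro a b hab
  refine Subtype.ext (YoungDiagram.ext (Finset.ext fun c => ?_))
  have : ∀ i, a.1.rowLen i = b.1.rowLen i := by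
    intro i
    by_cases hi : i < n
    · exact congrFun hab ⟨i, hi⟩
    · rw [rowLen_eq_zero (a.2.2.trans (not_lt.1 hi)), rowLen_eq_zero (b.2.2.trans (not_lt.1 hi))]
  rw [YoungDiagram.mem_cells, YoungDiagram.mem_cells, YoungDiagram.mem_iff_lt_rowLen,
    YoungDiagram.mem_iff_lt_rowLen, this]

theorem card_eq_sum_rowLen (μ : YoungDiagram) (h : μ.colLen 0 ≤ n) :
    μ.card = ∑ i : Fin n, μ.rowLen i := by
  rw [Fin.sum_univ_eq_sum_range fun i => μ.rowLen i]
  rw [YoungDiagram.card, Finset.card_eq_sum_card_fiberwise (f := Prod.fst) (t := Finset.range n)]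
  · refine Finset.sum_congr rfl fun i _ => ?_
    rw [YoungDiagram.rowLen_eq_card]
    rfl
  · intro c hc
    have : (c.1, 0) ∈ μ := μ.up_left_mem le_rfl (Nat.zero_le _) (show (c.1, c.2) ∈ μ from hc)
    simpa using (YoungDiagram.mem_iff_lt_colLen.1 this).trans_le h

theorem BoundedPartition.exists_weight_eq (μ : Fin n → ℕ) (hμ : Antitone μ)
    (hN : ∑ i, μ i = N) : ∃ lam : BoundedPartition n N, lam.weight = μ := by
  have hs : (List.ofFn μ).SortedGE := List.sortedGE_ofFn_iff.2 hμ
  let Y := YoungDiagram.ofRowLens (List.ofFn μ) hs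
  have hrow : ∀ i : Fin n, Y.rowLen i = μ i := by
    intro i
    have := YoungDiagram.rowLen_ofRowLens (hw := hs) ⟨i, by simp⟩
    simpa using this
  have hcol : Y.colLen 0 ≤ n := by
    by_contra! h
    have h1 : (n, 0) ∈ Y := YoungDiagram.mem_iff_lt_colLen.2 h
    obtain ⟨h2, -⟩ := YoungDiagram.mem_ofRowLens.1 h1
    simp at h2
  refine ⟨⟨Y, ?_, hcol⟩, funext hrow⟩
  rw [card_eq_sum_rowLen Y hcol, ← hN]
  exact Finset.sum_congr rfl fun i _ => hrow i

/-- Highest weight vectors of equal weight generate the same space under permutations. -/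
theorem mem_span_wordAct {μ : Fin n → ℕ} {u v : WordSpace n N}
    (hu : u ∈ hwSpace (WordSpace n N) μ) (hv : v ∈ hwSpace (WordSpace n N) μ) (hu0 : u ≠ 0) :
    v ∈ Submodule.span ℂ (Set.range fun σ : Equiv.Perm (Fin N) => wordAct n σ u) := by
  by_cases hv0 : v = 0
  · rw [hv0]; exact zero_mem _
  set P := Submodule.span ℂ (Set.range fun σ : Equiv.Perm (Fin N) => wordAct n σ u) with hP
  have hmap : ∀ σ : Equiv.Perm (Fin N),
      P.map (wordAct n σ).toLinearIsometry.toLinearMap = P := by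
    intro σ
    rw [hP, Submodule.map_span, ← Set.range_comp]
    congr 1
    ext w
    constructor
    · rintro ⟨τ, rfl⟩
      exact ⟨τ * σ, wordAct_mul τ σ u⟩
    · rintro ⟨τ, rfl⟩
      refine ⟨τ * σ⁻¹, ?_⟩
      change wordAct n σ (wordAct n (τ * σ⁻¹) u) = _
      rw [← wordAct_mul, inv_mul_cancel_right]
  -- `P` is stable under the isometries `wordAct`, so its orthogonal projection commutes with them
  -- and is the action of some `x` in the enveloping algebra.
  obtain ⟨x, hx⟩ := exists_smul_eq (P.starProjection : WordSpace n N →L[ℂ] WordSpace n N).toLinearMap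
    (fun σ w => by
      have h := (wordAct n σ).toLinearIsometry.map_starProjection P w
      simp only [hmap] at h
      exact h.symm)
  have hxu : x • u = u := by
    rw [hx]
    exact Submodule.starProjection_eq_self_iff.2 (Submodule.subset_span ⟨1, rfl⟩)
  have := isSimpleModule_span hu hu0
  have := isSimpleModule_span hv hv0
  obtain ⟨e, he⟩ := exists_linearEquiv_of_hwSpace
    (M := Submodule.span (U n) {u}) (M' := Submodule.span (U n) {v}) (μ := μ)
    (v := ⟨u, Submodule.mem_span_singleton_self u⟩) (v' := ⟨v, Submodule.mem_span_singleton_self v⟩)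
    ⟨fun i j hij => Subtype.ext (hu.1 i j hij), fun i => Subtype.ext (hu.2 i)⟩
    ⟨fun i j hij => Subtype.ext (hv.1 i j hij), fun i => Subtype.ext (hv.2 i)⟩
    (fun h => hu0 (congrArg Subtype.val h)) (fun h => hv0 (congrArg Subtype.val h))
  -- The isomorphism taking `u` to `v` carries `x • u = u` over to `v`, so the projection fixes `v`.
  have hxv : x • v = v := by
    have h1 : x • (⟨u, Submodule.mem_span_singleton_self u⟩ : Submodule.span (U n) {u}) =
        ⟨u, Submodule.mem_span_singleton_self u⟩ := Subtype.ext hxu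
    have h2 := congrArg e h1
    rw [map_smul, he] at h2
    exact congrArg Subtype.val h2
  rw [hx] at hxv
  exact Submodule.starProjection_eq_self_iff.1 hxv

end

/-! ### Specht modules as spaces of highest weight vectors -/

section

variable {n N : ℕ}

theorem E_smul_single (i j : Fin n) (g : Fin N → Fin n) :
    (E i j : U n) • (EuclideanSpace.single g 1 : WordSpace n N) =
      ∑ x ∈ Finset.univ.filter fun x => g x = j,
        EuclideanSpace.single (Function.update g x i) 1 := by
  ext f
  rw [E_smul_word_apply, WithLp.ofLp_sum, Finset.sum_apply, Finset.sum_filter]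
  refine Finset.sum_congr rfl fun x _ => ?_
  simp only [PiLp.single_apply]
  have : (f x = i ∧ Function.update f x j = g) ↔ (g x = j ∧ f = Function.update g x i) := by
    constructor
    · rintro ⟨rfl, rfl⟩; simp
    · rintro ⟨rfl, h⟩
      rw [h]; simp
  by_cases h1 : f x = i <;> by_cases h2 : g x = j <;> simp_all

theorem Tableau.nonempty {μ : YoungDiagram} (h : μ.card = N) : Nonempty (Tableau μ N) :=
  ⟨(Finset.equivFinOfCardEq h).symm⟩

theorem Tableau.mem_columnStabilizer {μ : YoungDiagram} {t : Tableau μ N}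
    {σ : Equiv.Perm (Fin N)} :
    σ ∈ t.columnStabilizer ↔ ∀ x, (t (σ x)).1.2 = (t x).1.2 := by
  simp [Tableau.columnStabilizer]

theorem Tabloid.actEquiv_apply {μ : YoungDiagram} (g : Equiv.Perm (Fin N)) (r : Tabloid μ N)
    (x : Fin N) : (Tabloid.actEquiv μ N g r).1 x = r.1 (g x) := rfl

theorem Tableau.eq_one_of_actEquiv_eq {μ : YoungDiagram} {t : Tableau μ N}
    {σ : Equiv.Perm (Fin N)} (hσ : σ ∈ t.columnStabilizer)
    (h : Tabloid.actEquiv μ N σ t.tabloid = t.tabloid) : σ = 1 := by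
  ext x : 1
  refine t.injective (Subtype.ext (Prod.ext ?_ (mem_columnStabilizer.1 hσ x)))
  have := congrArg (fun r : Tabloid μ N => ((r.1 x : Fin _) : ℕ)) h
  exact this

/-- The coefficient at the tabloid of `t` is 1: a permutation preserving every column and every row
of `t` is the identity. -/
theorem Tableau.polytabloid_ne_zero {μ : YoungDiagram} (t : Tableau μ N) :
    t.polytabloid ≠ 0 := by
  intro h
  have h1 : t.polytabloid t.tabloid = 1 := by
    rw [Tableau.polytabloid, WithLp.ofLp_sum, Finset.sum_apply, Finset.sum_eq_single 1]
    · have : Tabloid.actEquiv μ N 1 t.tabloid = t.tabloid := rfl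
      simp [this]
    · intro σ hσ hne
      rw [PiLp.smul_apply, PiLp.single_apply, if_neg, smul_zero]
      intro h
      exact hne (eq_one_of_actEquiv_eq hσ h.symm)
    · intro h
      exact absurd (mem_columnStabilizer.2 fun x => rfl) h
  rw [h] at h1
  exact zero_ne_one h1

variable {μ : YoungDiagram}

/-- A tabloid as a word. -/
def tabloidWord (hc : μ.colLen 0 ≤ n) (r : Tabloid μ N) : Fin N → Fin n :=
  fun x => Fin.castLE hc (r.1 x)

theorem tabloidWord_injective (hc : μ.colLen 0 ≤ n) :
    Function.Injective (tabloidWord (N := N) hc) := by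
  intro r s h
  refine Subtype.ext (funext fun x => ?_)
  exact Fin.castLE_injective hc (congrFun h x)

theorem tabloidWord_actEquiv (hc : μ.colLen 0 ≤ n) (g : Equiv.Perm (Fin N)) (r : Tabloid μ N) :
    tabloidWord hc (Tabloid.actEquiv μ N g r) = tabloidWord hc r ∘ g := rfl

theorem content_tabloidWord (hc : μ.colLen 0 ≤ n) (r : Tabloid μ N) (i : Fin n) :
    content (tabloidWord hc r) i = μ.rowLen i := by
  by_cases hi : (i : ℕ) < μ.colLen 0
  · rw [← show _ = μ.rowLen i from r.2 ⟨i, hi⟩, content]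
    congr 1
    ext x
    simp [tabloidWord, Fin.ext_iff]
  · rw [rowLen_eq_zero (not_lt.1 hi), content, Finset.card_eq_zero, Finset.filter_eq_empty_iff]
    rintro x - rfl
    exact hi (r.1 x).2

/-- The permutation module on tabloids as a weight space of the word space. -/
noncomputable def tabloidEmbedding (hc : μ.colLen 0 ≤ n) :
    TabloidSpace μ N →ₗ[ℂ] WordSpace n N :=
  (WithLp.linearEquiv 2 ℂ _).symm.toLinearMap ∘ₗ
    Function.ExtendByZero.linearMap ℂ (tabloidWord hc) ∘ₗ (WithLp.linearEquiv 2 ℂ _).toLinearMap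

theorem tabloidEmbedding_tabloidWord (hc : μ.colLen 0 ≤ n) (v : TabloidSpace μ N)
    (r : Tabloid μ N) : tabloidEmbedding hc v (tabloidWord hc r) = v r :=
  (tabloidWord_injective hc).extend_apply _ _ _

theorem tabloidEmbedding_of_notMem (hc : μ.colLen 0 ≤ n) (v : TabloidSpace μ N)
    {f : Fin N → Fin n} (hf : ¬ ∃ r : Tabloid μ N, tabloidWord hc r = f) :
    tabloidEmbedding hc v f = 0 :=
  Function.extend_apply' _ _ _ hf

theorem tabloidEmbedding_injective (hc : μ.colLen 0 ≤ n) :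
    Function.Injective (tabloidEmbedding (N := N) hc) := by
  intro v w h
  ext r
  rw [← tabloidEmbedding_tabloidWord hc, h, tabloidEmbedding_tabloidWord]

theorem tabloidEmbedding_single (hc : μ.colLen 0 ≤ n) (r : Tabloid μ N) :
    tabloidEmbedding hc (EuclideanSpace.single r 1) =
      EuclideanSpace.single (tabloidWord hc r) 1 := by
  ext f
  by_cases hf : ∃ s : Tabloid μ N, tabloidWord hc s = f
  · obtain ⟨s, rfl⟩ := hf
    rw [tabloidEmbedding_tabloidWord, PiLp.single_apply, PiLp.single_apply]
    simp only [(tabloidWord_injective hc).eq_iff]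
  · rw [tabloidEmbedding_of_notMem hc _ hf, PiLp.single_apply, if_neg]
    rintro rfl
    exact hf ⟨r, rfl⟩

theorem tabloidEmbedding_rightAct (hc : μ.colLen 0 ≤ n) (g : Equiv.Perm (Fin N))
    (v : TabloidSpace μ N) :
    tabloidEmbedding hc (rightAct μ N g v) = wordAct n g (tabloidEmbedding hc v) := by
  ext f
  rw [wordAct_apply]
  by_cases hf : ∃ s : Tabloid μ N, tabloidWord hc s = f
  · obtain ⟨s, rfl⟩ := hf
    rw [tabloidEmbedding_tabloidWord]
    change v ((Tabloid.actEquiv μ N g).symm s) = _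
    rw [← tabloidEmbedding_tabloidWord hc]
    rfl
  · rw [tabloidEmbedding_of_notMem hc _ hf, tabloidEmbedding_of_notMem]
    rintro ⟨s, hs⟩
    refine hf ⟨Tabloid.actEquiv μ N g s, ?_⟩
    rw [tabloidWord_actEquiv, hs, Function.comp_assoc, Equiv.symm_comp_self, Function.comp_id]

theorem weight_tabloidEmbedding (hc : μ.colLen 0 ≤ n) (v : TabloidSpace μ N) (i : Fin n) :
    (E i i : U n) • tabloidEmbedding hc v = μ.rowLen i • tabloidEmbedding hc v := by
  refine (weight_word_iff (μ := fun i : Fin n => μ.rowLen i)).2 (fun f hf => ?_) i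
  by_cases h : ∃ s : Tabloid μ N, tabloidWord hc s = f
  · obtain ⟨s, rfl⟩ := h
    exact funext fun i => content_tabloidWord hc s i
  · exact absurd (tabloidEmbedding_of_notMem hc v h) hf

/-- The transposition of `y` and `z` is an odd element of the column stabilizer that fixes the word
`h`; left translation by it shows that the sum equals its negative. -/
theorem sum_columnStabilizer_eq_zero (t : Tableau μ N) (h : Fin N → Fin n)
    {y z : Fin N} (hyz : y ≠ z) (hcol : (t y).1.2 = (t z).1.2) (hh : h y = h z) :
    ∑ σ ∈ t.columnStabilizer, ((Equiv.Perm.sign σ : ℤ) : ℂ) •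
      wordAct n σ (EuclideanSpace.single h 1) = 0 := by
  have hτ : ∀ x, (t (Equiv.swap y z x)).1.2 = (t x).1.2 := by
    intro x
    by_cases hx : x = y
    · subst hx; rw [Equiv.swap_apply_left, hcol]
    · by_cases hx' : x = z
      · subst hx'; rw [Equiv.swap_apply_right, hcol]
      · rw [Equiv.swap_apply_of_ne_of_ne hx hx']
  have hhτ : h ∘ Equiv.swap y z = h := by
    funext x
    rw [Function.comp_apply]
    by_cases hx : x = y
    · subst hx; rw [Equiv.swap_apply_left, hh]
    · by_cases hx' : x = z
      · subst hx'; rw [Equiv.swap_apply_right, hh]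
      · rw [Equiv.swap_apply_of_ne_of_ne hx hx']
  set S := ∑ σ ∈ t.columnStabilizer, ((Equiv.Perm.sign σ : ℤ) : ℂ) •
      wordAct n σ (EuclideanSpace.single h 1) with hS
  have hact : wordAct n (Equiv.swap y z) (EuclideanSpace.single h 1) =
      EuclideanSpace.single h 1 := by
    rw [wordAct_single, hhτ]
  have hneg : S = -S := by
    conv_lhs => rw [hS]
    rw [hS, ← Finset.sum_neg_distrib]
    refine Finset.sum_equiv (Equiv.mulLeft (Equiv.swap y z)) ?_ ?_
    · intro σ
      rw [Tableau.mem_columnStabilizer, Tableau.mem_columnStabilizer]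
      simp only [Equiv.coe_mulLeft, Equiv.Perm.mul_apply, hτ]
    · intro σ _
      rw [Equiv.coe_mulLeft, wordAct_mul, hact, map_mul,
        Equiv.Perm.sign_swap hyz]
      simp
  have h2 : (2 : ℂ) • S = 0 := by
    rw [two_smul]
    nth_rewrite 1 [hneg]
    exact neg_add_cancel S
  exact (smul_eq_zero.1 h2).resolve_left two_ne_zero

/-- A raising operator replaces the letter `j` of one entry `y` by `i < j`. The box in row `i` of
the column of `y` holds another entry with letter `i`, so the alternating sum over the column
stabilizer vanishes. -/
theorem tabloidEmbedding_polytabloid_mem (hc : μ.colLen 0 ≤ n) (t : Tableau μ N) :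
    tabloidEmbedding hc t.polytabloid ∈ hwSpace (WordSpace n N) (fun i : Fin n => μ.rowLen i) := by
  refine ⟨fun i j hij => ?_, weight_tabloidEmbedding hc _⟩
  have h1 : tabloidEmbedding hc t.polytabloid =
      ∑ σ ∈ t.columnStabilizer, ((Equiv.Perm.sign σ : ℤ) : ℂ) •
        wordAct n σ (EuclideanSpace.single (tabloidWord hc t.tabloid) 1) := by
    rw [Tableau.polytabloid, map_sum]
    refine Finset.sum_congr rfl fun σ _ => ?_
    rw [map_smul, tabloidEmbedding_single, wordAct_single]
    rfl
  have h2 : (E i j : U n) • tabloidEmbedding hc t.polytabloid =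
      ∑ y ∈ Finset.univ.filter fun y => tabloidWord hc t.tabloid y = j,
        ∑ σ ∈ t.columnStabilizer, ((Equiv.Perm.sign σ : ℤ) : ℂ) •
        wordAct n σ (EuclideanSpace.single
          (Function.update (tabloidWord hc t.tabloid) y i) 1) := by
    rw [h1, Finset.smul_sum, Finset.sum_comm]
    refine Finset.sum_congr rfl fun σ _ => ?_
    rw [smul_comm, ← wordAct_smul, E_smul_single, map_sum, Finset.smul_sum]
  rw [h2]
  refine Finset.sum_eq_zero fun y hy => ?_
  have hy' : (t y).1.1 = j := by
    have := (Finset.mem_filter.1 hy).2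
    exact congrArg Fin.val this
  have hcell : ((i : ℕ), (t y).1.2) ∈ μ.cells := by
    refine μ.up_left_mem (j1 := (t y).1.2) (i2 := (t y).1.1) ?_ le_rfl (t y).2
    rw [hy']
    exact le_of_lt hij
  have hz := t.apply_symm_apply ⟨_, hcell⟩
  set z := t.symm ⟨_, hcell⟩
  have hyz : y ≠ z := by
    intro h
    have h3 : (t y).1.1 = i := by rw [h, hz]
    exact absurd (h3.symm.trans hy') (Nat.ne_of_lt hij)
  refine sum_columnStabilizer_eq_zero t _ hyz (by rw [hz]) ?_
  rw [Function.update_self, Function.update_of_ne hyz.symm]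
  refine Fin.ext ?_
  change (i : ℕ) = (t z).1.1
  rw [hz]

/-- The Specht module is the space of highest weight vectors in the word space. -/
theorem map_specht (lam : BoundedPartition n N) :
    (specht lam.1 N).map (tabloidEmbedding lam.2.2) = hwSpace (WordSpace n N) lam.weight := by
  apply le_antisymm
  · rw [specht, Submodule.map_span, Submodule.span_le]
    rintro _ ⟨_, ⟨t, rfl⟩, rfl⟩
    exact tabloidEmbedding_polytabloid_mem lam.2.2 t
  · intro w hw
    obtain ⟨t⟩ := Tableau.nonempty (μ := lam.1) (N := N) lam.2.1
    -- One nonzero polytabloid reaches every highest weight vector by permutations, and permutations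
    -- preserve the Specht module.
    have h := mem_span_wordAct (tabloidEmbedding_polytabloid_mem lam.2.2 t) hw (by
      rw [Ne, map_eq_zero_iff _ (tabloidEmbedding_injective lam.2.2)]
      exact t.polytabloid_ne_zero)
    refine Submodule.span_le.2 ?_ h
    rintro _ ⟨σ, rfl⟩
    refine ⟨rightAct lam.1 N σ t.polytabloid, ?_, tabloidEmbedding_rightAct ..⟩
    exact rightAct_mem_specht lam.1 N σ _ (Submodule.subset_span ⟨t, rfl⟩)

end

/-! ### The exponent `ν` of block permutations -/

section Nu

theorem nu_extendDomain {β γ : Type*} [Fintype β] [DecidableEq β] [Fintype γ] [DecidableEq γ]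
    {p : γ → Prop} [DecidablePred p] (f : β ≃ Subtype p) (σ : Equiv.Perm β) :
    nu (σ.extendDomain f) = nu σ := by
  rw [nu, nu, Equiv.Perm.cycleType_extendDomain]

theorem nu_permCongr {β γ : Type*} [Fintype β] [DecidableEq β] [Fintype γ] [DecidableEq γ]
    (e : β ≃ γ) (σ : Equiv.Perm β) : nu (e.permCongr σ) = nu σ := by
  let f : β ≃ {_x : γ // True} := e.trans (Equiv.subtypeUnivEquiv fun _ => trivial).symm
  rw [← nu_extendDomain f σ]
  congr 1

theorem nu_mul {β : Type*} [Fintype β] [DecidableEq β] {σ τ : Equiv.Perm β}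
    (h : σ.Disjoint τ) : nu (σ * τ) = nu σ + nu τ := by
  rw [nu, h.cycleType_mul, Multiset.map_add, Multiset.sum_add, nu, nu]

theorem nu_one {β : Type*} [Fintype β] [DecidableEq β] : nu (1 : Equiv.Perm β) = 0 := by
  simp [nu]

variable {α β : Type*} [Fintype α] [DecidableEq α] [Fintype β] [DecidableEq β]

theorem nu_prodExtendRight (a : α) (σ : Equiv.Perm β) :
    nu (Equiv.Perm.prodExtendRight a σ) = nu σ := by
  let f : β ≃ {p : α × β // p.1 = a} :=
    { toFun := fun b => ⟨(a, b), rfl⟩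
      invFun := fun p => p.1.2
      left_inv := fun b => rfl
      right_inv := by rintro ⟨⟨_, b⟩, rfl⟩; rfl }
  rw [← nu_extendDomain f σ]
  congr 1
  ext ⟨a', b⟩ : 1
  by_cases h : a' = a
  · subst h
    rw [Equiv.Perm.prodExtendRight_apply_eq]
    exact (Equiv.Perm.extendDomain_apply_image σ f b).symm
  · rw [Equiv.Perm.prodExtendRight_apply_ne _ h, Equiv.Perm.extendDomain_apply_not_subtype]
    exact h

/-- The permutation is the product of its restrictions to the fibres over `α`; these are disjoint,
and `nu` is additive on disjoint products. -/
theorem nu_prodCongrRight (σ : α → Equiv.Perm β) :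
    nu (Equiv.prodCongrRight σ : Equiv.Perm (α × β)) = ∑ a, nu (σ a) := by
  have hl : ∀ l : List α, l.Nodup →
      nu (l.map fun a => Equiv.Perm.prodExtendRight a (σ a)).prod =
        (l.map fun a => nu (σ a)).sum := by
    intro l hl
    induction l with
    | nil => simp [nu_one]
    | cons a l ih =>
      rw [List.map_cons, List.prod_cons, nu_mul, ih hl.of_cons, nu_prodExtendRight, List.map_cons,
        List.sum_cons]
      refine Equiv.Perm.disjoint_prod_right _ fun g hg => ?_
      obtain ⟨b, hb, rfl⟩ := List.mem_map.1 hg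
      rintro ⟨c, d⟩
      by_cases hc : c = a
      · right
        exact Equiv.Perm.prodExtendRight_apply_ne _
          (fun h => (List.nodup_cons.1 hl).1 (by rw [← hc, h]; exact hb)) _
      · exact Or.inl (Equiv.Perm.prodExtendRight_apply_ne _ hc _)
  rw [← Equiv.Perm.prod_prodExtendRight σ (Finset.nodup_toList Finset.univ)
    (fun a => Finset.mem_toList.2 (Finset.mem_univ a)), hl _ (Finset.nodup_toList _),
    Finset.sum_map_toList]

end Nu

/-! ### The column group as a product of symmetric groups, one for each column -/

section Columns

variable {n l : ℕ}

variable (n l) in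
/-- The entries of the rectangular tableau, indexed by column and row. -/
def gridEquiv : Fin l × Fin n ≃ Fin (n * l) := (Equiv.prodComm _ _).trans finProdFinEquiv

theorem gridEquiv_divNat (p : Fin l × Fin n) : (gridEquiv n l p).divNat = p.2 :=
  congrArg Prod.fst (finProdFinEquiv.symm_apply_apply (p.2, p.1))

theorem gridEquiv_modNat (p : Fin l × Fin n) : (gridEquiv n l p).modNat = p.1 :=
  congrArg Prod.snd (finProdFinEquiv.symm_apply_apply (p.2, p.1))

/-- The element of the column group permuting the `j`-th column by `σ j`. -/
def columnPerm (σ : Fin l → Equiv.Perm (Fin n)) : columnGroup n l :=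
  ⟨(gridEquiv n l).permCongr (Equiv.prodCongrRight σ), fun x => by
    obtain ⟨p, rfl⟩ := (gridEquiv n l).surjective x
    rw [Equiv.permCongr_apply, Equiv.symm_apply_apply, gridEquiv_modNat, gridEquiv_modNat]
    rfl⟩

theorem columnPerm_apply (σ : Fin l → Equiv.Perm (Fin n)) (p : Fin l × Fin n) :
    (columnPerm σ).1 (gridEquiv n l p) = gridEquiv n l (p.1, σ p.1 p.2) := by
  change (gridEquiv n l).permCongr (Equiv.prodCongrRight σ) _ = _
  rw [Equiv.permCongr_apply, Equiv.symm_apply_apply]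
  rfl

theorem columnPerm_bijective : Function.Bijective (columnPerm (n := n) (l := l)) := by
  constructor
  · intro σ τ h
    funext j
    ext i : 1
    have := columnPerm_apply σ (j, i)
    rw [h, columnPerm_apply] at this
    exact (congrArg Prod.snd ((gridEquiv n l).injective this)).symm
  · rintro ⟨h, hh⟩
    have h1 : ∀ j i, h (gridEquiv n l (j, i)) =
        gridEquiv n l (j, (h (gridEquiv n l (j, i))).divNat) := by
      intro j i
      obtain ⟨⟨a, b⟩, hp⟩ := (gridEquiv n l).surjective (h (gridEquiv n l (j, i)))
      have h2 := hh (gridEquiv n l (j, i))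
      rw [← hp, gridEquiv_modNat, gridEquiv_modNat] at h2
      rw [← hp, gridEquiv_divNat]
      congr 2
    have hinj : ∀ j, Function.Injective fun i => (h (gridEquiv n l (j, i))).divNat := by
      intro j i i' hi
      have h2 : h (gridEquiv n l (j, i)) = h (gridEquiv n l (j, i')) := by
        rw [h1 j i, h1 j i']
        congr 2
      exact congrArg Prod.snd ((gridEquiv n l).injective (h.injective h2))
    refine ⟨fun j => Equiv.ofBijective _ (Finite.injective_iff_bijective.1 (hinj j)),
      Subtype.ext (Equiv.ext fun x => ?_)⟩
    obtain ⟨⟨j, i⟩, rfl⟩ := (gridEquiv n l).surjective x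
    rw [columnPerm_apply]
    exact (h1 j i).symm

theorem nu_columnPerm (σ : Fin l → Equiv.Perm (Fin n)) :
    nu (columnPerm σ).1 = ∑ j, nu (σ j) := by
  change nu ((gridEquiv n l).permCongr (Equiv.prodCongrRight σ)) = _
  rw [nu_permCongr, nu_prodCongrRight]

end Columns

/-! ### From words to polynomials -/

section Polynomials

variable {n l : ℕ}

instance : IsScalarTower ℂ (U n) (PolyMat n) where
  smul_assoc c u f := by
    change UniversalEnvelopingAlgebra.lift ℂ (glAction n) (c • u) f =
      c • UniversalEnvelopingAlgebra.lift ℂ (glAction n) u f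
    rw [map_smul]
    rfl

theorem E_smul_eq_glDerivation (i j : Fin n) (f : PolyMat n) :
    (E i j : U n) • f = glDerivation n (Matrix.single i j 1) f := by
  change UniversalEnvelopingAlgebra.lift ℂ (glAction n) (UniversalEnvelopingAlgebra.ι ℂ _) f = _
  rw [UniversalEnvelopingAlgebra.lift_ι_apply]
  rfl

theorem E_smul_X (i j k s : Fin n) :
    (E i j : U n) • (MvPolynomial.X (k, s) : PolyMat n) =
      if k = j then MvPolynomial.X (i, s) else 0 := by
  rw [E_smul_eq_glDerivation, glDerivation_X]
  split_ifs with h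
  · subst h
    rw [Finset.sum_eq_single i]
    · simp
    · intro b _ hb
      simp [Ne.symm hb]
    · simp
  · refine Finset.sum_eq_zero fun b _ => ?_
    simp [Ne.symm h]

theorem E_smul_prod {κ : Type*} [DecidableEq κ] (i j : Fin n) (s : Finset κ) (g : κ → PolyMat n) :
    (E i j : U n) • ∏ x ∈ s, g x = ∑ x ∈ s, ((E i j : U n) • g x) * ∏ y ∈ s.erase x, g y := by
  induction s using Finset.induction_on with
  | empty =>
    rw [Finset.prod_empty, E_smul_eq_glDerivation, Derivation.map_one_eq_zero, Finset.sum_empty]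
  | insert a s ha ih =>
    rw [Finset.prod_insert ha, E_smul_eq_glDerivation, Derivation.leibniz,
      ← E_smul_eq_glDerivation, ← E_smul_eq_glDerivation, ih, Finset.sum_insert ha,
      Finset.erase_insert ha, add_comm, smul_eq_mul, smul_eq_mul, mul_comm]
    congr 1
    rw [Finset.mul_sum]
    refine Finset.sum_congr rfl fun x hx => ?_
    have hax : a ≠ x := fun h => ha (h ▸ hx)
    rw [Finset.erase_insert_of_ne hax, Finset.prod_insert (fun h => ha (Finset.mem_of_mem_erase h))]
    ring

/-- The monomial of a word: the letter at `x` is the row index, the row of `x` in the rectangular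
tableau the column index of the variable. -/
noncomputable def wordMonomial (f : Fin (n * l) → Fin n) : PolyMat n :=
  ∏ x, MvPolynomial.X (f x, x.divNat)

/-- The exponent of the monomial of a word. -/
noncomputable def wordExponent (f : Fin (n * l) → Fin n) : Fin n × Fin n →₀ ℕ :=
  ∑ x, Finsupp.single (f x, x.divNat) 1

theorem wordMonomial_eq (f : Fin (n * l) → Fin n) :
    wordMonomial f = MvPolynomial.monomial (wordExponent f) 1 := by
  rw [wordExponent, MvPolynomial.monomial_sum_one]
  rfl

theorem wordExponent_apply (f : Fin (n * l) → Fin n) (p : Fin n × Fin n) :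
    wordExponent f p = (Finset.univ.filter fun x => (f x, x.divNat) = p).card := by
  rw [wordExponent, Finsupp.finsetSum_apply, Finset.card_filter]
  exact Finset.sum_congr rfl fun x _ => Finsupp.single_apply

variable (n l) in
/-- The map from words to polynomials. -/
noncomputable def wordToPoly : WordSpace n (n * l) →ₗ[ℂ] PolyMat n where
  toFun v := ∑ f, v f • wordMonomial f
  map_add' v w := by
    rw [← Finset.sum_add_distrib]
    exact Finset.sum_congr rfl fun f _ => add_smul ..
  map_smul' c v := by
    rw [RingHom.id_apply, Finset.smul_sum]
    exact Finset.sum_congr rfl fun f _ => by rw [PiLp.smul_apply, smul_assoc]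

theorem wordToPoly_apply (v : WordSpace n (n * l)) :
    wordToPoly n l v = ∑ f, v f • wordMonomial f := rfl

theorem wordToPoly_single (f : Fin (n * l) → Fin n) :
    wordToPoly n l (EuclideanSpace.single f 1) = wordMonomial f := by
  rw [wordToPoly_apply, Finset.sum_eq_single f]
  · simp
  · intro g _ hg
    simp [hg]
  · simp

theorem word_eq_sum_single {N : ℕ} (v : WordSpace n N) :
    v = ∑ f, v f • EuclideanSpace.single f (1 : ℂ) := by
  ext g
  rw [WithLp.ofLp_sum, Finset.sum_apply, Finset.sum_eq_single g]
  · simp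
  · intro f _ hf
    simp [Ne.symm hf]
  · simp

/-- Acting on one position at a time in a tensor corresponds to the Leibniz rule on the product of
variables. -/
theorem wordToPoly_E_smul (i j : Fin n) (v : WordSpace n (n * l)) :
    wordToPoly n l ((E i j : U n) • v) = (E i j : U n) • wordToPoly n l v := by
  conv_lhs => rw [word_eq_sum_single v]
  conv_rhs => rw [word_eq_sum_single v]
  rw [Finset.smul_sum, map_sum, map_sum, Finset.smul_sum]
  refine Finset.sum_congr rfl fun f _ => ?_
  rw [smul_comm, LinearMap.map_smul, LinearMap.map_smul, smul_comm]
  congr 1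
  rw [wordToPoly_single, E_smul_single, map_sum, wordMonomial, E_smul_prod, Finset.sum_filter]
  refine Finset.sum_congr rfl fun x _ => ?_
  rw [E_smul_X]
  split_ifs with h
  · rw [wordToPoly_single, wordMonomial, ← Finset.mul_prod_erase _ _ (Finset.mem_univ x),
      Function.update_self]
    congr 1
    refine Finset.prod_congr rfl fun y hy => ?_
    rw [Function.update_of_ne (Finset.ne_of_mem_erase hy)]
  · rw [zero_mul]

theorem wordToPoly_smul (u : U n) (v : WordSpace n (n * l)) :
    wordToPoly n l (u • v) = u • wordToPoly n l v :=
  map_smul_of_map_E_smul _ wordToPoly_E_smul u v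

theorem wordMonomial_comp {k : Equiv.Perm (Fin (n * l))} (hk : k ∈ rowGroup n l)
    (f : Fin (n * l) → Fin n) : wordMonomial (f ∘ k) = wordMonomial f := by
  rw [wordMonomial, wordMonomial, ← Equiv.prod_comp k fun x => MvPolynomial.X (f x, x.divNat)]
  refine Finset.prod_congr rfl fun x _ => ?_
  rw [show (k x).divNat = x.divNat from hk x]
  rfl

theorem wordToPoly_wordAct {k : Equiv.Perm (Fin (n * l))} (hk : k ∈ rowGroup n l)
    (v : WordSpace n (n * l)) : wordToPoly n l (wordAct n k v) = wordToPoly n l v := by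
  rw [wordToPoly_apply, wordToPoly_apply]
  refine Fintype.sum_equiv (k.arrowCongr (Equiv.refl (Fin n))) _ _ fun f => ?_
  change v (f ∘ k.symm) • wordMonomial f = v (f ∘ k.symm) • wordMonomial (f ∘ (k⁻¹ : Equiv.Perm _))
  rw [wordMonomial_comp (inv_mem hk)]

/-- Functions with fibres of equal cardinality differ by a permutation. -/
theorem exists_perm_comp_eq {β γ : Type*} [Fintype β] [DecidableEq γ] (p q : β → γ)
    (h : ∀ y, (Finset.univ.filter fun x => p x = y).card =
      (Finset.univ.filter fun x => q x = y).card) : ∃ σ : Equiv.Perm β, ∀ x, q (σ x) = p x := by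
  have e : ∀ y, {x // p x = y} ≃ {x // q x = y} := fun y =>
    Fintype.equivOfCardEq (by rw [Fintype.card_subtype, Fintype.card_subtype, h])
  refine ⟨(Equiv.sigmaFiberEquiv p).symm.trans
    ((Equiv.sigmaCongrRight e).trans (Equiv.sigmaFiberEquiv q)), fun x => ?_⟩
  exact (e (p x) ⟨x, rfl⟩).2

/-- Equal exponents mean that each pair (letter, rectangular row) occurs equally often in both
words. Matching occurrences of equal pairs gives a permutation that keeps the rows. -/
theorem exists_rowGroup_of_wordExponent_eq {f g : Fin (n * l) → Fin n}
    (h : wordExponent f = wordExponent g) : ∃ k ∈ rowGroup n l, f = g ∘ k := by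
  obtain ⟨k, hk⟩ := exists_perm_comp_eq (fun x => (f x, x.divNat)) (fun x => (g x, x.divNat))
    fun y => by rw [← wordExponent_apply, ← wordExponent_apply, h]
  exact ⟨k, fun x => congrArg Prod.snd (hk x), funext fun x => (congrArg Prod.fst (hk x)).symm⟩

theorem coeff_wordToPoly (v : WordSpace n (n * l)) (m : Fin n × Fin n →₀ ℕ) :
    (wordToPoly n l v).coeff m = ∑ f, if wordExponent f = m then v f else 0 := by
  classical
  rw [wordToPoly_apply, MvPolynomial.coeff_sum]
  refine Finset.sum_congr rfl fun f _ => ?_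
  rw [wordMonomial_eq, MvPolynomial.coeff_smul, MvPolynomial.coeff_monomial, smul_eq_mul, mul_ite,
    mul_one, mul_zero]

/-- An invariant vector is constant on the words with a given monomial, so each coefficient of its
polynomial is the number of these words times the common value. -/
theorem eq_zero_of_wordToPoly_eq_zero {v : WordSpace n (n * l)}
    (hv : ∀ k ∈ rowGroup n l, wordAct n k v = v) (h : wordToPoly n l v = 0) : v = 0 := by
  ext g
  have h1 := coeff_wordToPoly v (wordExponent g)
  rw [h, MvPolynomial.coeff_zero] at h1
  have h2 : ∀ f : Fin (n * l) → Fin n, (if wordExponent f = wordExponent g then v f else 0) =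
      if wordExponent f = wordExponent g then v g else 0 := by
    intro f
    split_ifs with hf
    · obtain ⟨k, hk, rfl⟩ := exists_rowGroup_of_wordExponent_eq hf
      conv_lhs => rw [← hv k hk]
      rw [wordAct_apply, Function.comp_assoc, Equiv.self_comp_symm, Function.comp_id]
    · rfl
  rw [Finset.sum_congr rfl fun f _ => h2 f, ← Finset.sum_filter, Finset.sum_const, nsmul_eq_mul]
    at h1
  exact (mul_eq_zero.1 h1.symm).resolve_left
    (Nat.cast_ne_zero.2 (Finset.card_ne_zero.2 ⟨g, by simp⟩))

end Polynomials

/-! ### The cyclic module as an image of the word space -/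

section

variable {n l : ℕ}

instance : DecidablePred (· ∈ rowGroup n l) := fun g =>
  inferInstanceAs (Decidable (∀ x, (g x).divNat = x.divNat))

variable (n l) in
/-- The sum over the row group. -/
noncomputable def rowSum : WordSpace n (n * l) →ₗ[ℂ] WordSpace n (n * l) :=
  ∑ k : rowGroup n l, (wordAct n k.1).toLinearEquiv.toLinearMap

theorem rowSum_apply (v : WordSpace n (n * l)) :
    rowSum n l v = ∑ k : rowGroup n l, wordAct n k.1 v := by
  rw [rowSum, LinearMap.sum_apply]
  rfl

variable (n l) in
/-- The sum over the column group, weighted with `α ^ ν`. -/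
noncomputable def columnSum (α : ℂ) : WordSpace n (n * l) →ₗ[ℂ] WordSpace n (n * l) :=
  ∑ h : columnGroup n l, α ^ nu h.1 • (wordAct n h.1).toLinearEquiv.toLinearMap

theorem columnSum_apply (α : ℂ) (v : WordSpace n (n * l)) :
    columnSum n l α v = ∑ h : columnGroup n l, α ^ nu h.1 • wordAct n h.1 v := by
  rw [columnSum, LinearMap.sum_apply]
  rfl

theorem rowSum_smul (u : U n) (v : WordSpace n (n * l)) :
    rowSum n l (u • v) = u • rowSum n l v := by
  simp only [rowSum_apply, wordAct_smul, Finset.smul_sum]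

theorem columnSum_smul (α : ℂ) (u : U n) (v : WordSpace n (n * l)) :
    columnSum n l α (u • v) = u • columnSum n l α v := by
  simp only [columnSum_apply, wordAct_smul, Finset.smul_sum]
  exact Finset.sum_congr rfl fun h _ => smul_comm _ _ _

theorem wordAct_rowSum {k : Equiv.Perm (Fin (n * l))} (hk : k ∈ rowGroup n l)
    (v : WordSpace n (n * l)) : wordAct n k (rowSum n l v) = rowSum n l v := by
  rw [rowSum_apply, map_sum]
  exact Fintype.sum_equiv (Equiv.mulRight (⟨k, hk⟩ : rowGroup n l)) _ _ fun k' =>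
    (wordAct_mul k'.1 k v).symm

variable (n l) in
/-- The order of the row group, as a complex number. -/
noncomputable def rowCard : ℂ := (Fintype.card (rowGroup n l) : ℂ)

theorem rowCard_ne_zero : rowCard n l ≠ 0 := Nat.cast_ne_zero.2 Fintype.card_ne_zero

theorem rowSum_of_invariant {v : WordSpace n (n * l)}
    (hv : ∀ k ∈ rowGroup n l, wordAct n k v = v) : rowSum n l v = rowCard n l • v := by
  rw [rowSum_apply, Finset.sum_congr rfl fun k _ => hv k.1 k.2, Finset.sum_const, Finset.card_univ,
    rowCard, Nat.cast_smul_eq_nsmul]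

theorem wordToPoly_rowSum (v : WordSpace n (n * l)) :
    wordToPoly n l (rowSum n l v) = rowCard n l • wordToPoly n l v := by
  rw [rowSum_apply, map_sum, Finset.sum_congr rfl fun k _ => wordToPoly_wordAct k.2 v,
    Finset.sum_const, Finset.card_univ, rowCard, Nat.cast_smul_eq_nsmul]

/-- `wordToPoly` is unchanged by the row group and injective on its invariants, so replacing `v` by
its row sum only scales the polynomial by a nonzero number. -/
theorem wordToPoly_eq_zero_iff (v : WordSpace n (n * l)) :
    wordToPoly n l v = 0 ↔ rowSum n l v = 0 := by
  constructor
  · intro h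
    refine eq_zero_of_wordToPoly_eq_zero (fun k hk => wordAct_rowSum hk v) ?_
    rw [wordToPoly_rowSum, h, smul_zero]
  · intro h
    have := wordToPoly_rowSum v
    rw [h, map_zero] at this
    exact (smul_eq_zero.1 this.symm).resolve_left rowCard_ne_zero

variable (n l) in
/-- The word reading off the rows of the rectangular tableau. -/
def rowWord : Fin (n * l) → Fin n := fun x => x.divNat

theorem rowWord_comp_iff (σ : Equiv.Perm (Fin (n * l))) :
    rowWord n l ∘ σ = rowWord n l ↔ σ ∈ rowGroup n l := funext_iff

theorem wordAct_rowWord {k : Equiv.Perm (Fin (n * l))} (hk : k ∈ rowGroup n l) :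
    wordAct n k (EuclideanSpace.single (rowWord n l) 1) =
      EuclideanSpace.single (rowWord n l) 1 := by
  rw [wordAct_single, (rowWord_comp_iff k).2 hk]

/-- The word `rowWord` generates all row-group invariants. -/
theorem exists_smul_rowWord_eq {w : WordSpace n (n * l)}
    (hw : ∀ k ∈ rowGroup n l, wordAct n k w = w) :
    ∃ u : U n, u • (EuclideanSpace.single (rowWord n l) 1 : WordSpace n (n * l)) = w := by
  classical
  -- This operator commutes with permutations by construction. It sends `rowWord` to `rowCard n l •
  -- w`, because the stabilizer of `rowWord` is the row group, which fixes `w`.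
  obtain ⟨u, hu⟩ := exists_smul_eq (n := n) (N := n * l)
    { toFun := fun v => ∑ σ : Equiv.Perm (Fin (n * l)), v (rowWord n l ∘ σ) • wordAct n σ w
      map_add' := fun v v' => by
        rw [← Finset.sum_add_distrib]
        exact Finset.sum_congr rfl fun σ _ => add_smul ..
      map_smul' := fun c v => by
        rw [RingHom.id_apply, Finset.smul_sum]
        exact Finset.sum_congr rfl fun σ _ => by
          rw [PiLp.smul_apply, smul_eq_mul, mul_smul] } (fun τ v => by
      change ∑ σ : Equiv.Perm (Fin (n * l)), wordAct n τ v (rowWord n l ∘ σ) • wordAct n σ w =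
        wordAct n τ (∑ σ : Equiv.Perm (Fin (n * l)), v (rowWord n l ∘ σ) • wordAct n σ w)
      rw [map_sum]
      refine Fintype.sum_equiv (Equiv.mulRight τ⁻¹) _ _ fun σ => ?_
      rw [map_smul, Equiv.coe_mulRight, ← wordAct_mul, inv_mul_cancel_right]
      rfl)
  refine ⟨(rowCard n l)⁻¹ • u, ?_⟩
  rw [smul_assoc, hu]
  change (rowCard n l)⁻¹ • ∑ σ : Equiv.Perm (Fin (n * l)),
    (EuclideanSpace.single (rowWord n l) (1 : ℂ) : WordSpace n (n * l)) (rowWord n l ∘ σ) •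
      wordAct n σ w = w
  have h1 : ∀ σ : Equiv.Perm (Fin (n * l)),
      (EuclideanSpace.single (rowWord n l) (1 : ℂ) : WordSpace n (n * l)) (rowWord n l ∘ σ) •
        wordAct n σ w = if σ ∈ rowGroup n l then w else 0 := by
    intro σ
    rw [PiLp.single_apply]
    by_cases hσ : σ ∈ rowGroup n l
    · rw [if_pos ((rowWord_comp_iff σ).2 hσ), if_pos hσ, one_smul, hw σ hσ]
    · rw [if_neg (fun h => hσ ((rowWord_comp_iff σ).1 h)), if_neg hσ, zero_smul]
  rw [Finset.sum_congr rfl fun σ _ => h1 σ, ← Finset.sum_filter, Finset.sum_const,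
    ← Nat.cast_smul_eq_nsmul ℂ, smul_smul, ← Fintype.card_subtype]
  have h2 : ((Fintype.card {σ // σ ∈ rowGroup n l} : ℕ) : ℂ) = rowCard n l := by
    rw [rowCard]
  rw [h2, inv_mul_cancel₀ rowCard_ne_zero, one_smul]

/-- Expanding the l-th power chooses one permutation per factor, that is, per column of the
rectangle; these choices form the column group, and their exponents `nu` add up. -/
theorem wordToPoly_columnSum_rowWord (α : ℂ) :
    wordToPoly n l (columnSum n l α (EuclideanSpace.single (rowWord n l) 1)) =
      alphaDet n α ^ l := by
  rw [columnSum_apply, map_sum]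
  have h1 : alphaDet n α ^ l = ∏ _j : Fin l, alphaDet n α := by
    rw [Finset.prod_const, Finset.card_univ, Fintype.card_fin]
  rw [h1]
  simp only [alphaDet]
  rw [Finset.prod_univ_sum, Fintype.piFinset_univ]
  symm
  refine Fintype.sum_bijective columnPerm columnPerm_bijective _ _ fun σ => ?_
  rw [map_smul, wordAct_single, wordToPoly_single, Finset.prod_mul_distrib, nu_columnPerm,
    ← Finset.prod_pow_eq_pow_sum, ← map_prod, ← MvPolynomial.smul_eq_C_mul]
  congr 1
  rw [wordMonomial, ← (gridEquiv n l).prod_comp, Fintype.prod_prod_type]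
  refine Finset.prod_congr rfl fun j _ => Finset.prod_congr rfl fun i _ => ?_
  rw [Function.comp_apply, columnPerm_apply, rowWord, gridEquiv_divNat, gridEquiv_divNat]

variable (n l) in
/-- The composition of the row sum, the weighted column sum and the map to polynomials. -/
noncomputable def detMap (α : ℂ) : WordSpace n (n * l) →ₗ[U n] PolyMat n where
  toFun v := wordToPoly n l (columnSum n l α (rowSum n l v))
  map_add' v w := by rw [map_add, map_add, map_add]
  map_smul' u v := by rw [rowSum_smul, columnSum_smul, wordToPoly_smul, RingHom.id_apply]

theorem detMap_apply (α : ℂ) (v : WordSpace n (n * l)) :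
    detMap n l α v = wordToPoly n l (columnSum n l α (rowSum n l v)) := rfl

/-- A row sum is row-invariant, hence of the form `u • rowWord`; the remaining maps are linear over
the enveloping algebra and take `rowWord` to the generator. -/
theorem range_detMap (α : ℂ) : LinearMap.range (detMap n l α) = cyclicModule n l α := by
  apply le_antisymm
  · rintro _ ⟨v, rfl⟩
    obtain ⟨u, hu⟩ := exists_smul_rowWord_eq (w := rowSum n l v) fun k hk => wordAct_rowSum hk v
    rw [detMap_apply, ← hu, columnSum_smul, wordToPoly_smul, wordToPoly_columnSum_rowWord]
    exact Submodule.smul_mem _ _ (Submodule.mem_span_singleton_self _)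
  · rw [cyclicModule, Submodule.span_le, Set.singleton_subset_iff]
    refine ⟨(rowCard n l)⁻¹ • EuclideanSpace.single (rowWord n l) 1, ?_⟩
    rw [detMap_apply, map_smul, rowSum_of_invariant fun k hk => wordAct_rowWord hk,
      smul_smul, inv_mul_cancel₀ rowCard_ne_zero, one_smul, wordToPoly_columnSum_rowWord]

variable (n l) in
/-- The surjection of the word space onto the cyclic module. -/
noncomputable def toCyclic (α : ℂ) : WordSpace n (n * l) →ₗ[U n] cyclicModule n l α :=
  (detMap n l α).codRestrict _ fun v => by
    rw [← range_detMap]; exact ⟨v, rfl⟩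

theorem toCyclic_surjective (α : ℂ) : Function.Surjective (toCyclic n l α) := by
  rintro ⟨y, hy⟩
  rw [← range_detMap] at hy
  obtain ⟨v, rfl⟩ := hy
  exact ⟨v, rfl⟩

theorem exists_section_toCyclic (α : ℂ) :
    ∃ s : cyclicModule n l α →ₗ[U n] WordSpace n (n * l), ∀ y, toCyclic n l α (s y) = y := by
  obtain ⟨s, hs⟩ := IsSemisimpleModule.lifting_property (toCyclic n l α) (toCyclic_surjective α)
    LinearMap.id
  exact ⟨s, fun y => LinearMap.congr_fun hs y⟩

instance (α : ℂ) : IsSemisimpleModule (U n) (cyclicModule n l α) :=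
  IsSemisimpleModule.of_surjective _ (toCyclic_surjective α)

theorem finiteDimensional_cyclicModule (α : ℂ) : FiniteDimensional ℂ (cyclicModule n l α) :=
  Module.Finite.of_surjective
    ((toCyclic n l α).restrictScalars ℂ : WordSpace n (n * l) →ₗ[ℂ] cyclicModule n l α)
    (toCyclic_surjective α)

theorem exists_mem_hwSpace_cyclicModule (α : ℂ) (S : Submodule (U n) (cyclicModule n l α))
    (hS : S ≠ ⊥) : ∃ lam : BoundedPartition n (n * l), ∃ x ∈ S, x ≠ 0 ∧
      x ∈ hwSpace (cyclicModule n l α) lam.weight := by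
  obtain ⟨s, hs⟩ := exists_section_toCyclic (n := n) (l := l) α
  have hinj : Function.Injective s := Function.LeftInverse.injective hs
  obtain ⟨μ, v, hv, hv0, hvμ⟩ := exists_mem_hwSpace_word (S.map s) fun h => hS <| (Submodule.eq_bot_iff _).2
    fun x hx => hinj (by
      rw [map_zero, ← Submodule.mem_bot (U n), ← h]; exact Submodule.mem_map_of_mem hx)
  obtain ⟨x, hx, rfl⟩ := hv
  obtain ⟨lam, hlam⟩ := BoundedPartition.exists_weight_eq μ (weight_antitone hvμ hv0)
    (sum_weight hvμ hv0)
  refine ⟨lam, x, hx, fun h => hv0 (by rw [h, map_zero]), ?_⟩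
  rw [hlam, ← hs x]
  exact map_mem_hwSpace _ hvμ

/-- A linear section over the enveloping algebra lifts highest weight vectors to highest weight
vectors, so none are gained or lost when passing to the image. -/
theorem finrank_hwSpace_cyclicModule (α : ℂ) (μ : Fin n → ℕ) :
    Module.finrank ℂ (hwSpace (cyclicModule n l α) μ) =
      Module.finrank ℂ ((hwSpace (WordSpace n (n * l)) μ).map
        ((detMap n l α).restrictScalars ℂ)) := by
  obtain ⟨s, hs⟩ := exists_section_toCyclic (n := n) (l := l) α
  refine LinearEquiv.finrank_eq (LinearEquiv.ofBijective
    { toFun := fun x => ⟨x.1.1, s x.1, map_mem_hwSpace s x.2, congrArg Subtype.val (hs x.1)⟩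
      map_add' := fun x y => rfl
      map_smul' := fun c x => rfl } ⟨?_, ?_⟩)
  · intro x y h
    have h' := congrArg Subtype.val h
    exact Subtype.ext (Subtype.ext h')
  · rintro ⟨_, v, hv, rfl⟩
    exact ⟨⟨toCyclic n l α v, map_mem_hwSpace _ hv⟩, rfl⟩

/-! ### The rank of the transition matrix -/

section Rank

variable {μ : YoungDiagram}

theorem spechtAct_coe (g : Equiv.Perm (Fin (n * l))) (y : specht μ (n * l)) :
    (spechtAct μ (n * l) g y : TabloidSpace μ (n * l)) = rightAct μ (n * l) g y := rfl

theorem spechtAct_mul (g h : Equiv.Perm (Fin (n * l))) (y : specht μ (n * l)) :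
    spechtAct μ (n * l) (g * h) y = spechtAct μ (n * l) h (spechtAct μ (n * l) g y) := rfl

theorem inner_spechtAct (g : Equiv.Perm (Fin (n * l))) (y z : specht μ (n * l)) :
    inner ℂ (spechtAct μ (n * l) g y) (spechtAct μ (n * l) g z) = inner ℂ y z :=
  (rightAct μ (n * l) g).inner_map_map _ _

theorem specht_inner_sum {κ : Type*} (s : Finset κ) (f : κ → specht μ (n * l))
    (z : specht μ (n * l)) : inner ℂ z (∑ i ∈ s, f i) = ∑ i ∈ s, inner ℂ z (f i) :=
  inner_sum (𝕜 := ℂ) s f z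

theorem specht_sum_inner {κ : Type*} (s : Finset κ) (f : κ → specht μ (n * l))
    (z : specht μ (n * l)) : inner ℂ (∑ i ∈ s, f i) z = ∑ i ∈ s, inner ℂ (f i) z :=
  sum_inner (𝕜 := ℂ) s f z

theorem specht_inner_smul_right (y z : specht μ (n * l)) (c : ℂ) :
    inner ℂ y (c • z) = c * inner ℂ y z :=
  inner_smul_right y z c

theorem specht_inner_smul_left (y z : specht μ (n * l)) (c : ℂ) :
    inner ℂ (c • y) z = starRingEnd ℂ c * inner ℂ y z :=
  inner_smul_left y z c

theorem specht_inner_zero_right (z : specht μ (n * l)) : inner ℂ z 0 = 0 :=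
  inner_zero_right (𝕜 := ℂ) z

theorem mem_rowInvariants {y : specht μ (n * l)} :
    y ∈ rowInvariants μ n l ↔ ∀ k ∈ rowGroup n l, spechtAct μ (n * l) k y = y := by
  simp only [rowInvariants, Submodule.mem_iInf, LinearMap.mem_ker, LinearMap.sub_apply,
    LinearMap.id_apply, sub_eq_zero]

variable (n l μ) in
/-- The sum over the row group on the Specht module. -/
noncomputable def spechtRowSum : specht μ (n * l) →ₗ[ℂ] specht μ (n * l) :=
  ∑ k : rowGroup n l, spechtAct μ (n * l) k.1

theorem spechtRowSum_apply (y : specht μ (n * l)) :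
    spechtRowSum n l μ y = ∑ k : rowGroup n l, spechtAct μ (n * l) k.1 y := by
  rw [spechtRowSum, LinearMap.sum_apply]

theorem spechtRowSum_mem (y : specht μ (n * l)) : spechtRowSum n l μ y ∈ rowInvariants μ n l := by
  rw [mem_rowInvariants]
  intro k hk
  rw [spechtRowSum_apply, map_sum]
  exact Fintype.sum_equiv (Equiv.mulRight (⟨k, hk⟩ : rowGroup n l)) _ _ fun k' =>
    (spechtAct_mul k'.1 k y).symm

theorem inner_spechtRowSum {z : specht μ (n * l)} (hz : z ∈ rowInvariants μ n l)
    (y : specht μ (n * l)) :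
    inner ℂ z (spechtRowSum n l μ y) = rowCard n l * inner ℂ z y := by
  rw [spechtRowSum_apply, specht_inner_sum, Finset.sum_congr rfl (g := fun _ => inner ℂ z y),
    Finset.sum_const, Finset.card_univ, nsmul_eq_mul, rowCard]
  intro k _
  conv_lhs => rw [← mem_rowInvariants.1 hz k.1 k.2]
  exact inner_spechtAct ..

/-- The row sum is a nonzero multiple of the orthogonal projection onto the row invariants. -/
theorem spechtRowSum_eq_zero_iff (y : specht μ (n * l)) :
    spechtRowSum n l μ y = 0 ↔ ∀ z ∈ rowInvariants μ n l, inner ℂ z y = 0 := by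
  constructor
  · intro h z hz
    have := inner_spechtRowSum hz y
    rw [h, specht_inner_zero_right] at this
    exact (mul_eq_zero.1 this.symm).resolve_left rowCard_ne_zero
  · intro h
    rw [← inner_self_eq_zero (𝕜 := ℂ), inner_spechtRowSum (spechtRowSum_mem y),
      h _ (spechtRowSum_mem y), mul_zero]

variable (n l μ) in
/-- The sum over the column group on the Specht module, weighted with `α ^ ν`. -/
noncomputable def spechtColumnSum (α : ℂ) : specht μ (n * l) →ₗ[ℂ] specht μ (n * l) :=
  ∑ h : columnGroup n l, α ^ nu h.1 • spechtAct μ (n * l) h.1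

theorem spechtColumnSum_apply (α : ℂ) (y : specht μ (n * l)) :
    spechtColumnSum n l μ α y =
      ∑ h : columnGroup n l, α ^ nu h.1 • spechtAct μ (n * l) h.1 y := by
  rw [spechtColumnSum, LinearMap.sum_apply]
  rfl

theorem tabloidEmbedding_spechtRowSum (hc : μ.colLen 0 ≤ n) (y : specht μ (n * l)) :
    tabloidEmbedding hc (spechtRowSum n l μ y : TabloidSpace μ (n * l)) =
      rowSum n l (tabloidEmbedding hc y.1) := by
  rw [spechtRowSum_apply, Submodule.coe_sum, map_sum, rowSum_apply]
  exact Finset.sum_congr rfl fun k _ => tabloidEmbedding_rightAct hc k.1 y.1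

theorem tabloidEmbedding_spechtColumnSum (hc : μ.colLen 0 ≤ n) (α : ℂ) (y : specht μ (n * l)) :
    tabloidEmbedding hc (spechtColumnSum n l μ α y : TabloidSpace μ (n * l)) =
      columnSum n l α (tabloidEmbedding hc y.1) := by
  rw [spechtColumnSum_apply, Submodule.coe_sum, map_sum, columnSum_apply]
  refine Finset.sum_congr rfl fun h _ => ?_
  rw [Submodule.coe_smul, map_smul]
  congr 1
  exact tabloidEmbedding_rightAct hc h.1 y.1

theorem wordToPoly_tabloidEmbedding_eq_zero_iff (hc : μ.colLen 0 ≤ n) (y : specht μ (n * l)) :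
    wordToPoly n l (tabloidEmbedding hc y.1) = 0 ↔
      ∀ z ∈ rowInvariants μ n l, inner ℂ z y = 0 := by
  rw [← spechtRowSum_eq_zero_iff, wordToPoly_eq_zero_iff, ← tabloidEmbedding_spechtRowSum,
    map_eq_zero_iff _ (tabloidEmbedding_injective hc), Submodule.coe_eq_zero]

/-- The row sum maps the Specht module onto the row invariants, and `wordToPoly` kills exactly the
orthogonal complement of the invariants. Between the two stands the column sum, so only its
compression to the invariants matters. -/
theorem finrank_map_detMap (hc : μ.colLen 0 ≤ n) (B : AdaptedBasis μ n l) (α : ℂ) :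
    Module.finrank ℂ (((specht μ (n * l)).map (tabloidEmbedding hc)).map
      ((detMap n l α).restrictScalars ℂ)) = (B.transitionMatrix α).rank := by
  let b : Fin B.d → specht μ (n * l) := fun i => B.basis (Fin.castLE B.d_le i)
  have hb : ∀ z, z ∈ rowInvariants μ n l ↔ ∃ c : Fin B.d → ℂ, ∑ i, c i • b i = z := by
    intro z
    rw [← B.span_eq, Submodule.mem_span_range_iff_exists_fun]
  -- The part of `detMap` after the row sum, in coordinates of the invariants. It has the range of
  -- `detMap` on the Specht module and the kernel of the transposed transition matrix, so
  -- rank-nullity gives the dimension.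
  let θ : (Fin B.d → ℂ) →ₗ[ℂ] PolyMat n :=
    wordToPoly n l ∘ₗ tabloidEmbedding hc ∘ₗ (specht μ (n * l)).subtype ∘ₗ
      spechtColumnSum n l μ α ∘ₗ Fintype.linearCombination ℂ b
  have hθ : ∀ c, θ c = wordToPoly n l (columnSum n l α
      (tabloidEmbedding hc (∑ i, c i • b i : specht μ (n * l)).1)) := by
    intro c
    rw [← tabloidEmbedding_spechtColumnSum]
    rfl
  have hrange : ((specht μ (n * l)).map (tabloidEmbedding hc)).map
      ((detMap n l α).restrictScalars ℂ) = LinearMap.range θ := by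
    ext p
    constructor
    · rintro ⟨_, ⟨y, hy, rfl⟩, rfl⟩
      obtain ⟨c, hc'⟩ := (hb _).1 (spechtRowSum_mem (n := n) (l := l) ⟨y, hy⟩)
      refine ⟨c, ?_⟩
      rw [hθ, hc', tabloidEmbedding_spechtRowSum]
      rfl
    · rintro ⟨c, rfl⟩
      set z := ∑ i, c i • b i with hz
      have hzi : z ∈ rowInvariants μ n l := (hb z).2 ⟨c, rfl⟩
      refine ⟨_, ⟨(rowCard n l)⁻¹ • z.1, Submodule.smul_mem _ _ z.2, rfl⟩, ?_⟩
      rw [hθ, ← hz]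
      change wordToPoly n l (columnSum n l α (rowSum n l _)) = _
      congr 2
      rw [map_smul, map_smul, rowSum_of_invariant, smul_smul, inv_mul_cancel₀ rowCard_ne_zero,
        one_smul]
      intro k hk
      rw [← tabloidEmbedding_rightAct, ← spechtAct_coe, mem_rowInvariants.1 hzi k hk]
  have hker : LinearMap.ker θ = LinearMap.ker (B.transitionMatrix α).transpose.mulVecLin := by
    ext c
    rw [LinearMap.mem_ker, LinearMap.mem_ker, Matrix.mulVecLin_apply]
    change wordToPoly n l (tabloidEmbedding hc
      (spechtColumnSum n l μ α (∑ i, c i • b i) : specht μ (n * l)).1) = 0 ↔ _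
    rw [wordToPoly_tabloidEmbedding_eq_zero_iff]
    -- The transpose appears because the first index of `psi` is that of the vector acted upon and
    -- the second that of the coordinate read off.
    have hentry : ∀ j, inner ℂ (b j) (spechtColumnSum n l μ α (∑ i, c i • b i)) =
        (B.transitionMatrix α).transpose.mulVec c j := by
      intro j
      rw [map_sum, specht_inner_sum, Matrix.mulVec, dotProduct]
      refine Finset.sum_congr rfl fun i _ => ?_
      rw [map_smul, specht_inner_smul_right, mul_comm]
      congr 1
      rw [spechtColumnSum_apply, specht_inner_sum]
      refine Finset.sum_congr rfl fun h _ => ?_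
      rw [specht_inner_smul_right]
      rfl
    constructor
    · intro h
      funext j
      rw [← hentry]
      exact h _ ((hb _).2 ⟨Pi.single j 1, by simp [Pi.single_apply]⟩)
    · intro h z hz
      obtain ⟨a, rfl⟩ := (hb z).1 hz
      rw [specht_sum_inner]
      refine Finset.sum_eq_zero fun j _ => ?_
      rw [specht_inner_smul_left, hentry, h, Pi.zero_apply, mul_zero]
  rw [hrange]
  have h1 := θ.finrank_range_add_finrank_ker
  have h2 := (B.transitionMatrix α).transpose.mulVecLin.finrank_range_add_finrank_ker
  rw [hker] at h1
  rw [← Matrix.rank_transpose, Matrix.rank]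
  omega

theorem finrank_hwSpace_cyclicModule_eq_rank (lam : BoundedPartition n (n * l))
    (B : AdaptedBasis lam.1 n l) (α : ℂ) :
    Module.finrank ℂ (hwSpace (cyclicModule n l α) lam.weight) = (B.transitionMatrix α).rank := by
  rw [finrank_hwSpace_cyclicModule, ← map_specht, finrank_map_detMap]

end Rank

theorem simpleMultiplicity_cyclicModule (lam : BoundedPartition n (n * l))
    (B : AdaptedBasis lam.1 n l) (α : ℂ) (M : Type*) [AddCommGroup M] [Module (U n) M]
    [IsSimpleModule (U n) M] (hM : HasHighestWeight (n := n) M lam.1) :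
    simpleMultiplicity (U n) (cyclicModule n l α) M = (B.transitionMatrix α).rank := by
  -- `M` carries only its module structure over the enveloping algebra; complex scalars act through
  -- the algebra map.
  let : Module ℂ M := Module.compHom M (algebraMap ℂ (U n))
  have : IsScalarTower ℂ (U n) M := IsScalarTower.of_algebraMap_smul fun _ _ => rfl
  have := finiteDimensional_cyclicModule (n := n) (l := l) α
  obtain ⟨v, hv0, hv⟩ := hasHighestWeight_iff.1 hM
  rw [← finrank_hwSpace_cyclicModule_eq_rank lam B α]
  exact simpleMultiplicity_eq_finrank hv hv0

theorem nonempty_cyclicModule_equiv (B : ∀ lam : BoundedPartition n (n * l), AdaptedBasis lam.1 n l)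
    (α : ℂ) (M : BoundedPartition n (n * l) → Type*) [∀ lam, AddCommGroup (M lam)]
    [∀ lam, Module (U n) (M lam)] [∀ lam, IsSimpleModule (U n) (M lam)]
    (hM : ∀ lam, HasHighestWeight (n := n) (M lam) lam.1) :
    Nonempty (cyclicModule n l α ≃ₗ[U n]
      ⨁ lam, (Fin ((B lam).transitionMatrix α).rank → M lam)) := by
  let : ∀ lam, Module ℂ (M lam) := fun lam => Module.compHom (M lam) (algebraMap ℂ (U n))
  have : ∀ lam, IsScalarTower ℂ (U n) (M lam) := fun lam =>
    IsScalarTower.of_algebraMap_smul fun _ _ => rfl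
  have := finiteDimensional_cyclicModule (n := n) (l := l) α
  choose v hv0 hv using fun lam => hasHighestWeight_iff.1 (hM lam)
  exact nonempty_equiv_directSum (X := cyclicModule n l α)
    BoundedPartition.weight_injective hv hv0 (fun S hS =>
      exists_mem_hwSpace_cyclicModule α S fun hbot => by
        have := IsSimpleModule.nontrivial (U n) S
        exact (Submodule.nontrivial_iff_ne_bot.1 this) hbot)
    fun lam => finrank_hwSpace_cyclicModule_eq_rank lam (B lam) α

end

/-! ### Row-group invariants of Specht modules and semistandard tableaux -/

section Kostka

variable {n l : ℕ} {μ : YoungDiagram}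

/-- The tableau `t` represents the semistandard tableau `T`: replacing each entry of `t` by the
number of its row in the rectangular tableau gives `T`. -/
def Tableau.Represents (t : Tableau μ (n * l)) (T : SemistandardYoungTableau μ) : Prop :=
  ∀ x, T (t x).1.1 (t x).1.2 = (x.divNat : ℕ)

theorem card_filter_divNat (i : ℕ) :
    (Finset.univ.filter fun x : Fin (n * l) => (x.divNat : ℕ) = i).card =
      if i < n then l else 0 := by
  split_ifs with h
  · have h1 : (Finset.univ.filter fun x : Fin (n * l) => (x.divNat : ℕ) = i) =
        (Finset.univ : Finset (Fin l)).map
          ⟨fun j => gridEquiv n l (j, ⟨i, h⟩), fun a b hab => by simpa using hab⟩ := by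
      ext x
      obtain ⟨⟨j, k⟩, rfl⟩ := (gridEquiv n l).surjective x
      rw [Finset.mem_filter, gridEquiv_divNat, Finset.mem_map]
      constructor
      · rintro ⟨-, rfl⟩
        exact ⟨j, Finset.mem_univ _, rfl⟩
      · rintro ⟨j', -, h'⟩
        have := (gridEquiv n l).injective h'
        rw [Prod.ext_iff] at this
        exact ⟨Finset.mem_univ _, (congrArg Fin.val this.2).symm⟩
    rw [h1, Finset.card_map, Finset.card_univ, Fintype.card_fin]
  · rw [Finset.card_eq_zero, Finset.filter_eq_empty_iff]
    rintro x - rfl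
    exact h x.divNat.2

theorem Tableau.card_filter_cell (t : Tableau μ (n * l)) (p : ℕ × ℕ → Prop) [DecidablePred p] :
    (Finset.univ.filter fun x => p (t x).1).card = (μ.cells.filter p).card := by
  refine Finset.card_bij (fun x _ => (t x).1) ?_ ?_ ?_
  · intro x hx
    simpa using hx
  · intro x _ y _ h
    exact t.injective (Subtype.ext h)
  · intro c hc
    rw [Finset.mem_filter] at hc
    exact ⟨t.symm ⟨c, hc.1⟩, by simpa using hc.2, by simp⟩

theorem Tableau.Represents.content {t : Tableau μ (n * l)} {T : SemistandardYoungTableau μ}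
    (h : t.Represents T) (i : ℕ) :
    (μ.cells.filter fun c => T c.1 c.2 = i).card = if i < n then l else 0 := by
  rw [← t.card_filter_cell fun c => T c.1 c.2 = i, ← card_filter_divNat (l := l)]
  simp only [h _]

theorem exists_represents (hμ : μ.card = n * l) {T : SemistandardYoungTableau μ}
    (hT : ∀ i : ℕ, (μ.cells.filter fun c => T c.1 c.2 = i).card = if i < n then l else 0) :
    ∃ t : Tableau μ (n * l), t.Represents T := by
  obtain ⟨t⟩ := Tableau.nonempty hμ
  obtain ⟨σ, hσ⟩ := exists_perm_comp_eq (fun x : Fin (n * l) => (x.divNat : ℕ))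
    (fun x => T (t x).1.1 (t x).1.2) fun i => by
      rw [card_filter_divNat, t.card_filter_cell fun c => T c.1 c.2 = i, hT]
  exact ⟨σ.trans t, hσ⟩

theorem exists_rowGroup_of_represents {t t' : Tableau μ (n * l)} {T : SemistandardYoungTableau μ}
    (h : t.Represents T) (h' : t'.Represents T) : ∃ k ∈ rowGroup n l, t = k.trans t' := by
  refine ⟨t.trans t'.symm, fun x => Fin.ext ?_, ?_⟩
  · rw [← h x, ← h' ((t.trans t'.symm) x)]
    simp
  · ext x : 1
    simp

/-- A row of a semistandard tableau is determined by the multiplicities of its entries. -/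
theorem lt_card_filter_le_iff (T : SemistandardYoungTableau μ) {i j : ℕ} (h : (i, j) ∈ μ)
    (s : ℕ) : j < (μ.cells.filter fun c => c.1 = i ∧ T c.1 c.2 ≤ s).card ↔ T i j ≤ s := by
  -- The entries at most `s` fill an initial segment of row `i`, so both implications compare this
  -- segment with an interval of columns.
  have hinj : Function.Injective fun j' : ℕ => (i, j') := fun a b hab => by simpa using hab
  constructor
  · intro hj
    by_contra! hs
    refine absurd hj (not_lt.2 ?_)
    rw [← Finset.card_range j, ← Finset.card_map ⟨_, hinj⟩]
    refine Finset.card_le_card ?_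
    rintro ⟨i', j'⟩ hc
    simp only [Finset.mem_filter, YoungDiagram.mem_cells] at hc
    obtain ⟨hc, rfl, hle⟩ := hc
    simp only [Finset.mem_map, Finset.mem_range, Function.Embedding.coeFn_mk]
    refine ⟨j', ?_, rfl⟩
    by_contra! hjj
    exact absurd (T.row_weak_of_le hjj hc) (by omega)
  · intro hs
    rw [← Nat.succ_le_iff, ← Finset.card_range j.succ, ← Finset.card_map ⟨_, hinj⟩]
    refine Finset.card_le_card ?_
    intro c hc
    simp only [Finset.mem_map, Finset.mem_range, Function.Embedding.coeFn_mk] at hc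
    obtain ⟨j', hj', rfl⟩ := hc
    simp only [Finset.mem_filter, YoungDiagram.mem_cells, true_and]
    exact ⟨μ.up_left_mem le_rfl (by omega) h, (T.row_weak_of_le (by omega) h).trans hs⟩

/-- If the tabloids agree up to the row group, then each row of `T` and of `T'` has the same entries
with multiplicity, and weakly increasing rows are determined by these. -/
theorem eq_of_represents {t t' : Tableau μ (n * l)} {T T' : SemistandardYoungTableau μ}
    (h : t.Represents T) (h' : t'.Represents T') {k : Equiv.Perm (Fin (n * l))}
    (hk : k ∈ rowGroup n l)
    (ht : ∀ x, (t x).1.1 = (t' (k x)).1.1) : T = T' := by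
  have hcard : ∀ i s, (μ.cells.filter fun c => c.1 = i ∧ T c.1 c.2 ≤ s).card =
      (μ.cells.filter fun c => c.1 = i ∧ T' c.1 c.2 ≤ s).card := by
    intro i s
    rw [← t.card_filter_cell fun c => c.1 = i ∧ T c.1 c.2 ≤ s,
      ← t'.card_filter_cell fun c => c.1 = i ∧ T' c.1 c.2 ≤ s]
    refine Finset.card_equiv k fun x => ?_
    have h'' : T' (t x).1.1 (t' (k x)).1.2 = (x.divNat : ℕ) := by rw [ht x, h', hk x]
    simp only [Finset.mem_filter, Finset.mem_univ, true_and, h x, ← ht x, h'']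
  ext i j
  by_cases hc : (i, j) ∈ μ
  · refine le_antisymm ?_ ?_
    · rw [← lt_card_filter_le_iff T hc, hcard, lt_card_filter_le_iff T' hc]
    · rw [← lt_card_filter_le_iff T' hc, ← hcard, lt_card_filter_le_iff T hc]
  · rw [T.zeros hc, T'.zeros hc]

/-- The sum of (row of `x` in the tabloid) times (row of `x` in the rectangular tableau). -/
def rowPairing (r : Tabloid μ (n * l)) : ℕ := ∑ x, (r.1 x : ℕ) * (x.divNat : ℕ)

theorem rowPairing_actEquiv {k : Equiv.Perm (Fin (n * l))} (hk : k ∈ rowGroup n l)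
    (r : Tabloid μ (n * l)) : rowPairing (Tabloid.actEquiv μ _ k r) = rowPairing r := by
  rw [rowPairing, rowPairing, ← Equiv.sum_comp k fun x => (r.1 x : ℕ) * (x.divNat : ℕ)]
  exact Finset.sum_congr rfl fun x _ => by rw [Tabloid.actEquiv_apply, hk x]

/-- The equality case of the rearrangement inequality. If `x` is moved and all points of smaller
`g`-value are fixed, then `σ x` and `σ⁻¹ x` both have larger `g`-value, which contradicts
monovariance at `x` and `σ⁻¹ x`. -/
theorem eq_one_of_monovary {β : Type*} {f g : β → ℕ} (hg : Function.Injective g)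
    (hfg : ∀ x y, g x < g y → f x < f y) {σ : Equiv.Perm β} (h : Monovary (f ∘ σ) g) : σ = 1 := by
  have key : ∀ m x, g x = m → σ x = x := by
    intro m
    induction m using Nat.strong_induction_on with
    | _ m ih =>
      rintro x rfl
      by_contra hne
      have h1 : g x < g (σ x) := by
        refine lt_of_le_of_ne (not_lt.1 fun hlt => ?_) fun he => hne (hg he).symm
        exact hne (σ.injective (ih _ hlt _ rfl))
      obtain ⟨y, rfl⟩ : ∃ y, x = σ y := ⟨σ.symm x, by simp⟩
      have h2 : g (σ y) < g y := by
        refine lt_of_le_of_ne (not_lt.1 fun hlt => ?_) fun he => hne (congrArg σ (hg he))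
        exact hne (by rw [ih _ hlt y rfl, ih _ hlt y rfl])
      exact absurd (h h2) (not_le.2 (hfg _ _ h1))
  exact Equiv.ext fun x => key _ x rfl

/-- Down a column of `t` the row and the rectangular row increase together strictly, so the
rearrangement inequality makes every nontrivial column permutation lower the pairing. -/
theorem rowPairing_lt {t : Tableau μ (n * l)} {T : SemistandardYoungTableau μ}
    (h : t.Represents T) {σ : Equiv.Perm (Fin (n * l))} (hσ : σ ∈ t.columnStabilizer)
    (hne : σ ≠ 1) : rowPairing (Tabloid.actEquiv μ _ σ t.tabloid) < rowPairing t.tabloid := by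
  rw [Tableau.mem_columnStabilizer] at hσ
  -- The factors `μ.colLen 0` here and `n` in `g` exceed every row and rectangular row, so both
  -- functions compare columns first. This treats all columns in one rearrangement.
  let f : Fin (n * l) → ℕ := fun x => (t x).1.1 + μ.colLen 0 * (t x).1.2
  let g : Fin (n * l) → ℕ := fun x => (x.divNat : ℕ) + n * (t x).1.2
  have hrow : ∀ x, (t x).1.1 < μ.colLen 0 := fun x => (t.tabloid.1 x).2
  have hlex : ∀ {a b c d m : ℕ}, a < m → c < m → (a + m * b < c + m * d ↔ b < d ∨ b = d ∧ a < c) := by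
    intro a b c d m ha hc
    rcases lt_trichotomy b d with hbd | rfl | hbd
    · simp only [hbd, true_or, iff_true]
      nlinarith [Nat.mul_le_mul_left m (Nat.succ_le_of_lt hbd)]
    · simp
    · simp only [hbd.not_gt, hbd.ne', false_and, or_self, iff_false, not_lt]
      nlinarith [Nat.mul_le_mul_left m (Nat.succ_le_of_lt hbd)]
  have hfg : ∀ x y, g x < g y → f x < f y := by
    intro x y hxy
    rw [hlex x.divNat.2 y.divNat.2] at hxy
    refine (hlex (hrow x) (hrow y)).2 (hxy.imp_right fun hxy => ⟨hxy.1, ?_⟩)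
    obtain ⟨hcol, hdiv⟩ := hxy
    rw [← h x, ← h y, ← hcol] at hdiv
    by_contra! hle
    exact absurd hdiv (not_lt.2 (T.col_weak hle (t x).2))
  have hg : Function.Injective g := by
    intro x y hxy
    have h1 := (hlex x.divNat.2 y.divNat.2).not.1 hxy.not_lt
    have h2 := (hlex y.divNat.2 x.divNat.2).not.1 hxy.not_gt
    have hcol : (t x).1.2 = (t y).1.2 := by omega
    have hdiv : T (t x).1.1 (t x).1.2 = T (t y).1.1 (t y).1.2 := by rw [h x, h y]; omega
    refine t.injective (Subtype.ext (Prod.ext ?_ hcol))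
    rcases lt_trichotomy (t x).1.1 (t y).1.1 with hlt | heq | hlt
    · exact absurd (T.col_strict hlt (t y).2) (by rw [← hdiv, hcol]; exact lt_irrefl _)
    · exact heq
    · have := T.col_strict hlt (t x).2
      rw [hdiv, hcol] at this
      exact absurd this (lt_irrefl _)
  have hmono : Monovary f g := fun x y hxy => (hfg x y hxy).le
  have hlt := hmono.sum_comp_perm_mul_lt_sum_mul_iff.2 fun hm => hne (eq_one_of_monovary hg hfg hm)
  -- The terms added by the lexicographic encoding do not depend on the column permutation, so they
  -- cancel in the comparison.
  have hexp : ∀ τ : Equiv.Perm (Fin (n * l)), (∀ x, (t (τ x)).1.2 = (t x).1.2) →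
      ∑ x, f (τ x) * g x = ∑ x, (t (τ x)).1.1 * (x.divNat : ℕ) +
        (∑ x, (t x).1.1 * (n * (t x).1.2) + ∑ x, μ.colLen 0 * (t x).1.2 * g x) := by
    intro τ hτ
    rw [← Equiv.sum_comp τ fun x => (t x).1.1 * (n * (t x).1.2), ← Finset.sum_add_distrib,
      ← Finset.sum_add_distrib]
    refine Finset.sum_congr rfl fun x _ => ?_
    simp only [f, g, hτ]
    ring
  have h1 := hexp 1 fun x => rfl
  rw [hexp σ hσ] at hlt
  simp only [Equiv.Perm.one_apply] at h1
  rw [h1] at hlt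
  exact lt_of_add_lt_add_right hlt

theorem polytabloid_mem_specht {N : ℕ} (t : Tableau μ N) : t.polytabloid ∈ specht μ N :=
  Submodule.subset_span ⟨t, rfl⟩

/-- The sum of the images of a polytabloid under the row group. -/
noncomputable def Tableau.invariantVector (t : Tableau μ (n * l)) : specht μ (n * l) :=
  spechtRowSum n l μ ⟨t.polytabloid, polytabloid_mem_specht t⟩

theorem Tableau.invariantVector_apply (t : Tableau μ (n * l)) (r : Tabloid μ (n * l)) :
    (t.invariantVector : TabloidSpace μ (n * l)) r = ∑ k : rowGroup n l,
      ∑ σ ∈ t.columnStabilizer, if r = Tabloid.actEquiv μ _ (σ * k.1) t.tabloid then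
        ((Equiv.Perm.sign σ : ℤ) : ℂ) else 0 := by
  rw [Tableau.invariantVector, spechtRowSum_apply, Submodule.coe_sum, WithLp.ofLp_sum,
    Finset.sum_apply]
  refine Finset.sum_congr rfl fun k _ => ?_
  rw [spechtAct_coe]
  simp only [Tableau.polytabloid, map_sum, map_smul, rightAct_single, WithLp.ofLp_sum,
    Finset.sum_apply, PiLp.smul_apply, PiLp.single_apply, smul_eq_mul, mul_ite, mul_one, mul_zero]
  rfl

theorem exists_of_invariantVector_apply_ne_zero {t : Tableau μ (n * l)} {r : Tabloid μ (n * l)}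
    (h : (t.invariantVector : TabloidSpace μ (n * l)) r ≠ 0) :
    ∃ k ∈ rowGroup n l, ∃ σ ∈ t.columnStabilizer,
      r = Tabloid.actEquiv μ _ k (Tabloid.actEquiv μ _ σ t.tabloid) := by
  rw [Tableau.invariantVector_apply] at h
  obtain ⟨k, _, hk⟩ := Finset.exists_ne_zero_of_sum_ne_zero h
  obtain ⟨σ, hσ, h1⟩ := Finset.exists_ne_zero_of_sum_ne_zero hk
  refine ⟨k.1, k.2, σ, hσ, ?_⟩
  by_contra h2
  exact h1 (if_neg h2)

/-- A nontrivial column permutation lowers `rowPairing`, which the row group cannot restore. Only `σ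
= 1` contributes, and the coefficient counts the row-group elements fixing the tabloid, among them
the identity. -/
theorem invariantVector_tabloid_ne_zero {t : Tableau μ (n * l)} {T : SemistandardYoungTableau μ}
    (h : t.Represents T) : (t.invariantVector : TabloidSpace μ (n * l)) t.tabloid ≠ 0 := by
  rw [Tableau.invariantVector_apply]
  have h1 : ∀ k : rowGroup n l, (∑ σ ∈ t.columnStabilizer,
      if t.tabloid = Tabloid.actEquiv μ _ (σ * k.1) t.tabloid then
        ((Equiv.Perm.sign σ : ℤ) : ℂ) else 0) =
      ((if t.tabloid = Tabloid.actEquiv μ _ k.1 t.tabloid then 1 else 0 : ℕ) : ℂ) := by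
    intro k
    rw [Finset.sum_eq_single 1]
    · simp
    · intro σ hσ hne
      rw [if_neg]
      intro he
      have h2 := rowPairing_lt h hσ hne
      have h3 : rowPairing t.tabloid = rowPairing (Tabloid.actEquiv μ _ σ t.tabloid) := by
        conv_lhs => rw [he]
        exact rowPairing_actEquiv k.2 (Tabloid.actEquiv μ _ σ t.tabloid)
      omega
    · intro h
      exact absurd (Tableau.mem_columnStabilizer.2 fun x => rfl) h
  rw [Finset.sum_congr rfl fun k _ => h1 k, ← Nat.cast_sum, Nat.cast_ne_zero]
  refine (Finset.sum_pos' (fun _ _ => Nat.zero_le _) ⟨1, Finset.mem_univ _, ?_⟩).ne'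
  rw [if_pos]
  · exact Nat.one_pos
  · rfl

/-- Semistandard tableaux with the content `(l ^ n)`. -/
abbrev RectTableau (μ : YoungDiagram) (n l : ℕ) : Type :=
  {T : SemistandardYoungTableau μ //
    ∀ i : ℕ, (μ.cells.filter fun c => T c.1 c.2 = i).card = if i < n then l else 0}

/-- Triangularity for `rowPairing`: in a relation take a tableau of largest pairing with nonzero
coefficient. Its tabloid can occur in another vector of the relation only through `σ = 1`, hence in
the same row-group orbit, which forces the tableaux to coincide. -/
theorem linearIndependent_invariantVector {t : RectTableau μ n l → Tableau μ (n * l)}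
    (ht : ∀ T, (t T).Represents T.1) :
    LinearIndependent ℂ fun T => (t T).invariantVector := by
  rw [linearIndependent_iff']
  intro s c hc
  by_contra! hne
  obtain ⟨T, hT, hmax⟩ := Finset.exists_max_image (s.filter fun T => c T ≠ 0)
    (fun T => rowPairing (t T).tabloid) (by
      obtain ⟨T, hT, h⟩ := hne
      exact ⟨T, Finset.mem_filter.2 ⟨hT, h⟩⟩)
  rw [Finset.mem_filter] at hT
  have h1 := congrArg (fun v : specht μ (n * l) =>
    (v : TabloidSpace μ (n * l)) (t T).tabloid) hc
  simp only [Submodule.coe_sum, Submodule.coe_smul, WithLp.ofLp_sum, Finset.sum_apply,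
    PiLp.smul_apply, smul_eq_mul, Submodule.coe_zero, PiLp.zero_apply] at h1
  rw [Finset.sum_eq_single T] at h1
  · exact (mul_ne_zero hT.2 (invariantVector_tabloid_ne_zero (ht T))) h1
  · intro T' hT' hne'
    by_contra h2
    obtain ⟨h3, h4⟩ := mul_ne_zero_iff.1 h2
    obtain ⟨k, hk, σ, hσ, h5⟩ := exists_of_invariantVector_apply_ne_zero h4
    have h6 := hmax T' (Finset.mem_filter.2 ⟨hT', h3⟩)
    rw [h5, rowPairing_actEquiv hk] at h6
    have h7 : σ = 1 := by
      by_contra h7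
      exact absurd (rowPairing_lt (ht T') hσ h7) (not_lt.2 h6)
    subst h7
    refine hne' (Subtype.ext (eq_of_represents (ht T) (ht T') hk fun x => ?_)).symm
    exact congrArg (fun r : Tabloid μ (n * l) => ((r.1 x : Fin _) : ℕ)) h5
  · intro h
    exact absurd hT.1 h

end Kostka

/-! ### Straightening -/

section Straightening

variable {n l N : ℕ} {μ : YoungDiagram}

theorem polytabloid_trans_of_mem_columnStabilizer {t : Tableau μ N} {σ : Equiv.Perm (Fin N)}
    (hσ : σ ∈ t.columnStabilizer) :
    Tableau.polytabloid (σ.trans t) = ((Equiv.Perm.sign σ : ℤ) : ℂ) • t.polytabloid := by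
  rw [← rightAct_polytabloid]
  simp only [Tableau.polytabloid, map_sum, map_smul, rightAct_single, Finset.smul_sum]
  rw [Tableau.mem_columnStabilizer] at hσ
  refine Finset.sum_equiv (Equiv.mulRight σ) ?_ ?_
  · intro τ
    simp only [Tableau.mem_columnStabilizer, Equiv.coe_mulRight, Equiv.Perm.mul_apply]
    constructor
    · intro h x
      rw [h, hσ]
    · intro h x
      have h1 := h (σ.symm x)
      have h2 := hσ (σ.symm x)
      rw [Equiv.apply_symm_apply] at h1 h2
      rw [h1, h2]
  · intro τ _
    rw [smul_smul, Equiv.coe_mulRight, map_mul, Units.val_mul, mul_comm, Int.cast_mul, mul_assoc,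
      ← Int.cast_mul, ← Units.val_mul, Int.units_mul_self, Units.val_one, Int.cast_one, mul_one]
    rfl

/-- The Garnir relation. -/
theorem sum_polytabloid_eq_zero (t : Tableau μ N) {j : ℕ} {s : Finset (Fin N)}
    (hs : ∀ x ∈ s, j ≤ (t x).1.2) (hcard : μ.colLen j < s.card) :
    ∑ σ ∈ Finset.univ.filter (fun σ : Equiv.Perm (Fin N) => ∀ x, x ∉ s → σ x = x),
      ((Equiv.Perm.sign σ : ℤ) : ℂ) • Tableau.polytabloid (σ.trans t) = 0 := by
  simp only [← rightAct_polytabloid]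
  simp only [Tableau.polytabloid, map_sum, map_smul, rightAct_single, Finset.smul_sum]
  rw [Finset.sum_comm]
  refine Finset.sum_eq_zero fun τ hτ => ?_
  rw [Tableau.mem_columnStabilizer] at hτ
  -- After the column permutation `τ` the entries of `s` lie in columns from `j` on, hence in the
  -- first `μ.colLen j` rows, and two of them share a row. Swapping these two fixes the tabloid, so
  -- the signed sum cancels in pairs.
  obtain ⟨x, hx, y, hy, hxy, he⟩ := Finset.exists_ne_map_eq_of_card_lt_of_maps_to
    (s := s) (t := Finset.range (μ.colLen j)) (f := fun x => (t (τ x)).1.1) (by simpa using hcard)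
    (by
      intro x hx
      rw [Finset.mem_coe, Finset.mem_range]
      refine (YoungDiagram.mem_iff_lt_colLen.1 (t (τ x)).2).trans_le (μ.colLen_anti _ _ ?_)
      rw [hτ]
      exact hs x hx)
  have hswap : Tabloid.actEquiv μ N (Equiv.swap x y) (Tabloid.actEquiv μ N τ t.tabloid) =
      Tabloid.actEquiv μ N τ t.tabloid := by
    refine Subtype.ext (funext fun z => Fin.ext ?_)
    change (t (τ (Equiv.swap x y z))).1.1 = (t (τ z)).1.1
    by_cases h1 : z = x
    · subst h1
      rw [Equiv.swap_apply_left]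
      exact he.symm
    · by_cases h2 : z = y
      · subst h2
        rw [Equiv.swap_apply_right]
        exact he
      · rw [Equiv.swap_apply_of_ne_of_ne h1 h2]
  refine Finset.sum_involution (fun σ _ => Equiv.swap x y * σ) ?_ ?_ ?_ ?_
  · intro σ _
    have h1 : Tabloid.actEquiv μ N (Equiv.swap x y * σ) (Tabloid.actEquiv μ N τ t.tabloid) =
        Tabloid.actEquiv μ N σ (Tabloid.actEquiv μ N τ t.tabloid) := by
      conv_rhs => rw [← hswap]
      rfl
    rw [h1, Equiv.Perm.sign_mul, Equiv.Perm.sign_swap hxy]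
    simp
  · intro σ _ _ h
    rw [mul_eq_right, Equiv.swap_eq_one_iff] at h
    exact hxy h
  · intro σ hσ
    simp only [Finset.mem_filter, Finset.mem_univ, true_and] at hσ ⊢
    intro z hz
    rw [Equiv.Perm.mul_apply, hσ z hz, Equiv.swap_apply_of_ne_of_ne]
    · rintro rfl; exact hz hx
    · rintro rfl; exact hz hy
  · intro σ _
    rw [← mul_assoc, Equiv.swap_mul_self, one_mul]

theorem sum_mul_lt_sum_perm_mul {β : Type*} [Fintype β] [DecidableEq β] {f g : β → ℕ}
    {s : Finset β} {σ : Equiv.Perm β} (hσ : ∀ x, x ∉ s → σ x = x) (h : AntivaryOn f g s)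
    (h' : ¬ AntivaryOn (f ∘ σ) g s) : ∑ x, f x * g x < ∑ x, f (σ x) * g x := by
  have h1 := (h.sum_mul_lt_sum_comp_perm_mul_iff (σ := σ) fun x hx => by
    by_contra hxs
    exact hx (hσ x hxs)).2 h'
  rw [← Finset.sum_add_sum_compl s, ← Finset.sum_add_sum_compl s fun x => f (σ x) * g x]
  refine add_lt_add_of_lt_of_le h1 (Finset.sum_le_sum fun x hx => ?_)
  rw [hσ x (Finset.mem_compl.1 hx)]

theorem inner_polytabloid_trans {y : specht μ (n * l)} (hy : y ∈ rowInvariants μ n l)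
    {k : Equiv.Perm (Fin (n * l))} (hk : k ∈ rowGroup n l) (t : Tableau μ (n * l)) :
    inner ℂ (Tableau.polytabloid (k.trans t)) (y : TabloidSpace μ (n * l)) =
      inner ℂ t.polytabloid (y : TabloidSpace μ (n * l)) := by
  have h := congrArg (Subtype.val) (mem_rowInvariants.1 hy k hk)
  rw [spechtAct_coe] at h
  conv_lhs => rw [← h, ← rightAct_polytabloid]
  exact (rightAct μ (n * l) k).inner_map_map _ _

/-- The transposition of `a` and `b` belongs to the row group, which keeps the inner product, and to
the column stabilizer, where it changes its sign. -/
theorem inner_polytabloid_eq_zero_of_divNat_eq {y : specht μ (n * l)}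
    (hy : y ∈ rowInvariants μ n l) (t : Tableau μ (n * l)) {a b : Fin (n * l)} (hab : a ≠ b)
    (hcol : (t a).1.2 = (t b).1.2) (hdiv : a.divNat = b.divNat) :
    inner ℂ t.polytabloid (y : TabloidSpace μ (n * l)) = 0 := by
  have h1 : ∀ {γ : Type} (f : Fin (n * l) → γ), f a = f b → ∀ x, f (Equiv.swap a b x) = f x := by
    intro γ f hf x
    rw [Equiv.swap_apply_def]
    split_ifs with h1 h2
    · rw [h1, hf]
    · rw [h2, hf]
    · rfl
  have h2 := inner_polytabloid_trans hy (k := Equiv.swap a b) (h1 _ hdiv) t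
  rw [polytabloid_trans_of_mem_columnStabilizer (Tableau.mem_columnStabilizer.2
    (h1 (fun x => (t x).1.2) hcol)), Equiv.Perm.sign_swap hab, inner_smul_left] at h2
  simpa [neg_eq_self] using h2

theorem colLen_lt_card_filter {i j : ℕ} (h : (i, j + 1) ∈ μ) :
    μ.colLen j < (μ.cells.filter fun c =>
      c.2 = j ∧ i ≤ c.1 ∨ c.2 = j + 1 ∧ c.1 ≤ i).card := by
  rw [← Nat.succ_le_iff, ← Finset.card_range (μ.colLen j).succ]
  -- Row `i` is counted in both columns, as the images of `m = i` and `m = i + 1`; this supplies the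
  -- one box beyond the length of column `j`.
  refine Finset.card_le_card_of_injOn (fun m => if m ≤ i then (m, j + 1) else (m - 1, j)) ?_ ?_
  · intro m hm
    rw [Finset.mem_coe, Finset.mem_range] at hm
    rw [Finset.mem_coe, Finset.mem_filter, YoungDiagram.mem_cells]
    dsimp only
    split_ifs with h1
    · exact ⟨μ.up_left_mem h1 le_rfl h, Or.inr ⟨rfl, h1⟩⟩
    · exact ⟨YoungDiagram.mem_iff_lt_colLen.2 (by omega), Or.inl ⟨rfl, by dsimp only; omega⟩⟩
  · intro m _ m' _ hmm
    dsimp only at hmm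
    split_ifs at hmm <;> simp only [Prod.mk.injEq] at hmm <;> omega

/-- A tableau with strictly increasing columns and weakly increasing rows represents a
semistandard tableau. -/
theorem exists_represented {t : Tableau μ (n * l)}
    (hcol : ∀ a b, (t a).1.2 = (t b).1.2 → (t a).1.1 < (t b).1.1 → a.divNat < b.divNat)
    (hrow : ∀ a b, (t a).1.1 = (t b).1.1 → (t b).1.2 = (t a).1.2 + 1 → a.divNat ≤ b.divNat) :
    ∃ T : SemistandardYoungTableau μ, t.Represents T := by
  classical
  let D : ℕ → ℕ → ℕ := fun i j =>
    if h : (i, j) ∈ μ.cells then ((t.symm ⟨(i, j), h⟩).divNat : ℕ) else 0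
  have hD : ∀ x, D (t x).1.1 (t x).1.2 = (x.divNat : ℕ) := by
    intro x
    have : ((t x).1.1, (t x).1.2) ∈ μ.cells := (t x).2
    simp only [D, dif_pos this]
    congr 2
    exact t.symm_apply_apply x
  have hsurj : ∀ {i j : ℕ}, (i, j) ∈ μ → ∃ x, (t x).1 = (i, j) := fun {i j} h =>
    ⟨t.symm ⟨(i, j), h⟩, by simp⟩
  have hstep : ∀ {i j : ℕ}, (i, j + 1) ∈ μ → D i j ≤ D i (j + 1) := by
    intro i j h
    obtain ⟨a, ha⟩ := hsurj (μ.up_left_mem le_rfl (Nat.le_succ j) h)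
    obtain ⟨b, hb⟩ := hsurj h
    have h1 := hD a
    have h2 := hD b
    have h3 := hrow a b
    rw [ha] at h1 h3
    rw [hb] at h2 h3
    rw [h1, h2]
    exact h3 rfl rfl
  refine ⟨⟨D, ?_, ?_, ?_⟩, hD⟩
  · intro i j1 j2 hj h
    obtain ⟨m, rfl⟩ := Nat.exists_eq_add_of_lt hj
    clear hj
    induction m with
    | zero => exact hstep h
    | succ m ih => exact (ih (μ.up_left_mem le_rfl (by omega) h)).trans (hstep h)
  · intro i1 i2 j hi h
    obtain ⟨a, ha⟩ := hsurj (μ.up_left_mem hi.le le_rfl h)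
    obtain ⟨b, hb⟩ := hsurj h
    have h1 := hD a
    have h2 := hD b
    have h3 := hcol a b
    rw [ha] at h1 h3
    rw [hb] at h2 h3
    rw [h1, h2]
    exact h3 rfl hi
  · intro i j h
    exact dif_neg h

end Straightening

/-! ### The dimension of the invariants is a Kostka number -/

section

variable {n l : ℕ} {μ : YoungDiagram}

theorem inner_polytabloid_trans_column {t : Tableau μ (n * l)} (y : TabloidSpace μ (n * l))
    {σ : Equiv.Perm (Fin (n * l))} (hσ : σ ∈ t.columnStabilizer) :
    inner ℂ (Tableau.polytabloid (σ.trans t)) y =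
      ((Equiv.Perm.sign σ : ℤ) : ℂ) * inner ℂ t.polytabloid y := by
  rw [polytabloid_trans_of_mem_columnStabilizer hσ, inner_smul_left, map_intCast]

/-- A vector that is orthogonal to the polytabloids of all tableaux with a larger column pairing than
`t` is orthogonal to the polytabloid of `t`, if `t` has strictly increasing columns and a descent in
some row. -/
theorem inner_polytabloid_eq_zero_of_descent (y : TabloidSpace μ (n * l))
    {t : Tableau μ (n * l)}
    (hcol : ∀ a b, (t a).1.2 = (t b).1.2 → (t a).1.1 < (t b).1.1 → a.divNat < b.divNat)
    (hmax : ∀ t' : Tableau μ (n * l), inner ℂ t'.polytabloid y ≠ 0 →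
      ∑ x, (t' x).1.2 * (x.divNat : ℕ) ≤ ∑ x, (t x).1.2 * (x.divNat : ℕ))
    {a b : Fin (n * l)} (hrow : (t a).1.1 = (t b).1.1) (hab : (t b).1.2 = (t a).1.2 + 1)
    (hlt : b.divNat < a.divNat) : inner ℂ t.polytabloid y = 0 := by
  classical
  obtain ⟨i, hi⟩ : ∃ i, i = (t a).1.1 := ⟨_, rfl⟩
  obtain ⟨j, hj⟩ : ∃ j, j = (t a).1.2 := ⟨_, rfl⟩
  have hcell : (i, j + 1) ∈ μ := by
    have : ((t b).1.1, (t b).1.2) ∈ μ := (t b).2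
    rwa [hab, ← hrow, ← hi, ← hj] at this
  -- The Garnir set of the descent: column `j` from row `i` downwards together with column `j + 1`
  -- down to row `i`.
  let s : Finset (Fin (n * l)) := Finset.univ.filter fun x =>
    (t x).1.2 = j ∧ i ≤ (t x).1.1 ∨ (t x).1.2 = j + 1 ∧ (t x).1.1 ≤ i
  have hmem : ∀ x, x ∈ s ↔
      (t x).1.2 = j ∧ i ≤ (t x).1.1 ∨ (t x).1.2 = j + 1 ∧ (t x).1.1 ≤ i := fun x => by simp [s]
  have hcard : μ.colLen j < s.card := by
    have h1 := t.card_filter_cell fun c => c.2 = j ∧ i ≤ c.1 ∨ c.2 = j + 1 ∧ c.1 ≤ i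
    exact (colLen_lt_card_filter hcell).trans_eq h1.symm
  have hcol' : ∀ a b, (t a).1.2 = (t b).1.2 → (t a).1.1 ≤ (t b).1.1 → a.divNat ≤ b.divNat := by
    intro a b h1 h2
    rcases h2.lt_or_eq with h2 | h2
    · exact (hcol a b h1 h2).le
    · rw [t.injective (Subtype.ext (Prod.ext h2 h1) : t a = t b)]
  have hdesc : ∀ u ∈ s, ∀ v ∈ s, (t u).1.2 = j → (t v).1.2 = j + 1 → v.divNat < u.divNat := by
    intro u hu v hv h1 h2
    rw [hmem] at hu hv
    have h3 := hcol' a u (by omega) (by omega)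
    have h4 := hcol' v b (by omega) (by omega)
    exact h4.trans_lt (hlt.trans_le h3)
  -- All rectangular rows in the left part of `s` exceed those in the right part, so `t` has the
  -- least column pairing among the rearrangements of `s`.
  have hanti : AntivaryOn (fun x => (t x).1.2) (fun x => (x.divNat : ℕ)) s := by
    intro u hu v hv huv
    by_contra! h
    have h1 := (hmem u).1 hu
    have h2 := (hmem v).1 hv
    have h3 : v.divNat < u.divNat := hdesc u hu v hv (by omega) (by omega)
    exact absurd huv (not_lt.2 (show v.divNat ≤ u.divNat from h3.le))
  have hgarnir := congrArg (fun v => inner ℂ v y) (sum_polytabloid_eq_zero t (s := s) (j := j)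
    (fun x hx => by rw [hmem] at hx; omega) hcard)
  simp only [sum_inner, inner_smul_left, inner_zero_left, map_intCast] at hgarnir
  -- A rearrangement that changes columns raises the column pairing, so its term vanishes by `hmax`.
  -- One that keeps columns contributes a sign whose square is 1, so the Garnir relation becomes a
  -- positive multiple of the inner product for `t`.
  have hterm : ∀ σ ∈ Finset.univ.filter
      (fun σ : Equiv.Perm (Fin (n * l)) => ∀ x, x ∉ s → σ x = x),
      ((Equiv.Perm.sign σ : ℤ) : ℂ) * inner ℂ (Tableau.polytabloid (σ.trans t)) y =
        ((if σ ∈ t.columnStabilizer then 1 else 0 : ℕ) : ℂ) * inner ℂ t.polytabloid y := by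
    intro σ hσ
    rw [Finset.mem_filter] at hσ
    split_ifs with h1
    · rw [inner_polytabloid_trans_column y h1, ← mul_assoc, ← Int.cast_mul, ← Units.val_mul,
        Int.units_mul_self]
      simp
    · rw [Nat.cast_zero, zero_mul, mul_eq_zero]
      right
      by_contra h2
      refine absurd (hmax _ h2) (not_le.2 (sum_mul_lt_sum_perm_mul hσ.2 hanti fun h3 => h1 ?_))
      have hs : ∀ x ∈ s, σ x ∈ s := by
        intro x hx
        by_contra h4
        have h5 := σ.injective (hσ.2 _ h4)
        rw [h5] at h4
        exact h4 hx
      have hle : ∀ x, (t (σ x)).1.2 ≤ (t x).1.2 := by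
        by_contra! h4
        obtain ⟨x, hx⟩ := h4
        have hxs : x ∈ s := by
          by_contra h5
          rw [hσ.2 x h5] at hx
          exact lt_irrefl _ hx
        -- If some `x` moves right, some `z` must move left, since the total of the columns is
        -- preserved. As `z` has the smaller rectangular row, the pair violates antivariance.
        obtain ⟨z, hz⟩ : ∃ z, (t (σ z)).1.2 < (t z).1.2 := by
          by_contra! h5
          have h6 := Finset.sum_lt_sum (s := Finset.univ) (fun z _ => h5 z)
            ⟨x, Finset.mem_univ _, hx⟩
          rw [Equiv.sum_comp σ fun x => (t x).1.2] at h6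
          exact lt_irrefl _ h6
        have hzs : z ∈ s := by
          by_contra h5
          rw [hσ.2 z h5] at hz
          exact lt_irrefl _ hz
        have hx1 := (hmem _).1 hxs
        have hx2 := (hmem _).1 (hs x hxs)
        have hz1 := (hmem _).1 hzs
        have hz2 := (hmem _).1 (hs z hzs)
        have h7 : (z.divNat : ℕ) < (x.divNat : ℕ) :=
          hdesc x hxs z hzs (by omega) (by omega)
        have h8 := h3 hzs hxs h7
        simp only [Function.comp_apply] at h8
        omega
      rw [Tableau.mem_columnStabilizer]
      have h4 := (Finset.sum_eq_sum_iff_of_le (s := Finset.univ) fun x _ => hle x).1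
        (Equiv.sum_comp σ fun x => (t x).1.2)
      exact fun x => h4 x (Finset.mem_univ x)
  rw [Finset.sum_congr rfl hterm, ← Finset.sum_mul, ← Nat.cast_sum, mul_eq_zero,
    Nat.cast_eq_zero] at hgarnir
  refine hgarnir.resolve_left (Finset.sum_pos' (fun _ _ => Nat.zero_le _) ⟨1, ?_, ?_⟩).ne'
  · simp
  · rw [if_pos (Tableau.mem_columnStabilizer.2 fun x => rfl)]
    exact Nat.one_pos

/-- A row-invariant vector of the Specht module that is orthogonal to the polytabloids of all
tableaux representing semistandard tableaux vanishes. -/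
theorem eq_zero_of_inner_represents {y : specht μ (n * l)} (hy : y ∈ rowInvariants μ n l)
    (h : ∀ (t : Tableau μ (n * l)) (T : SemistandardYoungTableau μ), t.Represents T →
      inner ℂ t.polytabloid (y : TabloidSpace μ (n * l)) = 0) : y = 0 := by
  classical
  have key : ∀ t : Tableau μ (n * l),
      inner ℂ t.polytabloid (y : TabloidSpace μ (n * l)) = 0 := by
    by_contra! hne
    obtain ⟨t₀, ht₀⟩ := hne
    -- A counterexample is chosen with largest column pairing and, among these, largest row pairing.
    -- The second choice forces columns to increase, since swapping an inversion keeps the column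
    -- pairing; the first then forces rows to increase weakly by the Garnir argument.
    obtain ⟨t₁, ht₁, hmax₁⟩ := Finset.exists_max_image
      (Finset.univ.filter fun t : Tableau μ (n * l) =>
        inner ℂ t.polytabloid (y : TabloidSpace μ (n * l)) ≠ 0)
      (fun t => ∑ x, (t x).1.2 * (x.divNat : ℕ)) ⟨t₀, by simpa using ht₀⟩
    obtain ⟨t, ht, hmax⟩ := Finset.exists_max_image
      (Finset.univ.filter fun t : Tableau μ (n * l) =>
        inner ℂ t.polytabloid (y : TabloidSpace μ (n * l)) ≠ 0 ∧
          ∑ x, (t x).1.2 * (x.divNat : ℕ) = ∑ x, (t₁ x).1.2 * (x.divNat : ℕ))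
      (fun t => ∑ x, (t x).1.1 * (x.divNat : ℕ)) ⟨t₁, Finset.mem_filter.2
        ⟨Finset.mem_univ _, (Finset.mem_filter.1 ht₁).2, rfl⟩⟩
    simp only [Finset.mem_filter, Finset.mem_univ, true_and] at hmax₁ ht hmax
    have hcol : ∀ a b, (t a).1.2 = (t b).1.2 → (t a).1.1 < (t b).1.1 → a.divNat < b.divNat := by
      intro a b hab hlt
      by_contra! hle
      have hne : a ≠ b := by
        rintro rfl
        exact lt_irrefl _ hlt
      rcases hle.lt_or_eq with hlt' | heq
      · have hσ : Equiv.swap a b ∈ t.columnStabilizer := by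
          rw [Tableau.mem_columnStabilizer]
          intro x
          rw [Equiv.swap_apply_def]
          split_ifs with h1 h2
          · rw [h1, hab]
          · rw [h2, hab]
          · rfl
        refine absurd (hmax ((Equiv.swap a b).trans t) ⟨?_, ?_⟩) (not_le.2 ?_)
        · rw [inner_polytabloid_trans_column _ hσ]
          refine mul_ne_zero ?_ ht.1
          simp [Equiv.Perm.sign_swap hne]
        · rw [← ht.2]
          refine Finset.sum_congr rfl fun x _ => ?_
          rw [Equiv.trans_apply, Tableau.mem_columnStabilizer.1 hσ]
        · refine sum_mul_lt_sum_perm_mul (s := {a, b}) (f := fun x => (t x).1.1)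
            (g := fun x => (x.divNat : ℕ)) ?_ ?_ ?_
          · intro x hx
            simp only [Finset.mem_insert, Finset.mem_singleton, not_or] at hx
            exact Equiv.swap_apply_of_ne_of_ne hx.1 hx.2
          · intro u hu v hv huv
            simp only [Finset.coe_insert, Finset.coe_singleton, Set.mem_insert_iff,
              Set.mem_singleton_iff] at hu hv
            rcases hu with rfl | rfl <;> rcases hv with rfl | rfl
            · exact le_rfl
            · exact absurd huv (not_lt.2 (show (u.divNat : ℕ) ≥ v.divNat from hlt'.le))
            · exact hlt.le
            · exact le_rfl
          · intro h1
            have h2 := h1 (i := b) (j := a) (by simp) (by simp) hlt'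
            simp only [Function.comp_apply, Equiv.swap_apply_left, Equiv.swap_apply_right] at h2
            omega
      · exact ht.1 (inner_polytabloid_eq_zero_of_divNat_eq hy t hne hab heq.symm)
    have hrow : ∀ a b, (t a).1.1 = (t b).1.1 → (t b).1.2 = (t a).1.2 + 1 →
        a.divNat ≤ b.divNat := by
      intro a b h1 h2
      by_contra! h3
      exact ht.1 (inner_polytabloid_eq_zero_of_descent _ hcol
        (fun t' ht' => (hmax₁ t' ht').trans_eq ht.2.symm) h1 h2 h3)
    obtain ⟨T, hT⟩ := exists_represented hcol hrow
    exact ht.1 (h t T hT)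
  have hspan : ∀ v ∈ specht μ (n * l), inner ℂ v (y : TabloidSpace μ (n * l)) = 0 := by
    intro v hv
    refine Submodule.span_induction ?_ ?_ ?_ ?_ hv
    · rintro _ ⟨t, rfl⟩
      exact key t
    · exact inner_zero_left _
    · intro u v _ _ hu hv
      rw [inner_add_left, hu, hv, add_zero]
    · intro c u _ hu
      rw [inner_smul_left, hu, mul_zero]
  exact Subtype.ext (inner_self_eq_zero.1 (hspan y y.2))

/-- The independent vectors `invariantVector` give the lower bound. The upper bound holds because
pairing with one polytabloid for each semistandard tableau is injective on the invariants. -/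
theorem finrank_rowInvariants (hμ : μ.card = n * l) :
    Module.finrank ℂ (rowInvariants μ n l) = kostka μ n l := by
  classical
  choose t ht using fun T : RectTableau μ n l => exists_represents hμ T.2
  have hli : LinearIndependent ℂ fun T => (⟨(t T).invariantVector,
      spechtRowSum_mem _⟩ : rowInvariants μ n l) :=
    LinearIndependent.of_comp (rowInvariants μ n l).subtype (linearIndependent_invariantVector ht)
  -- Independence in a finite-dimensional space also shows that there are finitely many tableaux;
  -- otherwise `Nat.card` would take its default value 0.
  have hfin : Finite (RectTableau μ n l) := hli.finite
  have := Fintype.ofFinite (RectTableau μ n l)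
  rw [kostka, Nat.card_eq_fintype_card]
  refine le_antisymm ?_ hli.fintype_card_le_finrank
  let φ : rowInvariants μ n l →ₗ[ℂ] (RectTableau μ n l → ℂ) := LinearMap.pi fun T =>
    (innerSL ℂ (t T).polytabloid).toLinearMap ∘ₗ (specht μ (n * l)).subtype ∘ₗ
      (rowInvariants μ n l).subtype
  have hφ : Function.Injective φ := by
    rw [injective_iff_map_eq_zero]
    intro y hy
    refine Subtype.ext (eq_zero_of_inner_represents y.2 fun t' T hT => ?_)
    -- Two representatives of the same semistandard tableau differ by the row group, so testing
    -- against the chosen one suffices for an invariant vector.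
    obtain ⟨k, hk, hk'⟩ := exists_rowGroup_of_represents hT (ht ⟨T, hT.content⟩)
    rw [hk', inner_polytabloid_trans y.2 hk]
    exact congrFun hy ⟨T, hT.content⟩
  simpa using LinearMap.finrank_le_finrank_of_injective hφ

theorem adaptedBasis_d_eq_kostka (lam : BoundedPartition n (n * l))
    (B : AdaptedBasis lam.1 n l) : B.d = kostka lam.1 n l := by
  have hli : LinearIndependent ℂ fun i : Fin B.d => B.basis (Fin.castLE B.d_le i) :=
    B.basis.toBasis.linearIndependent.comp _ (Fin.castLE_injective B.d_le) |> fun h => by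
      simpa [Function.comp_def] using h
  rw [← finrank_rowInvariants lam.2.1, ← B.span_eq, finrank_span_eq_card hli, Fintype.card_fin]

end

end AlphaDet

theorem theorem2p4 (n l : ℕ) (hn : 0 < n) (hl : 0 < l) :
    (∀ (lam : BoundedPartition n (n * l)) (B : AdaptedBasis lam.1 n l),
      B.d = kostka lam.1 n l ∧
      ∀ (α : ℂ) (M : Type*) [AddCommGroup M] [Module (U n) M] [IsSimpleModule (U n) M],
        HasHighestWeight (n := n) M lam.1 →
        simpleMultiplicity (U n) (cyclicModule n l α) M = (B.transitionMatrix α).rank) ∧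
    (∀ (B : ∀ lam : BoundedPartition n (n * l), AdaptedBasis lam.1 n l) (α : ℂ)
      (M : BoundedPartition n (n * l) → Type*) [∀ lam, AddCommGroup (M lam)]
      [∀ lam, Module (U n) (M lam)] [∀ lam, IsSimpleModule (U n) (M lam)],
      (∀ lam, HasHighestWeight (n := n) (M lam) lam.1) →
      Nonempty (cyclicModule n l α ≃ₗ[U n]
        ⨁ lam, (Fin ((B lam).transitionMatrix α).rank → M lam))) :=
  ⟨fun lam B => ⟨adaptedBasis_d_eq_kostka lam B, fun α M _ _ _ hM =>
      simpleMultiplicity_cyclicModule lam B α M hM⟩,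
    fun B α M _ _ _ hM => nonempty_cyclicModule_equiv B α M hM⟩
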